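/- Conventions. Smooth manifolds are finite-dimensional, Hausdorff and without boundary. A $Q$-chart is a map $\pi:M\to S$ from a smooth manifold to a set such that (a) if $\pi(x)=\pi(y)$, there is a diffeomorphism $h$ from a neighbourhood of $x$ to a neighbourhood of $y$ with $h(x)=y$ and $\pi\circ h=\pi$; (b) if $f,h:T\to M$ are smooth maps from a manifold with $\pi\circ f=\pi\circ h$, then $\{f=h\}$ is open in $T$. A surjective $Q$-chart is a $Q$-atlas; a $Q$-manifold is a set with a $Q$-atlas (up to equivalence). A map is $Q$-smooth if it lifts locally to smooth maps between $Q$-atlases; $Q$-manifolds have tangent bundles $TS$ (again $Q$-manifolds), tangent maps, and Lie brackets of vector fields. A $Q$-submersion is a $Q$-smooth map with surjective tangent maps. A $Q$-group is a group that is a $Q$-manifold with $Q$-smooth multiplication and inversion. A principal $Q$-bundle $\beta:P\to M$ with structure $Q$-group $G$ over a smooth manifold $M$ is a $Q$-manifold $P$ with a free $Q$-smooth right $G$-action and a $Q$-smooth map $\beta$ whose fibres are the $G$-orbits, locally $G$-equivariantly $Q$-diffeomorphic over $M$ to $U\times G$. A morphism $(F,f,\Theta):P_1\to P_2$ consists of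 a smooth map $f:M_1\to M_2$, a $Q$-smooth group homomorphism $\Theta:G_1\to G_2$ and a $Q$-smooth map $F$ with $\beta_2\circ F=f\circ\beta_1$ and $F(pg)=F(p)\Theta(g)$. The Atiyah algebroid $\mathrm{Atiyah}(P)=(TP)/G\to M$ has the anchor induced by $T\beta$ and the bracket of $G$-invariant vector fields on $P$; a map into it is smooth iff it lifts locally to a $Q$-smooth map into $TP$. The map $\mathrm{Atiyah}(F)$ is induced by $TF$. The gauge groupoid $\mathcal G=\mathrm{Gauge}(P)=(P\times P)/G\rightrightarrows M$ has $s[p,q]=\beta(q)$, $t[p,q]=\beta(p)$, $[p,q][q,r]=[p,r]$, $1_{\beta(p)}=[p,p]$, $[p,q]^{-1}=[q,p]$, and carries the $Q$-manifold structure for which $P\times P\to(P\times P)/G$ is a $Q$-submersion; $\mathrm{Gauge}(F)[p,q]=[F(p),F(q)]$. A $Q$-groupoid is a groupoid over a smooth manifold whose arrows form a $Q$-manifold, with $s$ a $Q$-submersion and $Q$-smooth structure maps; it is locally trivial if $(s,t)$ is a surjective $Q$-submersion onto $M\times M$. Its Lie algebroid $\mathcal{AG}$ has fibres $\ker(T_{1_x}s)$,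 anchor $Tt$, and the bracket of right-invariant vector fields; a $Q$-groupoid morphism $\Phi$ induces $\mathcal A\Phi=T\Phi|_{\mathcal{AG}}$. **Theorem.** (i) For every principal $Q$-bundle $\beta:P\to M$ with structure group $G$, the set $(P\times P)/G$ has a $Q$-manifold structure for which the quotient map is a $Q$-submersion, and it is unique. With it, the gauge groupoid $\mathcal G$ is a locally trivial $Q$-groupoid, and $(TP)/G$ and $\mathcal{AG}$ are Lie algebroids over $M$. The Ehresmann map $$\mathrm{Ehr}(\beta):(TP)/G\to\mathcal A\big((P\times P)/G\big),\qquad [v]\mapsto T_p\big(p'\mapsto[p',p]\big)(v)\quad(v\in T_pP),$$ is well defined and is an isomorphism of Lie algebroids over $\mathrm{id}_M$. (ii) $\mathrm{Gauge}$, $\mathrm{Atiyah}$ and $\mathcal A\circ\mathrm{Gauge}$ are functors on the category of principal $Q$-bundles: for every morphism $(F,f,\Theta):P_1\to P_2$, $\mathrm{Gauge}(F)$ is a morphism of $Q$-groupoids over $f$, the maps $\mathrm{Atiyah}(F)$ and $\mathcal A(\mathrm{Gauge}(F))$ are morphisms of Lie algebroids over $f$, and these assignments preserve identities and compositions. The Ehresmann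 map is natural: $$\mathrm{Ehr}(\beta_2)\circ\mathrm{Atiyah}(F)=\mathcal A(\mathrm{Gauge}(F))\circ\mathrm{Ehr}(\beta_1).$$ Hence $\mathrm{Ehr}$ is an isomorphism between the functors $\mathcal A\circ\mathrm{Gauge}$ and $\mathrm{Atiyah}$. -/

import Mathlib

open scoped Manifold ContDiff Topology CategoryTheory
universe u

/-- A smooth manifold: finite-dimensional, Hausdorff, without boundary, modelled on one vector space
(second countability and connectedness are not required). -/
structure SmoothMfd : Type (u + 1) where
  E : Type u
  H : Type u
  carrier : Type u
  [normedE : NormedAddCommGroup E]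
  [spaceE : NormedSpace ℝ E]
  [finE : FiniteDimensional ℝ E]
  [topH : TopologicalSpace H]
  I : ModelWithCorners ℝ E H
  [bdry : I.Boundaryless]
  [top : TopologicalSpace carrier]
  [charted : ChartedSpace H carrier]
  [smooth : IsManifold I ∞ carrier]
  [t2 : T2Space carrier]

namespace SmoothMfd

instance : CoeSort SmoothMfd.{u} (Type u) := ⟨SmoothMfd.carrier⟩

attribute [instance] normedE spaceE finE topH bdry top charted smooth t2

/-- An open subset, as a manifold. -/
noncomputable def ofOpens (M : SmoothMfd.{u}) (U : TopologicalSpace.Opens M) : SmoothMfd.{u} where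
  E := M.E
  H := M.H
  carrier := U
  I := M.I

/-- The product of two manifolds. -/
noncomputable def prod (M N : SmoothMfd.{u}) : SmoothMfd.{u} where
  E := M.E × N.E
  H := ModelProd M.H N.H
  carrier := M × N
  I := M.I.prod N.I

theorem t2Space_tangentBundle (M : SmoothMfd.{u}) : T2Space (TangentBundle M.I M) := by
  refine ⟨fun x y hxy => ?_⟩
  have hc : Continuous (Bundle.TotalSpace.proj : TangentBundle M.I M → M) :=
    FiberBundle.continuous_proj M.E (TangentSpace M.I)
  by_cases h : x.proj = y.proj
  · let e := trivializationAt M.E (TangentSpace M.I) x.proj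
    have hx : x ∈ e.source := FiberBundle.mem_trivializationAt_proj_source
    have hy : y ∈ e.source := by
      rw [e.mem_source, ← h]; exact FiberBundle.mem_baseSet_trivializationAt' x.proj
    have hne : e x ≠ e y := fun he => hxy (e.injOn hx hy he)
    obtain ⟨A, B, hA, hB, hxA, hyB, hAB⟩ := t2_separation hne
    refine ⟨e.source ∩ e ⁻¹' A, e.source ∩ e ⁻¹' B,
      e.continuousOn.isOpen_inter_preimage e.open_source hA,
      e.continuousOn.isOpen_inter_preimage e.open_source hB, ⟨hx, hxA⟩, ⟨hy, hyB⟩, ?_⟩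
    exact Set.disjoint_left.2 fun z hz hz' => Set.disjoint_left.1 hAB hz.2 hz'.2
  · obtain ⟨A, B, hA, hB, hxA, hyB, hAB⟩ := t2_separation h
    exact ⟨_, _, hA.preimage hc, hB.preimage hc, hxA, hyB, hAB.preimage _⟩

/-- The tangent bundle, as a manifold. -/
noncomputable def tangent (M : SmoothMfd.{u}) : SmoothMfd.{u} where
  E := M.E × M.E
  H := ModelProd M.H M.E
  carrier := TangentBundle M.I M
  I := M.I.tangent
  t2 := M.t2Space_tangentBundle

end SmoothMfd

/-- `π : M → S` is a Q-chart.
`transverse`: points of the same fibre are related by a local diffeomorphism `h` of `M` with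
`π ∘ h = π` on its (open) domain.
`isOpen_eq`: if two smooth maps `f`, `h` from a manifold into `M` have `π ∘ f = π ∘ h`, then
the set where they agree is open. -/
structure IsQChart (M : SmoothMfd.{u}) {S : Type u} (π : M → S) : Prop where
  transverse : ∀ x y : M, π x = π y → ∃ h : OpenPartialHomeomorph M M,
    x ∈ h.source ∧ h x = y ∧ ContMDiffOn M.I M.I ∞ h h.source ∧
      ContMDiffOn M.I M.I ∞ h.symm h.target ∧ ∀ z ∈ h.source, π (h z) = π z
  isOpen_eq : ∀ (T : SmoothMfd.{u}) (f h : T → M), ContMDiff T.I M.I ∞ f →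
    ContMDiff T.I M.I ∞ h → π ∘ f = π ∘ h → IsOpen {t | f t = h t}

/-- A Q-manifold structure on the set `S`: a Q-atlas, that is a surjective Q-chart `π : M → S`.
Surjectivity is recorded by a set-theoretic choice `out` of a preimage of every point. The choice only serves
to have a concrete model of the tangent spaces of `S`; no continuity is asked of it. -/
structure QStr (S : Type u) where
  M : SmoothMfd.{u}
  π : M → S
  isQChart : IsQChart M π
  out : S → M
  π_out : ∀ s, π (out s) = s

/-- A smooth manifold as a Q-manifold, with the identity map as Q-atlas. -/
noncomputable def SmoothMfd.toQ (M : SmoothMfd.{u}) : QStr M where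
  M := M
  π := id
  isQChart :=
    { transverse := by
        rintro x y rfl
        exact ⟨OpenPartialHomeomorph.refl M, trivial, rfl, contMDiff_id.contMDiffOn,
          contMDiff_id.contMDiffOn, fun _ _ => rfl⟩
      isOpen_eq := by
        intro T f h hf hh e
        have : f = h := e
        simp [this] }
  out := id
  π_out _ := rfl

section
variable {S₁ S₂ S₃ : Type u} (Q₁ : QStr S₁) (Q₂ : QStr S₂) (Q₃ : QStr S₃)

/-- `f` is Q-smooth on `V`: near every point of the atlas above `V` it has a smooth lift
through the atlases. (By transversality of Q-charts one may prescribe the value of the lift at one point, and the notion does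
not change if an atlas is replaced by an equivalent one.) -/
def QSmoothOn (f : S₁ → S₂) (V : Set S₁) : Prop :=
  ∀ m : Q₁.M, Q₁.π m ∈ V → ∃ (U : Set Q₁.M) (g : Q₁.M → Q₂.M), IsOpen U ∧ m ∈ U ∧
    ContMDiffOn Q₁.M.I Q₂.M.I ∞ g U ∧ ∀ z ∈ U, Q₂.π (g z) = f (Q₁.π z)

/-- Q-smooth maps. -/
def QSmooth (f : S₁ → S₂) : Prop := QSmoothOn Q₁ Q₂ f Set.univ

/-- The tangent space `T_s S`, realised as the tangent space of the atlas at the chosen preimage of `s`.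
It is canonically identified by `tmapAt Q.M.toQ Q Q.π m` with the tangent space of the atlas at any other preimage `m`. -/
abbrev QStr.TSpace {S : Type u} (Q : QStr S) (s : S) : Type u := TangentSpace Q.M.I (Q.out s)

/-- `g` is a smooth local lift of `f` near the chosen preimage of `s`, and it sends this preimage to
the chosen preimage of `f s`. -/
structure IsLiftAt (f : S₁ → S₂) (s : S₁) (g : Q₁.M → Q₂.M) : Prop where
  base : g (Q₁.out s) = Q₂.out (f s)
  lift : ∃ U : Set Q₁.M, IsOpen U ∧ Q₁.out s ∈ U ∧ ContMDiffOn Q₁.M.I Q₂.M.I ∞ g U ∧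
    ∀ z ∈ U, Q₂.π (g z) = f (Q₁.π z)

open Classical in
/-- The tangent map `T_s f : T_s S₁ → T_{f s} S₂`, the derivative of any smooth lift as in `IsLiftAt`
(all have the same germ, see `IsLiftAt.tmapAt_eq`, and they exist if `f` is Q-smooth near `s`). -/
noncomputable def tmapAt (f : S₁ → S₂) (s : S₁) : Q₁.TSpace s →L[ℝ] Q₂.TSpace (f s) :=
  if h : ∃ g, IsLiftAt Q₁ Q₂ f s g then mfderiv Q₁.M.I Q₂.M.I h.choose (Q₁.out s) else 0

variable {Q₁ Q₂ Q₃}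

theorem QStr.eventuallyEq_of_lift {T : SmoothMfd.{u}} (Q : QStr S₂) {g g' : T → Q.M} {U : Set T} {m : T}
    (hU : IsOpen U) (hm : m ∈ U) (hg : ContMDiffOn T.I Q.M.I ∞ g U)
    (hg' : ContMDiffOn T.I Q.M.I ∞ g' U) (h : ∀ z ∈ U, Q.π (g z) = Q.π (g' z))
    (e : g m = g' m) : g =ᶠ[𝓝 m] g' := by
  let O : TopologicalSpace.Opens T := ⟨U, hU⟩
  have hv : ContMDiff T.I T.I ∞ (Subtype.val : O → T) := contMDiff_subtype_val
  have := Q.isQChart.isOpen_eq (T.ofOpens O) (fun z : O => g z) (fun z : O => g' z)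
    (hg.comp_contMDiff hv fun z => z.2)
    (hg'.comp_contMDiff hv fun z => z.2) (funext fun z : O => h z z.2)
  have h2 := (hU.isOpenMap_subtype_val _ this)
  refine Filter.mem_of_superset (h2.mem_nhds ⟨⟨m, hm⟩, e, rfl⟩) ?_
  rintro _ ⟨z, hz, rfl⟩
  exact hz

theorem QSmoothOn.exists_isLiftAt {f : S₁ → S₂} {V : Set S₁} (hf : QSmoothOn Q₁ Q₂ f V) {s : S₁}
    (hs : s ∈ V) : ∃ g, IsLiftAt Q₁ Q₂ f s g := by
  obtain ⟨U, g, hU, hm, hg, hl⟩ := hf (Q₁.out s) (by rwa [Q₁.π_out])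
  obtain ⟨h, hx, hy, hh, -, hπ⟩ := Q₂.isQChart.transverse (g (Q₁.out s)) (Q₂.out (f s))
    (by rw [hl _ hm, Q₁.π_out, Q₂.π_out])
  refine ⟨h ∘ g, hy, U ∩ g ⁻¹' h.source, hg.continuousOn.isOpen_inter_preimage hU h.open_source,
    ⟨hm, hx⟩, hh.comp (hg.mono Set.inter_subset_left) Set.inter_subset_right, ?_⟩
  rintro z ⟨hz, hz'⟩
  rw [Function.comp, hπ _ hz', hl _ hz]

theorem IsLiftAt.tmapAt_eq {f : S₁ → S₂} {s : S₁} {g : Q₁.M → Q₂.M} (hg : IsLiftAt Q₁ Q₂ f s g) :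
    tmapAt Q₁ Q₂ f s = mfderiv Q₁.M.I Q₂.M.I g (Q₁.out s) := by
  have h : ∃ g, IsLiftAt Q₁ Q₂ f s g := ⟨g, hg⟩
  refine Eq.trans (dif_pos h) ?_
  obtain ⟨U, hU, hm, hs, hl⟩ := hg.lift
  obtain ⟨U', hU', hm', hs', hl'⟩ := h.choose_spec.lift
  apply Filter.EventuallyEq.mfderiv_eq
  refine Q₂.eventuallyEq_of_lift (hU'.inter hU) ⟨hm', hm⟩ (hs'.mono Set.inter_subset_left)
    (hs.mono Set.inter_subset_right) (fun z hz => ?_) (h.choose_spec.base.trans hg.base.symm)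
  rw [hl' z hz.1, hl z hz.2]

theorem IsLiftAt.mdifferentiableAt {f : S₁ → S₂} {s : S₁} {g : Q₁.M → Q₂.M}
    (hg : IsLiftAt Q₁ Q₂ f s g) : MDifferentiableAt Q₁.M.I Q₂.M.I g (Q₁.out s) := by
  obtain ⟨U, hU, hm, hs, hl⟩ := hg.lift
  exact (hs.contMDiffAt (hU.mem_nhds hm)).mdifferentiableAt (by simp)

theorem IsLiftAt.comp {f : S₁ → S₂} {f' : S₂ → S₃} {s : S₁} {g : Q₁.M → Q₂.M} {g' : Q₂.M → Q₃.M}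
    (hg' : IsLiftAt Q₂ Q₃ f' (f s) g') (hg : IsLiftAt Q₁ Q₂ f s g) :
    IsLiftAt Q₁ Q₃ (fun x => f' (f x)) s (g' ∘ g) := by
  obtain ⟨U, hU, hm, hs, hl⟩ := hg.lift
  obtain ⟨U', hU', hm', hs', hl'⟩ := hg'.lift
  refine ⟨by rw [Function.comp, hg.base, hg'.base], U ∩ g ⁻¹' U',
    hs.continuousOn.isOpen_inter_preimage hU hU', ⟨hm, ?_⟩,
    hs'.comp (hs.mono Set.inter_subset_left) Set.inter_subset_right, ?_⟩
  · rw [Set.mem_preimage, hg.base]; exact hm'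
  · rintro z ⟨hz, hz'⟩
    rw [Function.comp, hl' _ hz', hl _ hz]

theorem tmapAt_comp {f : S₁ → S₂} {f' : S₂ → S₃} {s : S₁} (hf' : ∃ g, IsLiftAt Q₂ Q₃ f' (f s) g)
    (hf : ∃ g, IsLiftAt Q₁ Q₂ f s g) (v : Q₁.TSpace s) :
    tmapAt Q₁ Q₃ (fun x => f' (f x)) s v = tmapAt Q₂ Q₃ f' (f s) (tmapAt Q₁ Q₂ f s v) := by
  obtain ⟨g, hg⟩ := hf
  obtain ⟨g', hg'⟩ := hf'
  rw [(hg'.comp hg).tmapAt_eq, hg.tmapAt_eq, hg'.tmapAt_eq]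
  have h := mfderiv_comp (Q₁.out s) (I' := Q₂.M.I) (by rw [hg.base]; exact hg'.mdifferentiableAt) hg.mdifferentiableAt
  rw [h, hg.base]
  rfl

end

section
variable {S₁ S₂ S₃ : Type u}

/-- The product of two Q-manifolds. -/
noncomputable def QStr.prod (Q₁ : QStr S₁) (Q₂ : QStr S₂) : QStr (S₁ × S₂) where
  M := Q₁.M.prod Q₂.M
  π := fun m => (Q₁.π m.1, Q₂.π m.2)
  out := fun s => (Q₁.out s.1, Q₂.out s.2)
  π_out := fun s => Prod.ext (Q₁.π_out _) (Q₂.π_out _)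
  isQChart :=
    { transverse := by
        rintro ⟨x, x'⟩ ⟨y, y'⟩ e
        obtain ⟨h, hx, hy, hs, ht, hπ⟩ := Q₁.isQChart.transverse x y (congrArg Prod.fst e)
        obtain ⟨k, kx, ky, ks, kt, kπ⟩ := Q₂.isQChart.transverse x' y' (congrArg Prod.snd e)
        refine ⟨h.prod k, ⟨hx, kx⟩, Prod.ext hy ky, hs.prodMap ks, ht.prodMap kt, ?_⟩
        rintro ⟨z, z'⟩ ⟨hz, hz'⟩
        exact Prod.ext (hπ z hz) (kπ z' hz')
      isOpen_eq := by
        intro T f h hf hh e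
        have h₁ := Q₁.isQChart.isOpen_eq T (fun t => (f t).1) (fun t => (h t).1)
          (contMDiff_fst.comp hf) (contMDiff_fst.comp hh)
          (funext fun t => congrArg Prod.fst (congrFun e t))
        have h₂ := Q₂.isQChart.isOpen_eq T (fun t => (f t).2) (fun t => (h t).2)
          (contMDiff_snd.comp hf) (contMDiff_snd.comp hh)
          (funext fun t => congrArg Prod.snd (congrFun e t))
        have : {t | f t = h t} = {t | (f t).1 = (h t).1} ∩ {t | (f t).2 = (h t).2} :=
          Set.ext fun t => Prod.ext_iff
        rw [this]
        exact h₁.inter h₂ }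

/-- The tangent bundle `TS` of a Q-manifold, as a set. -/
def QStr.TB {S : Type u} (Q : QStr S) : Type u := Σ s, Q.TSpace s

/-- The tangent map `Tf : TS₁ → TS₂`. -/
noncomputable def tmap (Q₁ : QStr S₁) (Q₂ : QStr S₂) (f : S₁ → S₂) (w : Q₁.TB) : Q₂.TB :=
  ⟨f w.1, tmapAt Q₁ Q₂ f w.1 w.2⟩

theorem QStr.mdifferentiable_of_contMDiffOn {M N : SmoothMfd.{u}} {h : OpenPartialHomeomorph M N}
    (hs : ContMDiffOn M.I N.I ∞ h h.source) (ht : ContMDiffOn N.I M.I ∞ h.symm h.target) :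
    h.MDifferentiable M.I N.I :=
  ⟨hs.mdifferentiableOn (by simp), ht.mdifferentiableOn (by simp)⟩

theorem QStr.qSmooth_π {S : Type u} (Q : QStr S) : QSmooth Q.M.toQ Q Q.π :=
  fun _ _ => ⟨Set.univ, id, isOpen_univ, trivial, contMDiffOn_id, fun _ _ => rfl⟩

theorem QStr.bijective_tmapAt_π {S : Type u} (Q : QStr S) (m : Q.M) :
    Function.Bijective (tmapAt Q.M.toQ Q Q.π m) := by
  obtain ⟨h, hx, hy, hs, ht, hπ⟩ := Q.isQChart.transverse m (Q.out (Q.π m)) (Q.π_out _).symm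
  have hl : IsLiftAt Q.M.toQ Q Q.π m h := ⟨hy, h.source, h.open_source, hx, hs, hπ⟩
  rw [hl.tmapAt_eq]
  exact (QStr.mdifferentiable_of_contMDiffOn hs ht).mfderiv_bijective hx

theorem QStr.tmapAt_π_comp {S : Type u} (Q : QStr S) (h : OpenPartialHomeomorph Q.M Q.M)
    (hs : ContMDiffOn Q.M.I Q.M.I ∞ h h.source) (hπ : ∀ z ∈ h.source, Q.π (h z) = Q.π z)
    {z : Q.M} (hz : z ∈ h.source) (v : TangentSpace Q.M.I z) :
    (⟨Q.π (h z), tmapAt Q.M.toQ Q Q.π (h z) (mfderiv Q.M.I Q.M.I h z v)⟩ : Q.TB) =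
      ⟨Q.π z, tmapAt Q.M.toQ Q Q.π z v⟩ := by
  have hi : ∃ g, IsLiftAt Q.M.toQ Q Q.π (h z) g :=
    Q.qSmooth_π.exists_isLiftAt trivial
  have hl : IsLiftAt Q.M.toQ Q.M.toQ h z h :=
    ⟨rfl, h.source, h.open_source, hz, hs, fun _ _ => rfl⟩
  have h1 := tmapAt_comp hi ⟨_, hl⟩ v
  rw [hl.tmapAt_eq] at h1
  obtain ⟨g, hg⟩ := hi
  have hl' : IsLiftAt Q.M.toQ Q Q.π z (g ∘ h) := by
    obtain ⟨b, U, hU, hm, hc, hg⟩ := hg.comp hl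
    exact ⟨by rw [b, hπ z hz], U ∩ h.source, hU.inter h.open_source, ⟨hm, hz⟩,
      hc.mono Set.inter_subset_left, fun y hy => (hg y hy.1).trans (hπ y hy.2)⟩
  refine Sigma.ext (hπ z hz) (heq_of_eq ?_)
  rw [hl'.tmapAt_eq]
  refine h1.symm.trans ?_
  exact congrArg (fun L => L v) (hg.comp hl).tmapAt_eq

theorem contMDiffOn_tangentMap_of_isOpen {M N : SmoothMfd.{u}} {h : M → N} {U : Set M} (hU : IsOpen U)
    (hs : ContMDiffOn M.I N.I ∞ h U) :
    ContMDiffOn M.I.tangent N.I.tangent ∞ (tangentMap M.I N.I h)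
      ((fun p : TangentBundle M.I M => p.proj) ⁻¹' U) := by
  refine (hs.contMDiffOn_tangentMapWithin (m := ∞) (by simp) hU.uniqueMDiffOn).congr ?_
  intro p hp
  exact (tangentMapWithin_eq_tangentMap (hU.uniqueMDiffOn _ hp)
    ((hs.mdifferentiableOn (by simp) _ hp).mdifferentiableAt (hU.mem_nhds hp))).symm

theorem tangentMap_symm_tangentMap {M N : SmoothMfd.{u}} {h : OpenPartialHomeomorph M N}
    (hs : ContMDiffOn M.I N.I ∞ h h.source) (ht : ContMDiffOn N.I M.I ∞ h.symm h.target)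
    {p : TangentBundle M.I M} (hp : p.proj ∈ h.source) :
    tangentMap N.I M.I h.symm (tangentMap M.I N.I h p) = p := by
  have he := QStr.mdifferentiable_of_contMDiffOn hs ht
  obtain ⟨x, v⟩ := p
  have h1 : h.symm (h x) = x := h.left_inv hp
  refine Bundle.TotalSpace.ext h1 (heq_of_eq ?_)
  exact congrArg (fun L => L v) (he.symm_comp_deriv hp)

/-- The tangent map of a local diffeomorphism, as a local homeomorphism of the tangent bundles. -/
noncomputable def tangentHomeo {M N : SmoothMfd.{u}} (h : OpenPartialHomeomorph M N)
    (hs : ContMDiffOn M.I N.I ∞ h h.source) (ht : ContMDiffOn N.I M.I ∞ h.symm h.target) :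
    OpenPartialHomeomorph M.tangent N.tangent where
  toFun := tangentMap M.I N.I h
  invFun := tangentMap N.I M.I h.symm
  source := (fun p : TangentBundle M.I M => p.proj) ⁻¹' h.source
  target := (fun p : TangentBundle N.I N => p.proj) ⁻¹' h.target
  map_source' := fun _ hp => h.map_source hp
  map_target' := fun _ hp => h.map_target hp
  left_inv' := fun _ hp => tangentMap_symm_tangentMap hs ht hp
  right_inv' := fun _ hp => tangentMap_symm_tangentMap (h := h.symm) ht hs hp
  open_source := h.open_source.preimage (FiberBundle.continuous_proj M.E (TangentSpace M.I))
  open_target := h.open_target.preimage (FiberBundle.continuous_proj N.E (TangentSpace N.I))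
  continuousOn_toFun := (contMDiffOn_tangentMap_of_isOpen h.open_source hs).continuousOn
  continuousOn_invFun := (contMDiffOn_tangentMap_of_isOpen h.open_target ht).continuousOn

/-- The tangent bundle `TS` as a Q-manifold: its Q-atlas is the tangent map of the Q-atlas of `S`. -/
noncomputable def QStr.tangent {S : Type u} (Q : QStr S) : QStr Q.TB where
  M := Q.M.tangent
  π := fun p => tmap Q.M.toQ Q Q.π ⟨p.proj, p.2⟩
  out := fun w => (⟨Q.out w.1, w.2⟩ : TangentBundle Q.M.I Q.M)
  π_out := by
    rintro ⟨s, v⟩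
    refine Sigma.ext (Q.π_out s) (heq_of_eq ?_)
    have hl : IsLiftAt Q.M.toQ Q Q.π (Q.out s) id :=
      ⟨congrArg Q.out (Q.π_out s).symm, Set.univ, isOpen_univ, trivial, contMDiffOn_id,
        fun _ _ => rfl⟩
    refine (congrArg (fun L => L v) hl.tmapAt_eq).trans ?_
    exact congrArg (fun L => L v) (mfderiv_id (I := Q.M.I) (x := Q.out s))
  isQChart :=
    { transverse := by
        rintro ⟨m, v⟩ ⟨m', v'⟩ e
        obtain ⟨h, hx, rfl, hs, ht, hπ⟩ := Q.isQChart.transverse m m' (congrArg Sigma.fst e)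
        refine ⟨tangentHomeo h hs ht, hx, ?_, contMDiffOn_tangentMap_of_isOpen h.open_source hs,
          contMDiffOn_tangentMap_of_isOpen h.open_target ht, ?_⟩
        · have := (Q.tmapAt_π_comp h hs hπ hx v).trans e
          have := eq_of_heq (Sigma.mk.inj this).2
          have := (Q.bijective_tmapAt_π _).1 this
          exact congrArg (Bundle.TotalSpace.mk _) this
        · rintro ⟨z, w⟩ hz
          exact Q.tmapAt_π_comp h hs hπ hz w
      isOpen_eq := by
        intro T f h hf hh e
        have hp : ContMDiff Q.M.I.tangent Q.M.I ∞ (fun p : TangentBundle Q.M.I Q.M => p.proj) :=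
          Bundle.contMDiff_proj _
        have := Q.isQChart.isOpen_eq T (fun t => (f t).proj) (fun t => (h t).proj)
          (hp.comp hf) (hp.comp hh) (funext fun t => congrArg Sigma.fst (congrFun e t))
        convert this using 1
        ext t
        refine ⟨fun ht => congrArg Bundle.TotalSpace.proj ht, fun ht => ?_⟩
        have et := congrFun e t
        simp only [Set.mem_ofPred_eq, Function.comp] at ht et ⊢
        generalize f t = a at ht et
        generalize h t = b at ht et
        obtain ⟨a, v⟩ := a
        obtain ⟨b, w⟩ := b
        obtain rfl : a = b := ht
        have := eq_of_heq (Sigma.mk.inj et).2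
        exact congrArg (Bundle.TotalSpace.mk _) ((Q.bijective_tmapAt_π _).1 this) }
end

section
variable {S₁ S₂ S₃ : Type u} {Q₁ : QStr S₁} {Q₂ : QStr S₂} {Q₃ : QStr S₃}

theorem QSmooth.comp {f : S₁ → S₂} {f' : S₂ → S₃} (hf' : QSmooth Q₂ Q₃ f')
    (hf : QSmooth Q₁ Q₂ f) : QSmooth Q₁ Q₃ (fun x => f' (f x)) := by
  intro m _
  obtain ⟨U, g, hU, hm, hg, hl⟩ := hf m trivial
  obtain ⟨U', g', hU', hm', hg', hl'⟩ := hf' (g m) trivial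
  refine ⟨U ∩ g ⁻¹' U', g' ∘ g, hg.continuousOn.isOpen_inter_preimage hU hU', ⟨hm, hm'⟩,
    hg'.comp (hg.mono Set.inter_subset_left) Set.inter_subset_right, ?_⟩
  rintro z ⟨hz, hz'⟩
  rw [Function.comp, hl' _ hz', hl _ hz]

theorem qSmooth_id (Q : QStr S₁) : QSmooth Q Q (fun x => x) :=
  fun _ _ => ⟨Set.univ, id, isOpen_univ, trivial, contMDiffOn_id, fun _ _ => rfl⟩

theorem qSmooth_const (Q : QStr S₁) (Q' : QStr S₂) (c : S₂) : QSmooth Q Q' (fun _ => c) :=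
  fun _ _ => ⟨Set.univ, fun _ => Q'.out c, isOpen_univ, trivial, contMDiffOn_const,
    fun _ _ => Q'.π_out c⟩

theorem QSmooth.prodMk {f : S₁ → S₂} {f' : S₁ → S₃} (hf : QSmooth Q₁ Q₂ f)
    (hf' : QSmooth Q₁ Q₃ f') : QSmooth Q₁ (Q₂.prod Q₃) (fun x => (f x, f' x)) := by
  intro m _
  obtain ⟨U, g, hU, hm, hg, hl⟩ := hf m trivial
  obtain ⟨U', g', hU', hm', hg', hl'⟩ := hf' m trivial
  exact ⟨U ∩ U', fun z => (g z, g' z), hU.inter hU', ⟨hm, hm'⟩,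
    (hg.mono Set.inter_subset_left).prodMk (hg'.mono Set.inter_subset_right),
    fun z hz => Prod.ext (hl z hz.1) (hl' z hz.2)⟩

theorem ContMDiff.qSmooth {M N : SmoothMfd.{u}} {f : M → N} (hf : ContMDiff M.I N.I ∞ f) :
    QSmooth M.toQ N.toQ f :=
  fun _ _ => ⟨Set.univ, f, isOpen_univ, trivial, hf.contMDiffOn, fun _ _ => rfl⟩

theorem tmap_comp {f : S₁ → S₂} {f' : S₂ → S₃} (hf' : QSmooth Q₂ Q₃ f') (hf : QSmooth Q₁ Q₂ f)
    (w : Q₁.TB) : tmap Q₁ Q₃ (fun x => f' (f x)) w = tmap Q₂ Q₃ f' (tmap Q₁ Q₂ f w) :=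
  Sigma.ext rfl (heq_of_eq (tmapAt_comp (hf'.exists_isLiftAt trivial) (hf.exists_isLiftAt trivial) _))

theorem tmap_id (Q : QStr S₁) (w : Q.TB) : tmap Q Q (fun x => x) w = w := by
  have hl : IsLiftAt Q Q (fun x => x) w.1 id :=
    ⟨rfl, Set.univ, isOpen_univ, trivial, contMDiffOn_id, fun _ _ => rfl⟩
  refine Sigma.ext rfl (heq_of_eq ?_)
  refine (congrArg (fun L => L w.2) hl.tmapAt_eq).trans ?_
  rw [mfderiv_id]
  rfl

theorem tmapAt_const (Q : QStr S₁) (Q' : QStr S₂) (c : S₂) (s : S₁) :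
    tmapAt Q Q' (fun _ => c) s = 0 := by
  have hl : IsLiftAt Q Q' (fun _ => c) s (fun _ => Q'.out c) :=
    ⟨rfl, Set.univ, isOpen_univ, trivial, contMDiffOn_const, fun _ _ => Q'.π_out c⟩
  refine hl.tmapAt_eq.trans ?_
  exact mfderiv_const

/-- The vector part of `w ∈ TS`, transported along an equality of base points. -/
def QStr.TB.vecAt {Q : QStr S₁} (w : Q.TB) {s : S₁} (h : w.1 = s) : Q.TSpace s := h ▸ w.2

theorem QStr.TB.mk_vecAt {Q : QStr S₁} (w : Q.TB) {s : S₁} (h : w.1 = s) :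
    (⟨s, w.vecAt h⟩ : Q.TB) = w := by
  subst h; rfl

/-- Q-submersions: Q-smooth maps whose tangent maps are surjective. -/
def IsQSubmersion (Q₁ : QStr S₁) (Q₂ : QStr S₂) (f : S₁ → S₂) : Prop :=
  QSmooth Q₁ Q₂ f ∧ ∀ s, Function.Surjective (tmapAt Q₁ Q₂ f s)

/-- Smooth vector fields on a Q-manifold: Q-smooth sections of the tangent bundle. -/
def QStr.IsSmoothField (Q : QStr S₁) (X : ∀ s, Q.TSpace s) : Prop :=
  QSmooth Q Q.tangent (fun s => (⟨s, X s⟩ : Q.TB))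

/-- The vector field on the Q-atlas `π : M → S` that is `π`-related to the vector field `X` on `S`. -/
noncomputable def QStr.liftField (Q : QStr S₁) (X : ∀ s, Q.TSpace s) (m : Q.M) :
    TangentSpace Q.M.I m :=
  (Equiv.ofBijective _ (Q.bijective_tmapAt_π m)).symm (X (Q.π m))

/-- The Lie bracket of vector fields on a Q-manifold, computed in the Q-atlas. -/
noncomputable def QStr.lieBracket (Q : QStr S₁) (X Y : ∀ s, Q.TSpace s) (s : S₁) : Q.TSpace s :=
  VectorField.mlieBracket Q.M.I (Q.liftField X) (Q.liftField Y) (Q.out s)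

end

/-- A Q-group: a group with a Q-manifold structure for which the multiplication and the inversion are Q-smooth. -/
structure QGroup : Type (u + 1) where
  carrier : Type u
  [group : Group carrier]
  Q : QStr carrier
  smooth_mul : QSmooth (Q.prod Q) Q (fun x => x.1 * x.2)
  smooth_inv : QSmooth Q Q (fun x => x⁻¹)

instance : CoeSort QGroup.{u} (Type u) := ⟨QGroup.carrier⟩
attribute [instance] QGroup.group

/-- A principal Q-bundle `β : P → N` over a smooth manifold, whose structure group `G` is a Q-group acting on
`P` from the right: the action is free and Q-smooth, its orbits are the fibres of `β`, and `β` is locally trivial, with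
equivariant local trivializations `ψ : β⁻¹(U) → U × G` that are Q-diffeomorphisms. -/
structure PrincipalQBundle : Type (u + 1) where
  N : SmoothMfd.{u}
  G : QGroup.{u}
  P : Type u
  Q : QStr P
  β : P → N
  act : P → G → P
  act_one : ∀ p, act p 1 = p
  act_mul : ∀ p g h, act p (g * h) = act (act p g) h
  act_free : ∀ p g, act p g = p → g = 1
  smooth_act : QSmooth (Q.prod G.Q) Q (fun x => act x.1 x.2)
  smooth_β : QSmooth Q N.toQ β
  fiber_eq : ∀ p q, β q = β p ↔ ∃ g, act p g = q
  locallyTrivial : ∀ n : N, ∃ (U : Set N) (ψ : PartialEquiv P (N × G)), IsOpen U ∧ n ∈ U ∧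
    ψ.source = β ⁻¹' U ∧ ψ.target = U ×ˢ Set.univ ∧
    QSmoothOn Q (N.toQ.prod G.Q) ψ ψ.source ∧ QSmoothOn (N.toQ.prod G.Q) Q ψ.symm ψ.target ∧
    ∀ p ∈ ψ.source, (ψ p).1 = β p ∧ ∀ g, ψ (act p g) = (β p, (ψ p).2 * g)

namespace PrincipalQBundle

/-- A morphism `(F, f, Θ)` of principal Q-bundles: `F` is equivariant along the morphism of Q-groups `Θ` and
covers `f`. -/
@[ext]
structure Hom (P₁ P₂ : PrincipalQBundle.{u}) : Type u where
  f : P₁.N → P₂.N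
  Θ : P₁.G →* P₂.G
  F : P₁.P → P₂.P
  smooth_f : ContMDiff P₁.N.I P₂.N.I ∞ f
  smooth_Θ : QSmooth P₁.G.Q P₂.G.Q Θ
  smooth_F : QSmooth P₁.Q P₂.Q F
  comm : ∀ p, P₂.β (F p) = f (P₁.β p)
  equivariant : ∀ p g, F (P₁.act p g) = P₂.act (F p) (Θ g)

/-- The category of principal Q-bundles. -/
instance : CategoryTheory.Category PrincipalQBundle.{u} where
  Hom := Hom
  id P :=
    { f := id, Θ := MonoidHom.id _, F := id, smooth_f := contMDiff_id, smooth_Θ := qSmooth_id _,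
      smooth_F := qSmooth_id _, comm := fun _ => rfl, equivariant := fun _ _ => rfl }
  comp A B :=
    { f := B.f ∘ A.f, Θ := B.Θ.comp A.Θ, F := B.F ∘ A.F, smooth_f := B.smooth_f.comp A.smooth_f
      smooth_Θ := B.smooth_Θ.comp A.smooth_Θ, smooth_F := B.smooth_F.comp A.smooth_F
      comm := fun p => by simp [A.comm, B.comm]
      equivariant := fun p g => by simp [A.equivariant, B.equivariant] }

variable (P : PrincipalQBundle.{u})

theorem β_act (p : P.P) (g : P.G) : P.β (P.act p g) = P.β p := (P.fiber_eq _ _).2 ⟨g, rfl⟩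

theorem surjective_β : Function.Surjective P.β := by
  intro n
  obtain ⟨U, ψ, -, hn, hs, ht, -, -, h⟩ := P.locallyTrivial n
  have hm : ((n, 1) : P.N × P.G) ∈ ψ.target := by rw [ht]; exact ⟨hn, trivial⟩
  have := (h _ (ψ.map_target hm)).1
  rw [ψ.right_inv hm] at this
  exact ⟨_, this.symm⟩

theorem qSmooth_act (g : P.G) : QSmooth P.Q P.Q (fun p => P.act p g) :=
  P.smooth_act.comp ((qSmooth_id _).prodMk (qSmooth_const _ _ g))

/-- The tangent action `TP × G → TP`. -/
noncomputable def tact (w : P.Q.TB) (g : P.G) : P.Q.TB := tmap P.Q P.Q (fun p => P.act p g) w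

theorem tact_one (w : P.Q.TB) : P.tact w 1 = w := by
  simp only [tact, P.act_one, tmap_id]

theorem tact_mul (w : P.Q.TB) (g h : P.G) : P.tact w (g * h) = P.tact (P.tact w g) h := by
  simp only [tact, P.act_mul]
  exact tmap_comp (P.qSmooth_act h) (P.qSmooth_act g) w

/-- The orbit equivalence relation of the tangent action. -/
def tangentSetoid : Setoid P.Q.TB where
  r w w' := ∃ g, P.tact w g = w'
  iseqv :=
    { refl := fun w => ⟨1, P.tact_one w⟩
      symm := by
        rintro w _ ⟨g, rfl⟩
        exact ⟨g⁻¹, by rw [← tact_mul, mul_inv_cancel, tact_one]⟩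
      trans := by
        rintro w _ _ ⟨g, rfl⟩ ⟨h, rfl⟩
        exact ⟨g * h, P.tact_mul w g h⟩ }

/-- The quotient `(TP)/G`. -/
def Atiyah : Type u := Quotient P.tangentSetoid

/-- The quotient map `TP → (TP)/G`. -/
def Atiyah.mk {P : PrincipalQBundle.{u}} (w : P.Q.TB) : P.Atiyah := Quotient.mk P.tangentSetoid w

/-- The bundle projection `(TP)/G → N`. -/
def Atiyah.base {P : PrincipalQBundle.{u}} : P.Atiyah → P.N :=
  Quotient.lift (fun w => P.β w.1) (by rintro w _ ⟨g, rfl⟩; exact (P.β_act _ _).symm)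

theorem tmap_β_tact (w : P.Q.TB) (g : P.G) :
    tmap P.Q P.N.toQ P.β (P.tact w g) = tmap P.Q P.N.toQ P.β w := by
  rw [tact, ← tmap_comp P.smooth_β (P.qSmooth_act g)]
  simp only [P.β_act]

/-- The map `(TP)/G → TN` induced by `Tβ : TP → TN`. -/
noncomputable def Atiyah.anchor {P : PrincipalQBundle.{u}} : P.Atiyah → P.N.toQ.TB :=
  Quotient.lift (tmap P.Q P.N.toQ P.β) (by rintro w _ ⟨g, rfl⟩; exact (P.tmap_β_tact _ _).symm)

theorem Atiyah.anchor_fst {P : PrincipalQBundle.{u}} (ξ : P.Atiyah) : ξ.anchor.1 = ξ.base := by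
  induction ξ using Quotient.inductionOn; rfl

/-- The fibre of `(TP)/G` over `x`. -/
def AtiyahFib (x : P.N) : Type u := {ξ : P.Atiyah // ξ.base = x}

variable {P} in
/-- For `p ∈ β⁻¹(x)` the quotient map is a bijection from `T_pP` onto the fibre of `(TP)/G` over `x`. -/
noncomputable def fibEquiv {p : P.P} {x : P.N} (h : P.β p = x) : P.Q.TSpace p ≃ P.AtiyahFib x :=
  Equiv.ofBijective (fun v => ⟨Atiyah.mk ⟨p, v⟩, h⟩) (by
    constructor
    · intro v v' e
      obtain ⟨g, hg⟩ := Quotient.exact (congrArg Subtype.val e)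
      obtain rfl : g = 1 := P.act_free p g (congrArg Sigma.fst hg)
      have hg' := (P.tact_one _).symm.trans hg
      exact eq_of_heq (Sigma.mk.inj hg').2
    · rintro ⟨ξ, hξ⟩
      induction ξ using Quotient.inductionOn with
      | h w =>
        obtain ⟨g, hg⟩ := (P.fiber_eq w.1 p).1 (h.trans hξ.symm)
        have e : (P.tact w g).1 = p := hg
        refine ⟨(P.tact w g).vecAt e, Subtype.ext ?_⟩
        refine (congrArg Atiyah.mk ((P.tact w g).mk_vecAt e)).trans ?_
        exact (Quotient.sound (s := P.tangentSetoid) ⟨g, rfl⟩).symm)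

/-- A chosen point of the fibre over `x`. -/
noncomputable def point (x : P.N) : P.P := (P.surjective_β x).choose

theorem β_point (x : P.N) : P.β (P.point x) = x := (P.surjective_β x).choose_spec

/-- The vector space structure of the fibre of `(TP)/G`, transported from `T_pP` with `p` in the fibre of `P`. It does not
depend on `p` because `G` acts by linear maps between the tangent spaces. -/
noncomputable instance (x : P.N) : AddCommGroup (P.AtiyahFib x) :=
  (fibEquiv (P.β_point x)).symm.addCommGroup

noncomputable instance (x : P.N) : Module ℝ (P.AtiyahFib x) :=
  (fibEquiv (P.β_point x)).symm.module ℝ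

/-- The `G`-invariant vector field on `P` that corresponds to the section `σ` of `(TP)/G → N`: its value at `p` is the
unique `v ∈ T_pP` of class `σ (β p)`. -/
noncomputable def invField (σ : ∀ x, P.AtiyahFib x) (p : P.P) : P.Q.TSpace p :=
  (fibEquiv (rfl : P.β p = P.β p)).symm (σ (P.β p))

end PrincipalQBundle

/-- The derivative of the function `f` in the direction of the tangent vector `v`. -/
noncomputable def SmoothMfd.dirDeriv (M : SmoothMfd.{u}) (f : M → ℝ) (x : M)
    (v : TangentSpace M.I x) : ℝ := mfderiv M.I 𝓘(ℝ, ℝ) f x v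

/-- The raw data of a Lie algebroid over `M`: the fibres, which maps from manifolds to the total space are smooth near a point
(this determines the smooth structure of the total space), the anchor, and the bracket. The axioms are in
`LieAlgebroidData.IsLieAlgebroid`; values of the bracket matter only on smooth sections. -/
structure LieAlgebroidData (M : SmoothMfd.{u}) : Type (u + 1) where
  Fib : M → Type u
  [addCommGroup : ∀ x, AddCommGroup (Fib x)]
  [module : ∀ x, Module ℝ (Fib x)]
  IsSmoothAt : ∀ {T : SmoothMfd.{u}}, (T → Σ x, Fib x) → T → Prop
  anchor : ∀ x, Fib x → TangentSpace M.I x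
  bracket : (∀ x, Fib x) → (∀ x, Fib x) → ∀ x, Fib x

namespace LieAlgebroidData

attribute [instance] addCommGroup module

variable {M : SmoothMfd.{u}} (D : LieAlgebroidData M)

/-- Smooth sections. -/
def IsSmoothSection (σ : ∀ x, D.Fib x) : Prop :=
  ∀ x : M, D.IsSmoothAt (fun y : M => ⟨y, σ y⟩) x

/-- `e` is a smooth local trivialization over `U`: it is fibrewise a linear isomorphism, and a map `c` into the total space is
smooth near `t` if and only if its base component and its component in the typical fibre `F` are. -/
structure IsLocalTrivialization (F : Type u) [NormedAddCommGroup F] [NormedSpace ℝ F]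
    (U : Set M) (e : ∀ x, D.Fib x →ₗ[ℝ] F) : Prop where
  isOpen : IsOpen U
  bijective : ∀ x ∈ U, Function.Bijective (e x)
  smooth_iff : ∀ (T : SmoothMfd.{u}) (c : T → Σ x, D.Fib x) (t : T), (c t).1 ∈ U →
    (D.IsSmoothAt c t ↔ ∃ W : Set T, IsOpen W ∧ t ∈ W ∧ (∀ z ∈ W, (c z).1 ∈ U) ∧
      ContMDiffOn T.I M.I ∞ (fun z => (c z).1) W ∧
      ContMDiffOn T.I 𝓘(ℝ, F) ∞ (fun z => e (c z).1 (c z).2) W)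

/-- The data form a smooth vector bundle (of finite rank). -/
def IsVectorBundle : Prop :=
  ∃ (F : Type u) (_ : NormedAddCommGroup F) (_ : NormedSpace ℝ F) (_ : FiniteDimensional ℝ F),
    ∀ x, ∃ U e, x ∈ U ∧ D.IsLocalTrivialization F U e

/-- The Lie algebroid axioms: a smooth vector bundle, a smooth vector bundle map `anchor` to `TM`, and a Lie bracket on the
smooth sections with the Leibniz rule; the anchor preserves brackets. -/
structure IsLieAlgebroid : Prop where
  isVectorBundle : D.IsVectorBundle
  anchor_add : ∀ x v w, D.anchor x (v + w) = D.anchor x v + D.anchor x w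
  anchor_smul : ∀ x (r : ℝ) v, D.anchor x (r • v) = r • D.anchor x v
  anchor_smooth : ∀ (T : SmoothMfd.{u}) (c : T → Σ x, D.Fib x) (t : T), D.IsSmoothAt c t →
    ∃ W : Set T, IsOpen W ∧ t ∈ W ∧ ContMDiffOn T.I M.I.tangent ∞
      (fun z => (⟨(c z).1, D.anchor (c z).1 (c z).2⟩ : TangentBundle M.I M)) W
  bracket_smooth : ∀ σ τ, D.IsSmoothSection σ → D.IsSmoothSection τ →
    D.IsSmoothSection (D.bracket σ τ)
  bracket_add : ∀ σ τ ρ, D.IsSmoothSection σ → D.IsSmoothSection τ → D.IsSmoothSection ρ →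
    D.bracket σ (τ + ρ) = D.bracket σ τ + D.bracket σ ρ
  bracket_self : ∀ σ, D.IsSmoothSection σ → D.bracket σ σ = 0
  bracket_skew : ∀ σ τ, D.IsSmoothSection σ → D.IsSmoothSection τ →
    D.bracket σ τ = -D.bracket τ σ
  jacobi : ∀ σ τ ρ, D.IsSmoothSection σ → D.IsSmoothSection τ → D.IsSmoothSection ρ →
    D.bracket σ (D.bracket τ ρ) = D.bracket (D.bracket σ τ) ρ + D.bracket τ (D.bracket σ ρ)
  leibniz : ∀ (f : M → ℝ) (σ τ), ContMDiff M.I 𝓘(ℝ, ℝ) ∞ f → D.IsSmoothSection σ →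
    D.IsSmoothSection τ → ∀ x, D.bracket σ (fun y => f y • τ y) x =
      f x • D.bracket σ τ x + M.dirDeriv f x (D.anchor x (σ x)) • τ x
  anchor_bracket : ∀ σ τ, D.IsSmoothSection σ → D.IsSmoothSection τ → ∀ x,
    D.anchor x (D.bracket σ τ x) =
      VectorField.mlieBracket M.I (fun y => D.anchor y (σ y)) (fun y => D.anchor y (τ y)) x

variable {N : SmoothMfd.{u}} (D' : LieAlgebroidData N)

/-- `φ` is a morphism of Lie algebroids over `f : M → N` (for arbitrary `f`): a smooth vector bundle morphism that is compatible with
the anchors and the brackets. Compatibility with the brackets is stated through local decompositions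
`φ ∘ σ = ∑ aᵢ (Aᵢ ∘ f)`, `φ ∘ τ = ∑ bⱼ (Bⱼ ∘ f)`, the standard way over a base map that is not the identity. -/
structure IsHom (f : M → N) (φ : ∀ x, D.Fib x → D'.Fib (f x)) : Prop where
  smooth_base : ContMDiff M.I N.I ∞ f
  map_add : ∀ x v w, φ x (v + w) = φ x v + φ x w
  map_smul : ∀ x (r : ℝ) v, φ x (r • v) = r • φ x v
  smooth : ∀ (T : SmoothMfd.{u}) (c : T → Σ x, D.Fib x) (t : T), D.IsSmoothAt c t →
    D'.IsSmoothAt (fun z => ⟨f (c z).1, φ (c z).1 (c z).2⟩) t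
  anchor : ∀ x v, D'.anchor (f x) (φ x v) = mfderiv M.I N.I f x (D.anchor x v)
  bracket : ∀ (W : Set M) (σ τ : ∀ x, D.Fib x) (k l : ℕ) (a : Fin k → M → ℝ) (b : Fin l → M → ℝ)
    (A : Fin k → ∀ y, D'.Fib y) (B : Fin l → ∀ y, D'.Fib y),
    IsOpen W → D.IsSmoothSection σ → D.IsSmoothSection τ →
    (∀ i, ContMDiffOn M.I 𝓘(ℝ, ℝ) ∞ (a i) W) → (∀ j, ContMDiffOn M.I 𝓘(ℝ, ℝ) ∞ (b j) W) →
    (∀ i, D'.IsSmoothSection (A i)) → (∀ j, D'.IsSmoothSection (B j)) →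
    (∀ x ∈ W, φ x (σ x) = ∑ i, a i x • A i (f x)) →
    (∀ x ∈ W, φ x (τ x) = ∑ j, b j x • B j (f x)) →
    ∀ x ∈ W, φ x (D.bracket σ τ x) =
      (∑ i, ∑ j, (a i x * b j x) • D'.bracket (A i) (B j) (f x)) +
      (∑ j, M.dirDeriv (b j) x (D.anchor x (σ x)) • B j (f x)) -
      ∑ i, M.dirDeriv (a i) x (D.anchor x (τ x)) • A i (f x)

/-- `φ` is an isomorphism of Lie algebroids over the identity of `M`. -/
def IsIso (D₁ D₂ : LieAlgebroidData M) (φ : ∀ x, D₁.Fib x → D₂.Fib x) : Prop :=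
  D₁.IsHom D₂ (fun x => x) φ ∧ ∃ ψ : ∀ x, D₂.Fib x → D₁.Fib x,
    D₂.IsHom D₁ (fun x => x) ψ ∧ (∀ x v, ψ x (φ x v) = v) ∧ ∀ x w, φ x (ψ x w) = w

end LieAlgebroidData

namespace PrincipalQBundle
variable (P : PrincipalQBundle.{u})

/-- The Atiyah algebroid `(TP)/G` of a principal Q-bundle. The quotient map `TP → (TP)/G` being a Q-submersion, the smooth maps into
`(TP)/G` are those that lift locally to Q-smooth maps into `TP`. The anchor is induced by `Tβ`, and the bracket is that of
`G`-invariant vector fields on `P`. -/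
noncomputable def atiyah : LieAlgebroidData P.N where
  Fib := P.AtiyahFib
  IsSmoothAt := fun {T} c t => ∃ (W : Set T) (ĉ : T → P.Q.TB), IsOpen W ∧ t ∈ W ∧
    QSmoothOn T.toQ P.Q.tangent ĉ W ∧ ∀ z ∈ W, (c z).2.1 = Atiyah.mk (ĉ z)
  anchor := fun x ξ => ξ.1.anchor.vecAt (s := x) (ξ.1.anchor_fst.trans ξ.2)
  bracket := fun σ τ x => fibEquiv (P.β_point x)
    (P.Q.lieBracket (P.invField σ) (P.invField τ) (P.point x))

variable {P} {P' : PrincipalQBundle.{u}}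

theorem Hom.tmap_tact (F : P ⟶ P') (w : P.Q.TB) (g : P.G) :
    tmap P.Q P'.Q F.F (P.tact w g) = P'.tact (tmap P.Q P'.Q F.F w) (F.Θ g) := by
  rw [tact, tact, ← tmap_comp F.smooth_F (P.qSmooth_act g),
    ← tmap_comp (P'.qSmooth_act _) F.smooth_F]
  simp only [F.equivariant]

/-- The map `(TP)/G → (TP')/G'` induced by the tangent map of a morphism of principal Q-bundles. -/
noncomputable def Hom.atiyahTotal (F : P ⟶ P') : P.Atiyah → P'.Atiyah :=
  Quotient.map' (s₁ := P.tangentSetoid) (s₂ := P'.tangentSetoid) (tmap P.Q P'.Q F.F)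
    (by rintro w _ ⟨g, rfl⟩; exact ⟨F.Θ g, (Hom.tmap_tact F w g).symm⟩)

/-- The action of the Atiyah functor on morphisms, fibre by fibre. -/
noncomputable def Hom.atiyah (F : P ⟶ P') (x : P.N) (ξ : P.AtiyahFib x) : P'.AtiyahFib (F.f x) :=
  ⟨Hom.atiyahTotal F ξ.1, by
    obtain ⟨ξ, rfl⟩ := ξ
    induction ξ using Quotient.inductionOn
    exact F.comm _⟩

end PrincipalQBundle

/-- A groupoid with arrows `Γ` and objects `M`; the product `mul g h` of `g` and `h` exists if `s g = t h`. -/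
structure GroupoidOn (M Γ : Type u) where
  s : Γ → M
  t : Γ → M
  mul : ∀ g h : Γ, s g = t h → Γ
  one : M → Γ
  inv : Γ → Γ
  s_mul : ∀ g h e, s (mul g h e) = s h
  t_mul : ∀ g h e, t (mul g h e) = t g
  mul_assoc : ∀ g h k (e : s g = t h) (e' : s h = t k),
    mul (mul g h e) k ((s_mul g h e).trans e') = mul g (mul h k e') (e.trans (t_mul h k e').symm)
  s_one : ∀ x, s (one x) = x
  t_one : ∀ x, t (one x) = x
  mul_one : ∀ g, mul g (one (s g)) (t_one _).symm = g
  one_mul : ∀ g, mul (one (t g)) g (s_one _) = g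
  s_inv : ∀ g, s (inv g) = t g
  t_inv : ∀ g, t (inv g) = s g
  mul_inv : ∀ g, mul g (inv g) (t_inv g).symm = one (t g)
  inv_mul : ∀ g, mul (inv g) g (s_inv g) = one (s g)

namespace GroupoidOn

section
variable {M : SmoothMfd.{u}} {Γ : Type u} (𝒢 : GroupoidOn M Γ) (Q : QStr Γ)

/-- A Q-groupoid: the arrows form a Q-manifold over the smooth manifold of objects, the source is a Q-submersion, inversion and units
are Q-smooth, and so is the multiplication. The composable pairs form a Q-submanifold of `Γ × Γ`, so that smoothness of
the multiplication is tested on pairs of Q-smooth maps from manifolds, such as its Q-atlas. -/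
structure IsQGroupoid : Prop where
  submersion_s : IsQSubmersion Q M.toQ 𝒢.s
  smooth_inv : QSmooth Q Q 𝒢.inv
  smooth_one : QSmooth M.toQ Q 𝒢.one
  smooth_mul : ∀ (T : SmoothMfd.{u}) (a b : T → Γ) (e : ∀ z, 𝒢.s (a z) = 𝒢.t (b z)),
    QSmooth T.toQ Q a → QSmooth T.toQ Q b → QSmooth T.toQ Q (fun z => 𝒢.mul (a z) (b z) (e z))

/-- A Q-groupoid is locally trivial if `(s, t) : Γ → M × M` is a surjective Q-submersion. -/
def IsLocallyTrivial : Prop :=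
  Function.Surjective (fun g => (𝒢.s g, 𝒢.t g)) ∧
    IsQSubmersion Q (M.toQ.prod M.toQ) (fun g => (𝒢.s g, 𝒢.t g))

/-- Right-invariant vector fields: smooth, tangent to the source fibres, and invariant under the right translations
`h ↦ h g`, from the source fibre over `t g` to the source fibre over `s g`. Since a right translation is defined on a source fibre only, its
tangent map is evaluated on vectors represented by Q-smooth maps `c` from manifolds into the source fibre. -/
structure IsRightInvariant (X : ∀ g, Q.TSpace g) : Prop where
  smooth : Q.IsSmoothField X
  vertical : ∀ g, tmapAt Q M.toQ 𝒢.s g (X g) = 0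
  invariant : ∀ (g : Γ) (T : SmoothMfd.{u}) (c : T → Γ) (e : ∀ z, 𝒢.s (c z) = 𝒢.t g),
    QSmooth T.toQ Q c → ∀ (z : T) (w : TangentSpace T.I z), tmapAt T.toQ Q c z w = X (c z) →
      tmapAt T.toQ Q (fun z => 𝒢.mul (c z) g (e z)) z w = X (𝒢.mul (c z) g (e z))

/-- The fibre of the Lie algebroid over `x`: the kernel of `Ts` in the tangent space at the unit of `x`. -/
abbrev LieFib (x : M) : Type u := (tmapAt Q M.toQ 𝒢.s (𝒢.one x)).ker

open Classical in
/-- The right-invariant vector field that extends a section. -/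
noncomputable def rightInvExt (σ : ∀ x, 𝒢.LieFib Q x) : ∀ g, Q.TSpace g :=
  if h : ∃ X, 𝒢.IsRightInvariant Q X ∧ ∀ x, X (𝒢.one x) = (σ x).1 then h.choose else 0

open Classical in
/-- The Lie algebroid of a Q-groupoid: the kernel of `Ts` restricted to the units, with the bracket of right-invariant vector fields and
the anchor `Tt`. -/
noncomputable def lie : LieAlgebroidData M where
  Fib := fun x => 𝒢.LieFib Q x
  IsSmoothAt := fun {T} c t => ∃ W : Set T, IsOpen W ∧ t ∈ W ∧
    ContMDiffOn T.I M.I ∞ (fun z => (c z).1) W ∧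
    QSmoothOn T.toQ Q.tangent (fun z => (⟨𝒢.one (c z).1, (c z).2.1⟩ : Q.TB)) W
  anchor := fun x v => (tmap Q M.toQ 𝒢.t ⟨𝒢.one x, v.1⟩).vecAt (s := x) (𝒢.t_one x)
  bracket := fun σ τ x =>
    let Z := Q.lieBracket (𝒢.rightInvExt Q σ) (𝒢.rightInvExt Q τ) (𝒢.one x)
    if h : Z ∈ (tmapAt Q M.toQ 𝒢.s (𝒢.one x)).ker then ⟨Z, h⟩ else 0

end

section
variable {M N : SmoothMfd.{u}} {Γ Δ : Type u}

/-- Morphisms of Q-groupoids. -/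
structure IsQGroupoidHom (𝒢 : GroupoidOn M Γ) (Q : QStr Γ) (ℋ : GroupoidOn N Δ) (R : QStr Δ)
    (φ : M → N) (Φ : Γ → Δ) : Prop where
  map_s : ∀ g, ℋ.s (Φ g) = φ (𝒢.s g)
  map_t : ∀ g, ℋ.t (Φ g) = φ (𝒢.t g)
  map_one : ∀ x, Φ (𝒢.one x) = ℋ.one (φ x)
  map_mul : ∀ g h (e : 𝒢.s g = 𝒢.t h), Φ (𝒢.mul g h e) =
    ℋ.mul (Φ g) (Φ h) (by rw [map_s, map_t, e])
  smooth : QSmooth Q R Φ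

end
end GroupoidOn

namespace GroupoidOn
section
variable {M N : SmoothMfd.{u}} {Γ Δ : Type u} {𝒢 : GroupoidOn M Γ} {Q : QStr Γ}
  {ℋ : GroupoidOn N Δ} {R : QStr Δ} {φ : M → N} {Φ : Γ → Δ}

theorem mem_ker_iff (g : Γ) (v : Q.TSpace g) : v ∈ (tmapAt Q M.toQ 𝒢.s g).ker ↔
    ∃ y, tmap Q M.toQ 𝒢.s ⟨g, v⟩ = ⟨y, 0⟩ := by
  constructor
  · intro h
    exact ⟨𝒢.s g, Sigma.ext rfl (heq_of_eq h)⟩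
  · rintro ⟨y, h⟩
    obtain rfl : 𝒢.s g = y := congrArg Sigma.fst h
    exact eq_of_heq (Sigma.mk.inj h).2

theorem IsQGroupoidHom.smooth_base (h𝒢 : 𝒢.IsQGroupoid Q) (hℋ : ℋ.IsQGroupoid R)
    (hΦ : IsQGroupoidHom 𝒢 Q ℋ R φ Φ) : QSmooth M.toQ N.toQ φ := by
  have h := (hℋ.submersion_s.1.comp hΦ.smooth).comp h𝒢.smooth_one
  simpa only [hΦ.map_one, ℋ.s_one] using h

/-- The action of the Lie functor on morphisms: the restriction of the tangent map. -/
noncomputable def IsQGroupoidHom.lieMap (hΦ : IsQGroupoidHom 𝒢 Q ℋ R φ Φ)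
    (h𝒢 : 𝒢.IsQGroupoid Q) (hℋ : ℋ.IsQGroupoid R) (x : M) (v : 𝒢.LieFib Q x) :
    ℋ.LieFib R (φ x) :=
  ⟨(tmap Q R Φ ⟨𝒢.one x, v.1⟩).vecAt (s := ℋ.one (φ x)) (hΦ.map_one x), by
    obtain ⟨y, hy⟩ := (mem_ker_iff _ _).1 v.2
    refine (mem_ker_iff _ _).2 ⟨φ y, ?_⟩
    refine (congrArg (tmap R N.toQ ℋ.s)
      (QStr.TB.mk_vecAt (tmap Q R Φ ⟨𝒢.one x, v.1⟩) (hΦ.map_one x))).trans ?_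
    refine (tmap_comp hℋ.submersion_s.1 hΦ.smooth _).symm.trans ?_
    simp only [hΦ.map_s]
    refine (tmap_comp (hΦ.smooth_base h𝒢 hℋ) h𝒢.submersion_s.1 _).trans ?_
    rw [hy]
    exact Sigma.ext rfl (heq_of_eq (map_zero _))⟩

end
end GroupoidOn

namespace PrincipalQBundle
variable (P : PrincipalQBundle.{u})

/-- The orbit equivalence relation of the diagonal action of `G` on `P × P`. -/
def gaugeSetoid : Setoid (P.P × P.P) where
  r x y := ∃ g, (P.act x.1 g, P.act x.2 g) = y
  iseqv :=
    { refl := fun x => ⟨1, by rw [P.act_one, P.act_one]⟩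
      symm := by
        rintro x _ ⟨g, rfl⟩
        exact ⟨g⁻¹, by simp only [← P.act_mul, mul_inv_cancel, P.act_one]⟩
      trans := by
        rintro x _ _ ⟨g, rfl⟩ ⟨h, rfl⟩
        exact ⟨g * h, by simp only [P.act_mul]⟩ }

/-- The arrows `(P × P)/G` of the gauge groupoid. -/
def Gauge : Type u := Quotient P.gaugeSetoid

variable {P} in
/-- The class `[p, q]` of `(p, q)`. -/
def Gauge.mk (p q : P.P) : P.Gauge := Quotient.mk P.gaugeSetoid (p, q)

theorem Gauge.exact {p q p' q' : P.P} (h : Gauge.mk p q = Gauge.mk p' q') :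
    ∃ g, P.act p g = p' ∧ P.act q g = q' := by
  obtain ⟨g, hg⟩ := Quotient.exact h
  exact ⟨g, congrArg Prod.fst hg, congrArg Prod.snd hg⟩

theorem Gauge.mk_act (p q : P.P) (g : P.G) : Gauge.mk (P.act p g) (P.act q g) = Gauge.mk p q :=
  (Quotient.sound (s := P.gaugeSetoid) (a := (p, q)) (b := (P.act p g, P.act q g)) ⟨g, rfl⟩).symm

theorem Gauge.ind' (a : P.Gauge) : ∃ p q, Gauge.mk p q = a := by
  obtain ⟨⟨p, q⟩, h⟩ := Quotient.exists_rep a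
  exact ⟨p, q, h⟩

theorem act_cancel (p : P.P) {g h : P.G} (e : P.act p g = P.act p h) : g = h := by
  have : P.act p (g * h⁻¹) = p := by rw [P.act_mul, e, ← P.act_mul, mul_inv_cancel, P.act_one]
  exact mul_inv_eq_one.1 (P.act_free _ _ this)

variable {P} in
/-- The source, `s [p, q] = β q`. -/
def gaugeS : P.Gauge → P.N :=
  Quotient.lift (fun x => P.β x.2) (by rintro x _ ⟨g, rfl⟩; exact (P.β_act _ _).symm)

variable {P} in
/-- The target, `t [p, q] = β p`. -/
def gaugeT : P.Gauge → P.N :=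
  Quotient.lift (fun x => P.β x.1) (by rintro x _ ⟨g, rfl⟩; exact (P.β_act _ _).symm)

variable {P} in
theorem exists_gauge_rep (a b : P.Gauge) (e : gaugeS a = gaugeT b) :
    ∃ p q r, Gauge.mk p q = a ∧ Gauge.mk q r = b := by
  obtain ⟨p, q, rfl⟩ := Gauge.ind' P a
  obtain ⟨q', r, rfl⟩ := Gauge.ind' P b
  obtain ⟨g, rfl⟩ := (P.fiber_eq q' q).1 e
  exact ⟨p, P.act q' g, P.act r g, rfl, Gauge.mk_act ..⟩

variable {P} in
/-- The product, `[p, q] [q, r] = [p, r]` (see `gaugeMul_mk`). -/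
noncomputable def gaugeMul (a b : P.Gauge) (e : gaugeS a = gaugeT b) : P.Gauge :=
  Gauge.mk (exists_gauge_rep a b e).choose (exists_gauge_rep a b e).choose_spec.choose_spec.choose

variable {P} in
theorem gaugeMul_mk (p q r : P.P) (e) :
    gaugeMul (Gauge.mk p q) (Gauge.mk q r) e = Gauge.mk p r := by
  have key : ∀ p' q' r', Gauge.mk p' q' = Gauge.mk p q → Gauge.mk q' r' = Gauge.mk q r →
      Gauge.mk p' r' = Gauge.mk p r := by
    intro p' q' r' ha hb
    obtain ⟨g, rfl, hg⟩ := Gauge.exact P ha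
    obtain ⟨k, hk, rfl⟩ := Gauge.exact P hb
    obtain rfl : g = k := P.act_cancel _ (hg.trans hk.symm)
    exact (Gauge.mk_act P _ _ _).symm
  have h := (exists_gauge_rep _ _ e).choose_spec.choose_spec.choose_spec
  exact key _ _ _ h.1 h.2

theorem mk_point (p : P.P) : Gauge.mk (P.point (P.β p)) (P.point (P.β p)) = Gauge.mk p p := by
  obtain ⟨g, hg⟩ := (P.fiber_eq (P.point (P.β p)) p).1 (P.β_point _).symm
  exact (Gauge.mk_act P _ _ g).symm.trans (by rw [hg])

/-- The gauge groupoid. Its units are `[p, p]`, for any `p` above the object, and the inverse of `[p, q]` is `[q, p]`. -/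
noncomputable def gauge : GroupoidOn P.N P.Gauge where
  s := gaugeS
  t := gaugeT
  mul := gaugeMul
  one := fun x => Gauge.mk (P.point x) (P.point x)
  inv := Quotient.map' (s₁ := P.gaugeSetoid) (s₂ := P.gaugeSetoid) (fun x => (x.2, x.1))
    (by rintro x _ ⟨g, rfl⟩; exact ⟨g, rfl⟩)
  s_mul := by
    intro a b e
    obtain ⟨p, q, r, rfl, rfl⟩ := exists_gauge_rep a b e
    rw [gaugeMul_mk]; rfl
  t_mul := by
    intro a b e
    obtain ⟨p, q, r, rfl, rfl⟩ := exists_gauge_rep a b e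
    rw [gaugeMul_mk]; rfl
  mul_assoc := by
    intro a b c e e'
    obtain ⟨p, q, r, rfl, rfl⟩ := exists_gauge_rep a b e
    obtain ⟨r', t, rfl⟩ := Gauge.ind' P c
    obtain ⟨g, rfl⟩ := (P.fiber_eq r' r).1 e'
    simp only [← Gauge.mk_act P r' t g, gaugeMul_mk]
  s_one := P.β_point
  t_one := P.β_point
  mul_one := by
    intro a
    obtain ⟨p, q, rfl⟩ := Gauge.ind' P a
    have h : gaugeS (Gauge.mk p q) = P.β q := rfl
    simp only [h, mk_point, gaugeMul_mk]
  one_mul := by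
    intro a
    obtain ⟨p, q, rfl⟩ := Gauge.ind' P a
    have h : gaugeT (Gauge.mk p q) = P.β p := rfl
    simp only [h, mk_point, gaugeMul_mk]
  s_inv := by
    intro a
    obtain ⟨p, q, rfl⟩ := Gauge.ind' P a
    rfl
  t_inv := by
    intro a
    obtain ⟨p, q, rfl⟩ := Gauge.ind' P a
    rfl
  mul_inv := by
    intro a
    obtain ⟨p, q, rfl⟩ := Gauge.ind' P a
    exact (gaugeMul_mk p q p rfl).trans (P.mk_point p).symm
  inv_mul := by
    intro a
    obtain ⟨p, q, rfl⟩ := Gauge.ind' P a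
    exact (gaugeMul_mk q p q rfl).trans (P.mk_point q).symm

/-- `R` is the quotient Q-manifold structure on `(P × P)/G`: the quotient map is a Q-submersion. -/
def IsGaugeStr (R : QStr P.Gauge) : Prop :=
  IsQSubmersion (P.Q.prod P.Q) R (fun x => Gauge.mk x.1 x.2)

variable {P} {P' : PrincipalQBundle.{u}}

/-- The action of the gauge functor on morphisms, `[p, q] ↦ [F p, F q]`. -/
def Hom.gauge (F : P ⟶ P') : P.Gauge → P'.Gauge :=
  Quotient.map' (s₁ := P.gaugeSetoid) (s₂ := P'.gaugeSetoid) (fun x => (F.F x.1, F.F x.2)) (by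
    rintro x _ ⟨g, rfl⟩
    exact ⟨F.Θ g, Prod.ext (F.equivariant _ _).symm (F.equivariant _ _).symm⟩)

theorem IsGaugeStr.smooth_mk {R : QStr P.Gauge} (hR : P.IsGaugeStr R) (p : P.P) :
    QSmooth P.Q R (fun p' => Gauge.mk p' p) :=
  QSmooth.comp hR.1 ((qSmooth_id _).prodMk (qSmooth_const _ _ p))

/-- The Ehresmann map on the total space, `[v] ↦ T_p(p' ↦ [p', p]) v` for `v ∈ T_pP`. -/
noncomputable def ehrTotal {R : QStr P.Gauge} (hR : P.IsGaugeStr R) : P.Atiyah → R.TB :=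
  Quotient.lift (fun w => tmap P.Q R (fun p' => Gauge.mk p' w.1) w) (by
    rintro w _ ⟨g, rfl⟩
    have h := tmap_comp (hR.smooth_mk (P.act w.1 g)) (P.qSmooth_act g) w
    simp only [Gauge.mk_act] at h
    exact h)

theorem tmap_gaugeS_ehrTotal {R : QStr P.Gauge} (hR : P.IsGaugeStr R) (w : P.Q.TB) :
    tmap R P.N.toQ gaugeS (tmap P.Q R (fun p' => Gauge.mk p' w.1) w) = ⟨P.β w.1, 0⟩ := by
  obtain ⟨p, v⟩ := w
  by_cases h : ∃ g, IsLiftAt R P.N.toQ gaugeS (Gauge.mk p p) g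
  · refine Sigma.ext rfl (heq_of_eq ?_)
    refine (tmapAt_comp (f := fun p' => Gauge.mk p' p) h
      (QSmoothOn.exists_isLiftAt (hR.smooth_mk p) (Set.mem_univ p)) v).symm.trans ?_
    exact congrArg (fun L => L v) (tmapAt_const P.Q P.N.toQ (P.β p) p)
  · refine Sigma.ext rfl (heq_of_eq ?_)
    have h0 : tmapAt R P.N.toQ gaugeS (Gauge.mk p p) = 0 := dif_neg h
    exact congrArg (fun L => L (tmapAt P.Q R (fun p' => Gauge.mk p' p) p v)) h0

/-- The Ehresmann map `(TP)/G → A((P × P)/G)`, fibre by fibre. -/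
noncomputable def ehr {R : QStr P.Gauge} (hR : P.IsGaugeStr R) (x : P.N) (ξ : P.AtiyahFib x) :
    P.gauge.LieFib R x :=
  have base : (ehrTotal hR ξ.1).1 = P.gauge.one x := by
    obtain ⟨ξ, rfl⟩ := ξ
    induction ξ using Quotient.inductionOn with
    | h w => exact (P.mk_point w.1).symm
  ⟨(ehrTotal hR ξ.1).vecAt base, by
    refine (GroupoidOn.mem_ker_iff _ _).2 ⟨x, ?_⟩
    refine (congrArg (tmap R P.N.toQ gaugeS) ((ehrTotal hR ξ.1).mk_vecAt base)).trans ?_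
    obtain ⟨ξ, rfl⟩ := ξ
    induction ξ using Quotient.inductionOn with
    | h w => exact tmap_gaugeS_ehrTotal hR w⟩

end PrincipalQBundle

/-! Everything on a Q-manifold is computed through smooth lifts to its atlas. Condition (b) makes
lifts rigid: two lifts of the same map that agree at a point agree near it
(`QStr.eventually_eq_of_lift`). Condition (a) allows the value of a lift at one point to be
prescribed (`QSmoothAt.exists_lift`). Germs, tangent vectors and brackets are therefore independent
of choices, and the chain rule and the behaviour of brackets under related vector fields pass from
manifolds to Q-manifolds (`IsGermLift.tmap_vec`, `QStr.tmapAt_lieBracket`). By the inverse function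
theorem maps lift locally along Q-submersions (`IsQSubmersion.exists_lift`), so smoothness of a map
out of a quotient is tested upstairs (`IsQSubmersion.qSmoothAt_of_comp`). Uniqueness of the
structure on `(P × P)/G` is a case of this.

The main tool on `(P × P)/G` is `rho`. A local section `τ` of `β` singles out, by freeness of the
action, the one representative of an arrow `a` whose second entry is `τ (s a)`; its first entry is
`rho τ a`. Reading that entry in a trivialization gives charts with values `(t a, s a, g)`, which
are glued to a Q-manifold. The map `a ↦ (rho τ a, τ (s a))` is then a smooth local section of the
quotient map, which is therefore a Q-submersion (`isGaugeStr_glue`). Formulas of the same kind show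
that the groupoid operations are smooth and that the groupoid is locally trivial.

Sections of `(TP)/G` are `G`-invariant vector fields on `P`. Right translations relate such fields
to themselves, so their bracket is again invariant (`invField_bracket`) and the Lie algebroid axioms
come from the bracket on `P`. A bundle morphism satisfies the bracket condition by the formula for
fields related with function coefficients (`tmapAt_invField_bracket`).

For fixed `q`, the map `p' ↦ [p', q]` is a bijection of `P` onto the source fibre over `β q`,
inverted by `rho τ` for a section `τ` through `q`. On tangent vectors it identifies `T_qP` with the
kernel of `Ts` at the unit (`tmap_rho_mkTangent`, `mkTangent_tmap_rho`), and `[p'g, qg] = [p', q]`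
makes this a map on `(TP)/G`. An invariant field `X` corresponds to the right-invariant field whose
value at `[p, q]` is the image of `X p` under the tangent map of `p' ↦ [p', q]`. It is the only
right-invariant field with its values on the units (`mk_of_isRightInvariant`), and `p' ↦ [p', q]`
relates the two fields, so the brackets agree.

The Ehresmann map thus matches fibres, smooth maps, anchors and brackets (`ehr_isStrictIso`). The
Lie algebroid axioms and the morphism property on the groupoid side are transported from the Atiyah
side. Naturality is the chain rule applied to `[F p', F p]`. -/

/-! ### Germs of smooth maps -/

/-- `g` is smooth on a neighbourhood of `m`. -/
def SmoothNear (M N : SmoothMfd.{u}) (g : M → N) (m : M) : Prop :=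
  ∀ᶠ z in 𝓝 m, ContMDiffAt M.I N.I ∞ g z

namespace SmoothNear

variable {M N L : SmoothMfd.{u}} {g : M → N} {m : M}

theorem contMDiffAt (h : SmoothNear M N g m) : ContMDiffAt M.I N.I ∞ g m := h.self_of_nhds

theorem continuousAt (h : SmoothNear M N g m) : ContinuousAt g m := h.contMDiffAt.continuousAt

theorem mdifferentiableAt (h : SmoothNear M N g m) : MDifferentiableAt M.I N.I g m :=
  h.contMDiffAt.mdifferentiableAt (by simp)

/-- This is what `ContMDiffAt` with exponent `∞` lacks: there the neighbourhood may shrink as the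
order of differentiability grows. Hence the separate predicate. -/
theorem eventually (h : SmoothNear M N g m) : ∀ᶠ z in 𝓝 m, SmoothNear M N g z :=
  eventually_eventually_nhds.2 h

theorem comp {g' : N → L} (h' : SmoothNear N L g' (g m)) (h : SmoothNear M N g m) :
    SmoothNear M L (fun z => g' (g z)) m := by
  filter_upwards [h, h.continuousAt.eventually h'] with z hz hz'
  exact hz'.comp z hz

theorem congr {g' : M → N} (h : SmoothNear M N g m) (e : ∀ᶠ z in 𝓝 m, g' z = g z) :
    SmoothNear M N g' m := by
  filter_upwards [h, eventually_eventually_nhds.2 e] with z hz he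
  exact hz.congr_of_eventuallyEq he

theorem prodMk {g' : M → L} (h : SmoothNear M N g m) (h' : SmoothNear M L g' m) :
    SmoothNear M (N.prod L) (fun z => (g z, g' z)) m := by
  filter_upwards [h, h'] with z hz hz'
  exact hz.prodMk hz'

end SmoothNear

section
variable {M N L : SmoothMfd.{u}}

theorem ContMDiff.smoothNear {g : M → N} (h : ContMDiff M.I N.I ∞ g) (m : M) :
    SmoothNear M N g m := Filter.Eventually.of_forall h

theorem ContMDiffOn.smoothNear {g : M → N} {U : Set M} (h : ContMDiffOn M.I N.I ∞ g U)
    (hU : IsOpen U) {m : M} (hm : m ∈ U) : SmoothNear M N g m := by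
  filter_upwards [hU.mem_nhds hm] with z hz
  exact h.contMDiffAt (hU.mem_nhds hz)

theorem smoothNear_id (m : M) : SmoothNear M M (fun z => z) m := contMDiff_id.smoothNear m

theorem smoothNear_const (c : N) (m : M) : SmoothNear M N (fun _ => c) m :=
  contMDiff_const.smoothNear m

theorem smoothNear_fst (m : M.prod N) : SmoothNear (M.prod N) M (fun z => z.1) m :=
  ContMDiff.smoothNear (M := M.prod N) contMDiff_fst m

theorem smoothNear_snd (m : M.prod N) : SmoothNear (M.prod N) N (fun z => z.2) m :=
  ContMDiff.smoothNear (M := M.prod N) contMDiff_snd m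

end

/-! ### Germs of maps between Q-manifolds -/

section
variable {S S₁ S₂ S₃ S₄ : Type u}

/-- Rigidity of lifts: by condition (b) the set where two lifts of one map agree is open, so
agreement at `m` spreads to a neighbourhood. -/
theorem QStr.eventually_eq_of_lift {T : SmoothMfd.{u}} (Q : QStr S) {g g' : T → Q.M} {m : T}
    (hg : SmoothNear T Q.M g m) (hg' : SmoothNear T Q.M g' m)
    (h : ∀ᶠ z in 𝓝 m, Q.π (g z) = Q.π (g' z)) (e : g m = g' m) : ∀ᶠ z in 𝓝 m, g z = g' z := by
  obtain ⟨U, hUs, hU, hm⟩ := mem_nhds_iff.1 ((hg.and hg').and h)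
  exact Q.eventuallyEq_of_lift hU hm (fun z hz => (hUs hz).1.1.contMDiffWithinAt)
    (fun z hz => (hUs hz).1.2.contMDiffWithinAt) (fun z hz => (hUs hz).2) e

/-- The filter of Q-neighbourhoods of a point of a Q-manifold. -/
def QStr.nhd (Q : QStr S) (s : S) : Filter S := Filter.map Q.π (𝓝 (Q.out s))

/-- A transition `h` with `π ∘ h = π` carries the neighbourhoods of one preimage to those of
another, so the filter does not depend on the preimage from which it is pushed forward. -/
theorem QStr.map_π_nhds (Q : QStr S) (m : Q.M) : Filter.map Q.π (𝓝 m) = Q.nhd (Q.π m) := by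
  obtain ⟨h, hx, hy, -, -, hπ⟩ := Q.isQChart.transverse m (Q.out (Q.π m)) (Q.π_out _).symm
  rw [QStr.nhd, ← hy, ← h.map_nhds_eq hx, Filter.map_map]
  refine Filter.map_congr ?_
  filter_upwards [h.open_source.mem_nhds hx] with z hz
  exact (hπ z hz).symm

theorem QStr.eventually_nhd_π {Q : QStr S} {m : Q.M} {p : S → Prop} :
    (∀ᶠ x in Q.nhd (Q.π m), p x) ↔ ∀ᶠ z in 𝓝 m, p (Q.π z) := by
  rw [← Q.map_π_nhds, Filter.eventually_map]

theorem QStr.eventually_nhd {Q : QStr S} {s : S} {p : S → Prop} :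
    (∀ᶠ x in Q.nhd s, p x) ↔ ∀ᶠ z in 𝓝 (Q.out s), p (Q.π z) := Iff.rfl

theorem QStr.self_of_nhd {Q : QStr S} {s : S} {p : S → Prop} (h : ∀ᶠ x in Q.nhd s, p x) : p s := by
  have := (QStr.eventually_nhd.1 h).self_of_nhds
  rwa [Q.π_out] at this

@[simp] theorem SmoothMfd.nhd_toQ (M : SmoothMfd.{u}) (x : M) : M.toQ.nhd x = 𝓝 x :=
  Filter.map_id

/-- `g` is a smooth lift of `f` near `m`. -/
structure IsGermLift (Q₁ : QStr S₁) (Q₂ : QStr S₂) (f : S₁ → S₂) (g : Q₁.M → Q₂.M)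
    (m : Q₁.M) : Prop where
  smooth : SmoothNear Q₁.M Q₂.M g m
  lift : ∀ᶠ z in 𝓝 m, Q₂.π (g z) = f (Q₁.π z)

/-- `f` is Q-smooth near the point `s`. -/
def QSmoothAt (Q₁ : QStr S₁) (Q₂ : QStr S₂) (f : S₁ → S₂) (s : S₁) : Prop :=
  QSmoothOn Q₁ Q₂ f {s}

variable {Q : QStr S} {Q₁ : QStr S₁} {Q₂ : QStr S₂} {Q₃ : QStr S₃} {Q₄ : QStr S₄}

theorem qSmoothOn_iff {f : S₁ → S₂} {V : Set S₁} :
    QSmoothOn Q₁ Q₂ f V ↔ ∀ s ∈ V, QSmoothAt Q₁ Q₂ f s :=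
  ⟨fun h _ hs m hm => h m (hm ▸ hs), fun h m hm => h _ hm m rfl⟩

theorem qSmooth_iff {f : S₁ → S₂} : QSmooth Q₁ Q₂ f ↔ ∀ s, QSmoothAt Q₁ Q₂ f s :=
  qSmoothOn_iff.trans ⟨fun h s => h s trivial, fun h s _ => h s⟩

theorem QSmooth.qSmoothAt {f : S₁ → S₂} (h : QSmooth Q₁ Q₂ f) (s : S₁) : QSmoothAt Q₁ Q₂ f s :=
  qSmooth_iff.1 h s

theorem QSmoothOn.qSmoothAt {f : S₁ → S₂} {V : Set S₁} (h : QSmoothOn Q₁ Q₂ f V) {s : S₁}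
    (hs : s ∈ V) : QSmoothAt Q₁ Q₂ f s := qSmoothOn_iff.1 h s hs

namespace IsGermLift

theorem self {f : S₁ → S₂} {g : Q₁.M → Q₂.M} {m : Q₁.M} (h : IsGermLift Q₁ Q₂ f g m) :
    Q₂.π (g m) = f (Q₁.π m) := h.lift.self_of_nhds

theorem of_isOpen {f : S₁ → S₂} {g : Q₁.M → Q₂.M} {m : Q₁.M} {U : Set Q₁.M} (hU : IsOpen U)
    (hm : m ∈ U) (hg : ContMDiffOn Q₁.M.I Q₂.M.I ∞ g U) (h : ∀ z ∈ U, Q₂.π (g z) = f (Q₁.π z)) :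
    IsGermLift Q₁ Q₂ f g m :=
  ⟨hg.smoothNear hU hm, Filter.eventually_of_mem (hU.mem_nhds hm) h⟩

theorem exists_isOpen {f : S₁ → S₂} {g : Q₁.M → Q₂.M} {m : Q₁.M} (h : IsGermLift Q₁ Q₂ f g m) :
    ∃ U : Set Q₁.M, IsOpen U ∧ m ∈ U ∧ ContMDiffOn Q₁.M.I Q₂.M.I ∞ g U ∧
      ∀ z ∈ U, Q₂.π (g z) = f (Q₁.π z) := by
  obtain ⟨U, hUs, hU, hm⟩ := mem_nhds_iff.1 (h.smooth.and h.lift)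
  exact ⟨U, hU, hm, fun z hz => (hUs hz).1.contMDiffWithinAt, fun z hz => (hUs hz).2⟩

theorem comp {f : S₁ → S₂} {f' : S₂ → S₃} {g : Q₁.M → Q₂.M} {g' : Q₂.M → Q₃.M} {m : Q₁.M}
    (h' : IsGermLift Q₂ Q₃ f' g' (g m)) (h : IsGermLift Q₁ Q₂ f g m) :
    IsGermLift Q₁ Q₃ (fun x => f' (f x)) (fun z => g' (g z)) m := by
  refine ⟨h'.smooth.comp h.smooth, ?_⟩
  filter_upwards [h.lift, h.smooth.continuousAt.eventually h'.lift] with z hz hz'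
  rw [hz', hz]

theorem congr {f f' : S₁ → S₂} {g : Q₁.M → Q₂.M} {m : Q₁.M} (h : IsGermLift Q₁ Q₂ f g m)
    (e : ∀ᶠ x in Q₁.nhd (Q₁.π m), f' x = f x) : IsGermLift Q₁ Q₂ f' g m := by
  refine ⟨h.smooth, ?_⟩
  filter_upwards [h.lift, QStr.eventually_nhd_π.1 e] with z hz hz'
  rw [hz, hz']

theorem eventually {f : S₁ → S₂} {g : Q₁.M → Q₂.M} {m : Q₁.M} (h : IsGermLift Q₁ Q₂ f g m) :
    ∀ᶠ z in 𝓝 m, IsGermLift Q₁ Q₂ f g z := by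
  filter_upwards [h.smooth.eventually, eventually_eventually_nhds.2 h.lift] with z hz hz'
  exact ⟨hz, hz'⟩

end IsGermLift

/-- Points of the same fibre of a Q-atlas are related by a smooth lift of the identity. -/
theorem QStr.exists_transition (Q : QStr S) {m n : Q.M} (e : Q.π m = Q.π n) :
    ∃ h : Q.M → Q.M, IsGermLift Q Q (fun x => x) h m ∧ h m = n := by
  obtain ⟨h, hx, hy, hh, -, hπ⟩ := Q.isQChart.transverse m n e
  exact ⟨h, .of_isOpen h.open_source hx hh hπ, hy⟩

/-- One preimage of the point is enough: a lift near any other preimage is obtained by precomposing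
with a transition. -/
theorem IsGermLift.qSmoothAt {f : S₁ → S₂} {g : Q₁.M → Q₂.M} {m : Q₁.M}
    (h : IsGermLift Q₁ Q₂ f g m) : QSmoothAt Q₁ Q₂ f (Q₁.π m) := by
  intro m' hm'
  obtain ⟨k, hk, hkm⟩ := Q₁.exists_transition hm'
  exact ⟨_, _, (IsGermLift.comp (hkm ▸ h) hk).exists_isOpen.choose_spec⟩

namespace QSmoothAt

/-- A transition of the target atlas, composed after an arbitrary lift, moves its value at `m` to
the prescribed one. -/
theorem exists_lift {f : S₁ → S₂} {m : Q₁.M} (hf : QSmoothAt Q₁ Q₂ f (Q₁.π m)) {n : Q₂.M}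
    (e : Q₂.π n = f (Q₁.π m)) : ∃ g, IsGermLift Q₁ Q₂ f g m ∧ g m = n := by
  obtain ⟨U, g, hU, hm, hg, hl⟩ := hf m rfl
  have hg' := IsGermLift.of_isOpen hU hm hg hl
  obtain ⟨k, hk, hkm⟩ := Q₂.exists_transition (hg'.self.trans e.symm)
  exact ⟨_, hk.comp hg', hkm⟩

theorem exists_lift' {f : S₁ → S₂} {m : Q₁.M} (hf : QSmoothAt Q₁ Q₂ f (Q₁.π m)) :
    ∃ g, IsGermLift Q₁ Q₂ f g m := by
  obtain ⟨g, hg, -⟩ := hf.exists_lift (Q₂.π_out _)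
  exact ⟨g, hg⟩

theorem exists_isLiftAt {f : S₁ → S₂} {s : S₁} (hf : QSmoothAt Q₁ Q₂ f s) :
    ∃ g, IsLiftAt Q₁ Q₂ f s g := QSmoothOn.exists_isLiftAt hf rfl

theorem comp {f : S₁ → S₂} {f' : S₂ → S₃} {s : S₁} (hf' : QSmoothAt Q₂ Q₃ f' (f s))
    (hf : QSmoothAt Q₁ Q₂ f s) : QSmoothAt Q₁ Q₃ (fun x => f' (f x)) s := by
  obtain ⟨m, rfl⟩ : ∃ m, Q₁.π m = s := ⟨_, Q₁.π_out s⟩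
  obtain ⟨g, hg⟩ := hf.exists_lift'
  rw [← hg.self] at hf'
  obtain ⟨g', hg'⟩ := hf'.exists_lift'
  exact (hg'.comp hg).qSmoothAt

theorem congr {f f' : S₁ → S₂} {s : S₁} (hf : QSmoothAt Q₁ Q₂ f s)
    (e : ∀ᶠ x in Q₁.nhd s, f' x = f x) : QSmoothAt Q₁ Q₂ f' s := by
  obtain ⟨m, rfl⟩ : ∃ m, Q₁.π m = s := ⟨_, Q₁.π_out s⟩
  obtain ⟨g, hg⟩ := hf.exists_lift'
  exact (hg.congr e).qSmoothAt

theorem eventually {f : S₁ → S₂} {s : S₁} (hf : QSmoothAt Q₁ Q₂ f s) :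
    ∀ᶠ x in Q₁.nhd s, QSmoothAt Q₁ Q₂ f x := by
  obtain ⟨m, rfl⟩ : ∃ m, Q₁.π m = s := ⟨_, Q₁.π_out s⟩
  obtain ⟨g, hg⟩ := hf.exists_lift'
  refine QStr.eventually_nhd_π.2 ?_
  filter_upwards [hg.eventually] with z hz
  exact hz.qSmoothAt

theorem tendsto {f : S₁ → S₂} {s : S₁} (hf : QSmoothAt Q₁ Q₂ f s) :
    Filter.Tendsto f (Q₁.nhd s) (Q₂.nhd (f s)) := by
  obtain ⟨m, rfl⟩ : ∃ m, Q₁.π m = s := ⟨_, Q₁.π_out s⟩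
  obtain ⟨g, hg⟩ := hf.exists_lift'
  intro p hp
  rw [← hg.self] at hp
  refine QStr.eventually_nhd_π.2 ?_
  filter_upwards [hg.lift, hg.smooth.continuousAt.eventually (QStr.eventually_nhd_π.1 hp)] with z h h'
  rwa [← h]

theorem prodMk {f : S₁ → S₂} {f' : S₁ → S₃} {s : S₁} (hf : QSmoothAt Q₁ Q₂ f s)
    (hf' : QSmoothAt Q₁ Q₃ f' s) : QSmoothAt Q₁ (Q₂.prod Q₃) (fun x => (f x, f' x)) s := by
  obtain ⟨m, rfl⟩ : ∃ m, Q₁.π m = s := ⟨_, Q₁.π_out s⟩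
  obtain ⟨g, hg⟩ := hf.exists_lift'
  obtain ⟨g', hg'⟩ := hf'.exists_lift'
  refine IsGermLift.qSmoothAt (Q₂ := Q₂.prod Q₃) (g := fun z => ((g z, g' z) : Q₂.M × Q₃.M))
    ⟨hg.smooth.prodMk hg'.smooth, ?_⟩
  filter_upwards [hg.lift, hg'.lift] with z h h'
  exact Prod.ext h h'

theorem qSmoothOn {f : S₁ → S₂} {V : Set S₁} (h : ∀ s ∈ V, QSmoothAt Q₁ Q₂ f s) :
    QSmoothOn Q₁ Q₂ f V := qSmoothOn_iff.2 h

end QSmoothAt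

theorem qSmooth_fst : QSmooth (Q₁.prod Q₂) Q₁ (fun x => x.1) := fun _ _ =>
  ⟨Set.univ, fun z => z.1, isOpen_univ, trivial, contMDiff_fst.contMDiffOn, fun _ _ => rfl⟩

theorem qSmooth_snd : QSmooth (Q₁.prod Q₂) Q₂ (fun x => x.2) := fun _ _ =>
  ⟨Set.univ, fun z => z.2, isOpen_univ, trivial, contMDiff_snd.contMDiffOn, fun _ _ => rfl⟩

theorem QSmoothAt.fst {f : S → S₁ × S₂} {s : S} (h : QSmoothAt Q (Q₁.prod Q₂) f s) :
    QSmoothAt Q Q₁ (fun x => (f x).1) s := (qSmooth_fst.qSmoothAt _).comp h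

theorem QSmoothAt.snd {f : S → S₁ × S₂} {s : S} (h : QSmoothAt Q (Q₁.prod Q₂) f s) :
    QSmoothAt Q Q₂ (fun x => (f x).2) s := (qSmooth_snd.qSmoothAt _).comp h

theorem qSmoothAt_toQ {T M : SmoothMfd.{u}} {f : T → M} {t : T} :
    QSmoothAt T.toQ M.toQ f t ↔ SmoothNear T M f t := by
  constructor
  · intro h
    obtain ⟨g, hg⟩ := QSmoothAt.exists_lift' (Q₁ := T.toQ) (Q₂ := M.toQ) (m := t) h
    exact hg.smooth.congr (hg.lift.mono fun z hz => hz.symm)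
  · intro h
    exact IsGermLift.qSmoothAt (Q₁ := T.toQ) (Q₂ := M.toQ) (g := f) (m := t)
      ⟨h, Filter.Eventually.of_forall fun _ => rfl⟩

/-- A smooth map into the atlas of `Q`, seen as a map into the Q-manifold. -/
theorem SmoothNear.qSmoothAt_π {T : SmoothMfd.{u}} {g : T → Q.M} {t : T}
    (h : SmoothNear T Q.M g t) : QSmoothAt T.toQ Q (fun z => Q.π (g z)) t :=
  (Q.qSmooth_π.qSmoothAt (g t)).comp (qSmoothAt_toQ.2 h)

/-- A Q-smooth map from a manifold lifts to the atlas, with prescribed value at one point. -/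
theorem QSmoothAt.exists_lift_toQ {T : SmoothMfd.{u}} {f : T → S} {t : T}
    (h : QSmoothAt T.toQ Q f t) {n : Q.M} (e : Q.π n = f t) :
    ∃ g : T → Q.M, SmoothNear T Q.M g t ∧ (∀ᶠ z in 𝓝 t, Q.π (g z) = f z) ∧ g t = n := by
  obtain ⟨g, hg, hn⟩ := QSmoothAt.exists_lift (Q₁ := T.toQ) (m := t) h e
  exact ⟨g, hg.smooth, hg.lift, hn⟩

/-- Smoothness may be tested after composition with the atlas. -/
theorem qSmoothAt_of_comp_π {f : S₁ → S₂} {m : Q₁.M}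
    (h : QSmoothAt Q₁.M.toQ Q₂ (fun z => f (Q₁.π z)) m) : QSmoothAt Q₁ Q₂ f (Q₁.π m) := by
  obtain ⟨g, hg, hl, -⟩ := h.exists_lift_toQ (Q₂.π_out _)
  exact IsGermLift.qSmoothAt ⟨hg, hl⟩

theorem QSmoothAt.comp_π {f : S₁ → S₂} {m : Q₁.M} (h : QSmoothAt Q₁ Q₂ f (Q₁.π m)) :
    QSmoothAt Q₁.M.toQ Q₂ (fun z => f (Q₁.π z)) m :=
  QSmoothAt.comp (f := Q₁.π) h (Q₁.qSmooth_π.qSmoothAt _)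

end

/-! ### Tangent maps and lifts -/

section
variable {S S₁ S₂ S₃ S₄ : Type u}
variable {Q : QStr S} {Q₁ : QStr S₁} {Q₂ : QStr S₂} {Q₃ : QStr S₃} {Q₄ : QStr S₄}

/-- The tangent vector of a Q-manifold represented by a tangent vector of its atlas. -/
noncomputable def QStr.vec (Q : QStr S) (m : Q.M) (v : TangentSpace Q.M.I m) : Q.TB :=
  ⟨Q.π m, tmapAt Q.M.toQ Q Q.π m v⟩

theorem QStr.vec_injective {m : Q.M} {v w : TangentSpace Q.M.I m} (h : Q.vec m v = Q.vec m w) :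
    v = w :=
  (Q.bijective_tmapAt_π m).1 (eq_of_heq (Sigma.mk.inj h).2)

theorem QStr.exists_vec (w : Q.TB) {m : Q.M} (e : Q.π m = w.1) : ∃ v, Q.vec m v = w := by
  obtain ⟨s, w⟩ := w
  obtain rfl : Q.π m = s := e
  obtain ⟨v, hv⟩ := (Q.bijective_tmapAt_π m).2 w
  exact ⟨v, Sigma.ext rfl (heq_of_eq hv)⟩

/-- All tangent spaces of the Q-manifold unfold to the one model space `Q.M.E`, so vectors over `a`
and over `b` can be compared there without transport along `h`. -/
theorem QStr.TB.mk_congr {a b : S} (h : a = b) {v : Q.TSpace a} {w : Q.TSpace b}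
    (e : (v : Q.M.E) = w) : (⟨a, v⟩ : Q.TB) = ⟨b, w⟩ := by
  subst h
  exact Sigma.ext rfl (heq_of_eq e)

theorem IsGermLift.mfderiv_comp {f : S₁ → S₂} {f' : S₂ → S₃} {g : Q₁.M → Q₂.M} {g' : Q₂.M → Q₃.M}
    {m : Q₁.M} (h' : IsGermLift Q₂ Q₃ f' g' (g m)) (h : IsGermLift Q₁ Q₂ f g m)
    (v : TangentSpace Q₁.M.I m) :
    mfderiv Q₁.M.I Q₃.M.I (fun z => g' (g z)) m v =
      mfderiv Q₂.M.I Q₃.M.I g' (g m) (mfderiv Q₁.M.I Q₂.M.I g m v) :=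
  mfderiv_comp_apply (I' := Q₂.M.I) m h'.smooth.mdifferentiableAt h.smooth.mdifferentiableAt v

theorem IsGermLift.isLiftAt {f : S₁ → S₂} {g : Q₁.M → Q₂.M} {s : S₁}
    (h : IsGermLift Q₁ Q₂ f g (Q₁.out s)) (e : g (Q₁.out s) = Q₂.out (f s)) :
    IsLiftAt Q₁ Q₂ f s g := ⟨e, h.exists_isOpen⟩

theorem QStr.vec_eq {k : Q.M → Q.M} {m : Q.M} (hk : IsGermLift Q Q (fun x => x) k m)
    (e : k m = Q.out (Q.π m)) (v : TangentSpace Q.M.I m) :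
    Q.vec m v = ⟨Q.π m, (mfderiv Q.M.I Q.M.I k m v : Q.M.E)⟩ := by
  have hl : IsLiftAt Q.M.toQ Q Q.π m k := ⟨e, hk.exists_isOpen⟩
  exact QStr.TB.mk_congr rfl (congrArg (fun L => L v) hl.tmapAt_eq)

/-- The tangent map is represented by the derivative of any smooth lift. -/
theorem IsGermLift.tmap_vec {f : S₁ → S₂} {g : Q₁.M → Q₂.M} {m : Q₁.M}
    (h : IsGermLift Q₁ Q₂ f g m) (v : TangentSpace Q₁.M.I m) :
    tmap Q₁ Q₂ f (Q₁.vec m v) = Q₂.vec (g m) (mfderiv Q₁.M.I Q₂.M.I g m v) := by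
  obtain ⟨k, hk, hkm⟩ := Q₁.exists_transition (Q₁.π_out (Q₁.π m)).symm
  obtain ⟨k', hk', hkm'⟩ := Q₁.exists_transition (Q₁.π_out (Q₁.π m))
  obtain ⟨l, hl, hlm⟩ := Q₂.exists_transition (m := g m) (n := Q₂.out (f (Q₁.π m)))
    (by rw [h.self, Q₂.π_out])
  have hlg := IsGermLift.comp hl h
  have hlgk : IsGermLift Q₁ Q₂ f (fun z => l (g (k' z))) (Q₁.out (Q₁.π m)) :=
    IsGermLift.comp (hkm'.symm ▸ hlg) hk'
  have hlift := hlgk.isLiftAt (by rw [hkm', hlm])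
  rw [QStr.vec_eq hk hkm, QStr.vec_eq hl (by rw [hlm, h.self])]
  refine QStr.TB.mk_congr h.self.symm ?_
  rw [hlift.tmapAt_eq]
  have h1 := IsGermLift.mfderiv_comp (hkm.symm ▸ hlgk) hk v
  have h2 := IsGermLift.mfderiv_comp hl h v
  rw [hkm] at h1
  refine h1.symm.trans (Eq.trans ?_ h2)
  -- The composite lifts the identity and fixes `m`, hence is the identity near `m`. This removes
  -- the detour through the chosen preimage from the derivative.
  have hid : ∀ᶠ z in 𝓝 m, k' (k z) = z := by
    refine Q₁.eventually_eq_of_lift (IsGermLift.comp (hkm.symm ▸ hk') hk).smooth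
      (smoothNear_id m) ?_ (by rw [hkm, hkm'])
    exact (IsGermLift.comp (hkm.symm ▸ hk') hk).lift
  have : (fun z => l (g (k' (k z)))) =ᶠ[𝓝 m] fun z => l (g z) := by
    filter_upwards [hid] with z hz
    rw [hz]
  exact congrArg (fun L : Q₁.M.E →L[ℝ] Q₂.M.E => L v) this.mfderiv_eq

theorem QStr.vec_out (w : Q.TB) : Q.vec (Q.out w.1) w.2 = w := Q.tangent.π_out w

theorem SmoothMfd.vec_toQ {M : SmoothMfd.{u}} (x : M) (v : TangentSpace M.I x) :
    M.toQ.vec x v = ⟨x, v⟩ := QStr.vec_out (Q := M.toQ) ⟨x, v⟩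

theorem SmoothNear.tmap_toQ {T : SmoothMfd.{u}} {g : T → Q.M} {t : T} (h : SmoothNear T Q.M g t)
    (w : TangentSpace T.I t) :
    tmap T.toQ Q (fun z => Q.π (g z)) ⟨t, w⟩ = Q.vec (g t) (mfderiv T.I Q.M.I g t w) := by
  have := IsGermLift.tmap_vec (Q₁ := T.toQ) (Q₂ := Q) (f := fun z => Q.π (g z)) (g := g) (m := t)
    ⟨h, Filter.Eventually.of_forall fun _ => rfl⟩ w
  rwa [SmoothMfd.vec_toQ] at this

theorem tmap_toQ_toQ {T M : SmoothMfd.{u}} {g : T → M} {t : T} (h : SmoothNear T M g t)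
    (w : TangentSpace T.I t) :
    tmap T.toQ M.toQ g ⟨t, w⟩ = ⟨g t, mfderiv T.I M.I g t w⟩ := by
  rw [← SmoothMfd.vec_toQ (g t)]
  exact SmoothNear.tmap_toQ (Q := M.toQ) h w

theorem QStr.TB.induction {p : Q.TB → Prop} (h : ∀ m v, p (Q.vec m v)) (w : Q.TB) : p w := by
  rw [← QStr.vec_out w]; exact h _ _

theorem tmap_congr {f f' : S₁ → S₂} {w : Q₁.TB} (hf : QSmoothAt Q₁ Q₂ f w.1)
    (e : ∀ᶠ x in Q₁.nhd w.1, f' x = f x) : tmap Q₁ Q₂ f' w = tmap Q₁ Q₂ f w := by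
  induction w using QStr.TB.induction with
  | h m v =>
    obtain ⟨g, hg⟩ := QSmoothAt.exists_lift' hf
    rw [hg.tmap_vec, (hg.congr e).tmap_vec]

theorem tmap_comp_of_qSmoothAt {f : S₁ → S₂} {f' : S₂ → S₃} {w : Q₁.TB}
    (hf' : QSmoothAt Q₂ Q₃ f' (f w.1)) (hf : QSmoothAt Q₁ Q₂ f w.1) :
    tmap Q₁ Q₃ (fun x => f' (f x)) w = tmap Q₂ Q₃ f' (tmap Q₁ Q₂ f w) :=
  Sigma.ext rfl (heq_of_eq (tmapAt_comp hf'.exists_isLiftAt hf.exists_isLiftAt _))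

theorem SmoothNear.tangentMap {M N : SmoothMfd.{u}} {g : M → N} {p : TangentBundle M.I M}
    (h : SmoothNear M N g p.proj) : SmoothNear M.tangent N.tangent (tangentMap M.I N.I g) p := by
  obtain ⟨U, hUs, hU, hm⟩ := mem_nhds_iff.1 h
  have := contMDiffOn_tangentMap_of_isOpen hU (fun z hz => (hUs hz).contMDiffWithinAt)
  exact ContMDiffOn.smoothNear (M := M.tangent) (N := N.tangent) this
    (hU.preimage (FiberBundle.continuous_proj M.E (TangentSpace M.I))) hm

theorem IsGermLift.tangentMap {f : S₁ → S₂} {g : Q₁.M → Q₂.M} {p : TangentBundle Q₁.M.I Q₁.M}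
    (h : IsGermLift Q₁ Q₂ f g p.proj) :
    IsGermLift Q₁.tangent Q₂.tangent (tmap Q₁ Q₂ f) (tangentMap Q₁.M.I Q₂.M.I g) p := by
  refine ⟨h.smooth.tangentMap, ?_⟩
  have hc : Continuous (fun q : TangentBundle Q₁.M.I Q₁.M => q.proj) :=
    FiberBundle.continuous_proj Q₁.M.E (TangentSpace Q₁.M.I)
  have h' := hc.continuousAt.eventually h.eventually
  exact h'.mono fun q hq => (hq.tmap_vec q.2).symm

theorem QSmoothAt.tmap {f : S₁ → S₂} {w : Q₁.TB} (h : QSmoothAt Q₁ Q₂ f w.1) :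
    QSmoothAt Q₁.tangent Q₂.tangent (tmap Q₁ Q₂ f) w := by
  induction w using QStr.TB.induction with
  | h m v =>
    obtain ⟨g, hg⟩ := QSmoothAt.exists_lift' h
    exact (IsGermLift.tangentMap (p := ⟨m, v⟩) hg).qSmoothAt

theorem QSmooth.tmap {f : S₁ → S₂} (h : QSmooth Q₁ Q₂ f) :
    QSmooth Q₁.tangent Q₂.tangent (tmap Q₁ Q₂ f) :=
  qSmooth_iff.2 fun w => (h.qSmoothAt w.1).tmap

theorem QStr.qSmooth_tangent_fst : QSmooth Q.tangent Q (fun w => w.1) := by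
  have hp : ContMDiff Q.M.I.tangent Q.M.I ∞ (fun p : TangentBundle Q.M.I Q.M => p.proj) :=
    Bundle.contMDiff_proj _
  exact fun _ _ => ⟨Set.univ, fun p : TangentBundle Q.M.I Q.M => p.proj, isOpen_univ, trivial,
    hp.contMDiffOn, fun _ _ => rfl⟩

theorem QStr.vec_prod (m : Q₁.M) (n : Q₂.M) (v : TangentSpace Q₁.M.I m) (w : TangentSpace Q₂.M.I n) :
    tmap (Q₁.prod Q₂) Q₁ (fun x => x.1) ((Q₁.prod Q₂).vec (m, n) (v, w)) = Q₁.vec m v ∧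
    tmap (Q₁.prod Q₂) Q₂ (fun x => x.2) ((Q₁.prod Q₂).vec (m, n) (v, w)) = Q₂.vec n w := by
  constructor
  · have h : IsGermLift (Q₁.prod Q₂) Q₁ (fun x => x.1) (fun z => z.1) (m, n) :=
      ⟨smoothNear_fst _, Filter.Eventually.of_forall fun _ => rfl⟩
    refine (h.tmap_vec _).trans (congrArg (Q₁.vec m) ?_)
    exact congrArg (fun L => L (v, w)) (mfderiv_fst (I := Q₁.M.I) (I' := Q₂.M.I) (x := (m, n)))
  · have h : IsGermLift (Q₁.prod Q₂) Q₂ (fun x => x.2) (fun z => z.2) (m, n) :=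
      ⟨smoothNear_snd _, Filter.Eventually.of_forall fun _ => rfl⟩
    refine (h.tmap_vec _).trans (congrArg (Q₂.vec n) ?_)
    exact congrArg (fun L => L (v, w)) (mfderiv_snd (I := Q₁.M.I) (I' := Q₂.M.I) (x := (m, n)))

theorem QStr.TB.prod_ext {w w' : (Q₁.prod Q₂).TB}
    (h₁ : tmap (Q₁.prod Q₂) Q₁ (fun x => x.1) w = tmap (Q₁.prod Q₂) Q₁ (fun x => x.1) w')
    (h₂ : tmap (Q₁.prod Q₂) Q₂ (fun x => x.2) w = tmap (Q₁.prod Q₂) Q₂ (fun x => x.2) w') :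
    w = w' := by
  induction w using QStr.TB.induction with
  | h m v =>
    have e : w'.1 = (Q₁.prod Q₂).π m :=
      Prod.ext (congrArg Sigma.fst h₁).symm (congrArg Sigma.fst h₂).symm
    obtain ⟨v', rfl⟩ := QStr.exists_vec w' e.symm
    obtain ⟨m, n⟩ := m
    obtain ⟨v₁, v₂⟩ := v
    obtain ⟨v₁', v₂'⟩ := v'
    have a := (QStr.vec_prod m n v₁ v₂).1.symm.trans (h₁.trans (QStr.vec_prod m n v₁' v₂').1)
    have b := (QStr.vec_prod m n v₁ v₂).2.symm.trans (h₂.trans (QStr.vec_prod m n v₁' v₂').2)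
    rw [QStr.vec_injective a, QStr.vec_injective b]

/-- The tangent vectors of pairs of maps are determined by those of the components. -/
theorem tmap_prodMk_congr {f : S₁ → S₂} {f' f'' : S₁ → S₃} {w : Q₁.TB}
    (hf : QSmoothAt Q₁ Q₂ f w.1) (hf' : QSmoothAt Q₁ Q₃ f' w.1) (hf'' : QSmoothAt Q₁ Q₃ f'' w.1)
    (e : tmap Q₁ Q₃ f' w = tmap Q₁ Q₃ f'' w) :
    tmap Q₁ (Q₂.prod Q₃) (fun x => (f x, f' x)) w =
      tmap Q₁ (Q₂.prod Q₃) (fun x => (f x, f'' x)) w := by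
  apply QStr.TB.prod_ext
  · rw [← tmap_comp_of_qSmoothAt (qSmooth_fst.qSmoothAt _) (hf.prodMk hf'),
      ← tmap_comp_of_qSmoothAt (qSmooth_fst.qSmoothAt _) (hf.prodMk hf'')]
  · rw [← tmap_comp_of_qSmoothAt (qSmooth_snd.qSmoothAt _) (hf.prodMk hf'),
      ← tmap_comp_of_qSmoothAt (qSmooth_snd.qSmoothAt _) (hf.prodMk hf'')]
    exact e

/-- The inclusion of `TS₁ × S₂` into `T(S₁ × S₂)` is Q-smooth. -/
theorem qSmooth_tmap_prodMk_left : QSmooth (Q₁.tangent.prod Q₂) (Q₁.prod Q₂).tangent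
    (fun x => tmap Q₁ (Q₁.prod Q₂) (fun a => (a, x.2)) x.1) := by
  -- The lift puts the zero section in the second factor of `TM₁ × TM₂`, identified with `T(M₁ ×
  -- M₂)`.
  refine fun z _ => ⟨Set.univ, fun z => (equivTangentBundleProd Q₁.M.I Q₁.M Q₂.M.I Q₂.M).symm
    (z.1, Bundle.zeroSection Q₂.M.E (TangentSpace Q₂.M.I) z.2), isOpen_univ, trivial, ?_, ?_⟩
  · have h1 : ContMDiff (Q₁.M.I.tangent.prod Q₂.M.I) (Q₁.M.I.tangent.prod Q₂.M.I.tangent) ∞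
        (fun z : TangentBundle Q₁.M.I Q₁.M × Q₂.M =>
          (z.1, Bundle.zeroSection Q₂.M.E (TangentSpace Q₂.M.I) z.2)) :=
      contMDiff_fst.prodMk ((Bundle.contMDiff_zeroSection ℝ (TangentSpace Q₂.M.I)).comp
        contMDiff_snd)
    exact (ContMDiff.comp (contMDiff_equivTangentBundleProd_symm (I := Q₁.M.I) (M := Q₁.M)
      (I' := Q₂.M.I) (M' := Q₂.M)) h1).contMDiffOn
  · rintro ⟨⟨m, v⟩, n⟩ -
    have hl : IsGermLift Q₁ (Q₁.prod Q₂) (fun a => (a, Q₂.π n)) (fun z => (z, n)) m :=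
      ⟨(smoothNear_id m).prodMk (smoothNear_const n m), Filter.Eventually.of_forall fun _ => rfl⟩
    refine ((hl.tmap_vec v).trans ?_).symm
    refine congrArg ((Q₁.prod Q₂).vec (m, n)) ?_
    exact congrArg (fun L => L v)
      (mfderiv_prod_left (I := Q₁.M.I) (I' := Q₂.M.I) (x₀ := m) (y₀ := n))

/-- Partial tangent maps `(w, y) ↦ T(A(·, y)) w` are Q-smooth. -/
theorem qSmoothAt_tmap_left {A : S₁ × S₂ → S₃} {x : Q₁.TB × S₂}
    (hA : QSmoothAt (Q₁.prod Q₂) Q₃ A (x.1.1, x.2)) : QSmoothAt (Q₁.tangent.prod Q₂) Q₃.tangent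
      (fun x => tmap Q₁ Q₃ (fun a => A (a, x.2)) x.1) x := by
  have h1 : QSmoothAt (Q₁.tangent.prod Q₂) Q₃.tangent
      (fun x => tmap (Q₁.prod Q₂) Q₃ A (tmap Q₁ (Q₁.prod Q₂) (fun a => (a, x.2)) x.1)) x :=
    QSmoothAt.comp (f := fun x : Q₁.TB × S₂ => tmap Q₁ (Q₁.prod Q₂) (fun a => (a, x.2)) x.1)
      (QSmoothAt.tmap hA) (qSmooth_tmap_prodMk_left.qSmoothAt x)
  -- By the chain rule the partial tangent map is the full tangent map of `A` restricted to vectors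
  -- that vanish in the second factor.
  refine h1.congr ?_
  have hp : QSmooth (Q₁.tangent.prod Q₂) (Q₁.prod Q₂) (fun x => (x.1.1, x.2)) :=
    (QStr.qSmooth_tangent_fst.comp qSmooth_fst).prodMk qSmooth_snd
  filter_upwards [(hp.qSmoothAt x).tendsto.eventually hA.eventually] with y hy
  exact tmap_comp_of_qSmoothAt hy (((qSmooth_id Q₁).prodMk (qSmooth_const _ _ y.2)).qSmoothAt _)

end

/-! ### Lie brackets of related vector fields -/

open VectorField in
-- Both relations are differentiated, the second in the direction `V x` and the first in the
-- direction `W x`, and subtracted. The terms with the second derivative of `f` cancel by symmetry,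
-- which is the content of `fderiv_apply_lieBracket`. The derivatives of the `A i` and `B j` combine
-- to brackets, those of the coefficients give the two single sums.
theorem fderiv_lieBracket_of_related {E F : Type*} [NormedAddCommGroup E] [NormedSpace ℝ E]
    [NormedAddCommGroup F] [NormedSpace ℝ F] {ι κ : Type} [Fintype ι] [Fintype κ] {f : E → F} {x : E}
    {V W : E → E} {A : ι → F → F} {B : κ → F → F} {a : ι → E → ℝ} {b : κ → E → ℝ}
    (hf : ContDiffAt ℝ 2 f x) (hV : DifferentiableAt ℝ V x) (hW : DifferentiableAt ℝ W x)
    (hA : ∀ i, DifferentiableAt ℝ (A i) (f x)) (hB : ∀ j, DifferentiableAt ℝ (B j) (f x))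
    (ha : ∀ i, DifferentiableAt ℝ (a i) x) (hb : ∀ j, DifferentiableAt ℝ (b j) x)
    (hVA : ∀ᶠ y in 𝓝 x, fderiv ℝ f y (V y) = ∑ i, a i y • A i (f y))
    (hWB : ∀ᶠ y in 𝓝 x, fderiv ℝ f y (W y) = ∑ j, b j y • B j (f y)) :
    fderiv ℝ f x (lieBracket ℝ V W x) =
      (∑ i, ∑ j, (a i x * b j x) • lieBracket ℝ (A i) (B j) (f x)) +
      (∑ j, fderiv ℝ (b j) x (V x) • B j (f x)) - ∑ i, fderiv ℝ (a i) x (W x) • A i (f x) := by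
  have hfd : DifferentiableAt ℝ f x := hf.differentiableAt (by simp)
  have key : ∀ {μ : Type} [Fintype μ] (C : μ → F → F) (c : μ → E → ℝ) (U : E → E) (w : E),
      (∀ i, DifferentiableAt ℝ (C i) (f x)) → (∀ i, DifferentiableAt ℝ (c i) x) →
      (∀ᶠ y in 𝓝 x, fderiv ℝ f y (U y) = ∑ i, c i y • C i (f y)) →
      fderiv ℝ (fun y => fderiv ℝ f y (U y)) x w =
        (∑ i, c i x • fderiv ℝ (C i) (f x) (fderiv ℝ f x w)) +
          ∑ i, fderiv ℝ (c i) x w • C i (f x) := by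
    intro μ _ C c U w hC hc h
    rw [Filter.EventuallyEq.fderiv_eq h]
    have : ∀ i, HasFDerivAt (fun y => c i y • C i (f y))
        (c i x • (fderiv ℝ (C i) (f x)).comp (fderiv ℝ f x) +
          (fderiv ℝ (c i) x).smulRight (C i (f x))) x := fun i =>
      (hc i).hasFDerivAt.smul ((hC i).hasFDerivAt.comp x hfd.hasFDerivAt)
    rw [(HasFDerivAt.fun_sum fun i _ => this i).fderiv]
    simp [Finset.sum_add_distrib]
  rw [fderiv_apply_lieBracket hf (by simp) hW hV, key B b W (V x) hB hb hWB, key A a V (W x) hA ha hVA,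
    hVA.self_of_nhds, hWB.self_of_nhds]
  simp only [lieBracket_eq, map_sum, map_smul, smul_sub, Finset.sum_sub_distrib, Finset.smul_sum,
    smul_smul]
  rw [Finset.sum_comm]
  simp only [mul_comm]
  abel

/-- The vector field `V` in the parametrization `κ`. -/
noncomputable def SmoothMfd.localRep (M : SmoothMfd.{u}) (κ : M.E → M) (V : ∀ x : M, TangentSpace M.I x) :
    M.E → M.E := VectorField.mpullback 𝓘(ℝ, M.E) M.I κ V

/-- The derivative of a parametrization. -/
noncomputable def SmoothMfd.paramDeriv (M : SmoothMfd.{u}) (κ : M.E → M) (y : M.E) :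
    M.E →L[ℝ] M.E := mfderiv 𝓘(ℝ, M.E) M.I κ y

theorem SmoothMfd.paramDeriv_localRep {M : SmoothMfd.{u}} {κ : M.E → M} {y : M.E}
    (hinv : (M.paramDeriv κ y).IsInvertible) (V : ∀ x : M, TangentSpace M.I x) :
    M.paramDeriv κ y (M.localRep κ V y) = V (κ y) := by
  obtain ⟨e, he⟩ := hinv
  have : M.localRep κ V y = (M.paramDeriv κ y).inverse (V (κ y)) := rfl
  rw [this, ← he, ContinuousLinearMap.inverse_equiv]
  exact e.apply_symm_apply _

open VectorField in
/-- The bracket of two vector fields in a parametrization `κ` of the manifold. -/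
theorem SmoothMfd.paramDeriv_lieBracket {M : SmoothMfd.{u}} {κ : M.E → M} {y : M.E}
    (hκ : ContMDiffAt 𝓘(ℝ, M.E) M.I ∞ κ y) (hinv : (M.paramDeriv κ y).IsInvertible)
    {V W : ∀ x : M, TangentSpace M.I x}
    (hV : MDifferentiableAt M.I M.I.tangent (fun z => (⟨z, V z⟩ : TangentBundle M.I M)) (κ y))
    (hW : MDifferentiableAt M.I M.I.tangent (fun z => (⟨z, W z⟩ : TangentBundle M.I M)) (κ y)) :
    M.paramDeriv κ y (lieBracket ℝ (M.localRep κ V) (M.localRep κ W) y) =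
      mlieBracket M.I V W (κ y) := by
  have : IsManifold M.I (minSmoothness ℝ 3) M := by
    rw [minSmoothness_of_isRCLikeNormedField]
    exact IsManifold.of_le (n := ∞) ENat.LEInfty.out
  have : CompleteSpace M.E := FiniteDimensional.complete ℝ _
  have h := mpullback_mlieBracket (I := 𝓘(ℝ, M.E)) hV hW hκ
    (by rw [minSmoothness_of_isRCLikeNormedField]; exact ENat.LEInfty.out)
  have h2 : mlieBracket 𝓘(ℝ, M.E) (mpullback 𝓘(ℝ, M.E) M.I κ V) (mpullback 𝓘(ℝ, M.E) M.I κ W) =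
      lieBracket ℝ (M.localRep κ V) (M.localRep κ W) := by
    rw [← mlieBracketWithin_univ, mlieBracketWithin_eq_lieBracketWithin]
    exact lieBracketWithin_univ
  have h3 := h.trans (congrFun h2 y)
  refine Eq.trans ?_ (M.paramDeriv_localRep hinv (mlieBracket M.I V W))
  exact congrArg (M.paramDeriv κ y) h3.symm

theorem SmoothMfd.differentiableAt_localRep {M : SmoothMfd.{u}} {κ : M.E → M} {y : M.E}
    (hκ : ContMDiffAt 𝓘(ℝ, M.E) M.I ∞ κ y) (hinv : (M.paramDeriv κ y).IsInvertible)
    {V : ∀ x : M, TangentSpace M.I x}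
    (hV : MDifferentiableAt M.I M.I.tangent (fun z => (⟨z, V z⟩ : TangentBundle M.I M)) (κ y)) :
    DifferentiableAt ℝ (M.localRep κ V) y := by
  have : CompleteSpace M.E := FiniteDimensional.complete ℝ _
  have h := MDifferentiableAt.mpullback_vectorField (I := 𝓘(ℝ, M.E)) hV hκ hinv ENat.LEInfty.out
  apply MDifferentiableAt.differentiableAt
  exact ((contMDiff_snd_tangentBundle_modelSpace M.E 𝓘(ℝ, M.E)
    (n := 1)).contMDiffAt.mdifferentiableAt one_ne_zero).comp y h

/-- The parametrization of a manifold around a point by its model vector space. -/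
theorem SmoothMfd.exists_param (M : SmoothMfd.{u}) (x : M) :
    ∃ (κ : M.E → M) (φ : M → M.E) (y : M.E), κ y = x ∧ φ x = y ∧
      (∀ᶠ z in 𝓝 y, ContMDiffAt 𝓘(ℝ, M.E) M.I ∞ κ z) ∧
      (∀ᶠ z in 𝓝 y, (M.paramDeriv κ z).IsInvertible) ∧
      (∀ᶠ z in 𝓝 x, ContMDiffAt M.I 𝓘(ℝ, M.E) ∞ φ z) ∧
      (∀ᶠ z in 𝓝 x, κ (φ z) = z) ∧ (∀ᶠ z in 𝓝 y, φ (κ z) = z) := by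
  have ht : (extChartAt M.I x).target ∈ 𝓝 (extChartAt M.I x x) := extChartAt_target_mem_nhds x
  refine ⟨(extChartAt M.I x).symm, extChartAt M.I x, extChartAt M.I x x, extChartAt_to_inv x, rfl,
    ?_, ?_, ?_, ?_, ?_⟩
  · filter_upwards [(isOpen_extChartAt_target x).mem_nhds (mem_extChartAt_target (I := M.I) x)] with z hz
    exact (contMDiffOn_extChartAt_symm (n := ∞) x).contMDiffAt
      ((isOpen_extChartAt_target x).mem_nhds hz)
  · filter_upwards [ht] with z hz
    have := isInvertible_mfderivWithin_extChartAt_symm (I := M.I) hz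
    rwa [M.I.range_eq_univ, mfderivWithin_univ] at this
  · filter_upwards [extChartAt_source_mem_nhds (I := M.I) x] with z hz
    exact contMDiffAt_extChartAt' (by rwa [extChartAt_source] at hz)
  · filter_upwards [extChartAt_source_mem_nhds (I := M.I) x] with z hz
    exact (extChartAt M.I x).left_inv hz
  · filter_upwards [ht] with z hz
    exact (extChartAt M.I x).right_inv hz

/-- If `dF ∘ V = ∑ aᵢ (Aᵢ ∘ F)` and `dF ∘ W = ∑ bⱼ (Bⱼ ∘ F)`, then `dF ∘ [V, W]` is given by the Leibniz rule. -/
theorem mlieBracket_of_related {M N : SmoothMfd.{u}} {F : M → N} {x : M} (hF : SmoothNear M N F x)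
    {ι κ : Type} [Fintype ι] [Fintype κ] {V W : ∀ x : M, TangentSpace M.I x}
    {A : ι → ∀ y : N, TangentSpace N.I y} {B : κ → ∀ y : N, TangentSpace N.I y}
    {a : ι → M → ℝ} {b : κ → M → ℝ}
    (hV : MDifferentiableAt M.I M.I.tangent (fun z => (⟨z, V z⟩ : TangentBundle M.I M)) x)
    (hW : MDifferentiableAt M.I M.I.tangent (fun z => (⟨z, W z⟩ : TangentBundle M.I M)) x)
    (hA : ∀ i, MDifferentiableAt N.I N.I.tangent (fun z => (⟨z, A i z⟩ : TangentBundle N.I N)) (F x))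
    (hB : ∀ j, MDifferentiableAt N.I N.I.tangent (fun z => (⟨z, B j z⟩ : TangentBundle N.I N)) (F x))
    (ha : ∀ i, MDifferentiableAt M.I 𝓘(ℝ, ℝ) (a i) x) (hb : ∀ j, MDifferentiableAt M.I 𝓘(ℝ, ℝ) (b j) x)
    (hVA : ∀ᶠ z in 𝓝 x, mfderiv M.I N.I F z (V z) = ∑ i, a i z • A i (F z))
    (hWB : ∀ᶠ z in 𝓝 x, mfderiv M.I N.I F z (W z) = ∑ j, b j z • B j (F z)) :
    mfderiv M.I N.I F x (VectorField.mlieBracket M.I V W x) =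
      (∑ i, ∑ j, (a i x * b j x) • VectorField.mlieBracket N.I (A i) (B j) (F x)) +
      (∑ j, M.dirDeriv (b j) x (V x) • B j (F x)) - ∑ i, M.dirDeriv (a i) x (W x) • A i (F x) := by
  obtain ⟨k, -, y, rfl, -, hk, hki, -, -, -⟩ := M.exists_param x
  obtain ⟨l, φ, y', hly, hφ, hl, hli, hφs, hlφ, -⟩ := N.exists_param (F (k y))
  have hkc : ContinuousAt k y := hk.self_of_nhds.continuousAt
  have hFk : ContinuousAt (fun z => F (k z)) y := hF.continuousAt.comp hkc
  set f : M.E → N.E := fun z => φ (F (k z)) with hf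
  have hfs : ∀ᶠ z in 𝓝 y, ContMDiffAt 𝓘(ℝ, M.E) 𝓘(ℝ, N.E) ∞ f z := by
    filter_upwards [hk, hkc.eventually hF, hFk.eventually hφs] with z h1 h2 h3
    exact h3.comp z (h2.comp z h1)
  have hfc : ContinuousAt f y := hfs.self_of_nhds.continuousAt
  have hfy : f y = y' := hφ
  have hlf : ∀ᶠ z in 𝓝 y, l (f z) = F (k z) := hFk.eventually hlφ
  rw [← hfy] at hl hli
  -- The chain rule for `l ∘ f = F ∘ k`.
  have hdiff : ∀ᶠ z in 𝓝 y, ∀ w : M.E, N.paramDeriv l (f z) (fderiv ℝ f z w) =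
      (mfderiv M.I N.I F (k z) (M.paramDeriv k z w) : N.E) := by
    filter_upwards [hk, hkc.eventually hF, eventually_eventually_nhds.2 hlf, hfs,
      hfc.eventually hl] with z h1 h2 h3 h4 h5 w
    have e1 := mfderiv_comp_apply (I := 𝓘(ℝ, M.E)) (I' := M.I) (I'' := N.I) z
      (h2.mdifferentiableAt (by simp)) (h1.mdifferentiableAt (by simp)) w
    have e2 := mfderiv_comp_apply (I := 𝓘(ℝ, M.E)) (I' := 𝓘(ℝ, N.E)) (I'' := N.I) z
      (h5.mdifferentiableAt (by simp)) (h4.mdifferentiableAt (by simp)) w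
    have e3 : mfderiv 𝓘(ℝ, M.E) N.I (l ∘ f) z = mfderiv 𝓘(ℝ, M.E) N.I (F ∘ k) z :=
      Filter.EventuallyEq.mfderiv_eq h3
    rw [mfderiv_eq_fderiv] at e2
    refine e2.symm.trans (Eq.trans ?_ e1)
    exact congrArg (fun L : M.E →L[ℝ] N.E => L w) e3
  have hinj : ∀ᶠ z in 𝓝 y, ∀ v w : N.E, N.paramDeriv l (f z) v = N.paramDeriv l (f z) w → v = w := by
    filter_upwards [hfc.eventually hli] with z hz v w h
    obtain ⟨e, he⟩ := hz
    rw [← he] at h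
    exact e.injective h
  -- A relation along `F` becomes the same relation between representatives along `f`, because it
  -- may be checked after applying the injective derivative of `l`.
  have hrel : ∀ {μ : Type} [Fintype μ] (C : μ → ∀ y : N, TangentSpace N.I y) (c : μ → M → ℝ)
      (U : ∀ x : M, TangentSpace M.I x),
      (∀ᶠ z in 𝓝 (k y), mfderiv M.I N.I F z (U z) = ∑ i, c i z • C i (F z)) →
      ∀ᶠ z in 𝓝 y, fderiv ℝ f z (M.localRep k U z) =
        ∑ i, c i (k z) • N.localRep l (C i) (f z) := by
    intro μ _ C c U h
    filter_upwards [hkc.eventually h, hlf, hinj, hdiff, hki, hfc.eventually hli]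
      with z h1 h2 h3 h4 h5 h6
    apply h3
    rw [h4, SmoothMfd.paramDeriv_localRep h5, map_sum]
    refine h1.trans (Finset.sum_congr rfl fun i _ => ?_)
    rw [map_smul, SmoothMfd.paramDeriv_localRep h6]
    exact congrArg (fun p => c i (k z) • (C i p : N.E)) h2.symm
  have hdc : ∀ (c : M → ℝ), MDifferentiableAt M.I 𝓘(ℝ, ℝ) c (k y) →
      DifferentiableAt ℝ (fun z => c (k z)) y ∧ ∀ w, fderiv ℝ (fun z => c (k z)) y w =
        M.dirDeriv c (k y) (M.paramDeriv k y w) := by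
    intro c hc
    have hkd := hk.self_of_nhds.mdifferentiableAt (by simp)
    refine ⟨(hc.comp y hkd).differentiableAt, fun w => ?_⟩
    have e := mfderiv_comp_apply y hc hkd w
    rw [mfderiv_eq_fderiv] at e
    exact e
  have hlfy := hlf.self_of_nhds
  have hA' : ∀ i, DifferentiableAt ℝ (N.localRep l (A i)) (f y) := fun i =>
    SmoothMfd.differentiableAt_localRep hl.self_of_nhds hli.self_of_nhds (hlfy ▸ hA i)
  have hB' : ∀ i, DifferentiableAt ℝ (N.localRep l (B i)) (f y) := fun i =>
    SmoothMfd.differentiableAt_localRep hl.self_of_nhds hli.self_of_nhds (hlfy ▸ hB i)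
  have main := fderiv_lieBracket_of_related
    (hfs.self_of_nhds.contDiffAt.of_le ENat.LEInfty.out)
    (SmoothMfd.differentiableAt_localRep hk.self_of_nhds hki.self_of_nhds hV)
    (SmoothMfd.differentiableAt_localRep hk.self_of_nhds hki.self_of_nhds hW) hA' hB'
    (fun i => (hdc _ (ha i)).1) (fun j => (hdc _ (hb j)).1) (hrel A a V hVA) (hrel B b W hWB)
  have main' := congrArg (N.paramDeriv l (f y)) main
  rw [hdiff.self_of_nhds, SmoothMfd.paramDeriv_lieBracket hk.self_of_nhds hki.self_of_nhds hV hW] at main'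
  refine main'.trans ?_
  -- The point `l (f y)` occurs in the types, so the equation with `F (k y)` is used on values in
  -- the model space instead of by rewriting.
  have hpt : ∀ (C : ∀ y : N, TangentSpace N.I y), (C (l (f y)) : N.E) = C (F (k y)) :=
    fun C => congrArg (fun p => (C p : N.E)) hlfy
  simp only [map_sub, map_add, map_sum, map_smul, (hdc _ (ha _)).2, (hdc _ (hb _)).2,
    SmoothMfd.paramDeriv_localRep hki.self_of_nhds, SmoothMfd.paramDeriv_localRep hli.self_of_nhds,
    SmoothMfd.paramDeriv_lieBracket hl.self_of_nhds hli.self_of_nhds (hlfy ▸ hA _) (hlfy ▸ hB _), hpt]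
  rfl

/-! ### Vector fields on Q-manifolds -/

section
variable {S S₁ S₂ S₃ : Type u} {Q : QStr S} {Q₁ : QStr S₁} {Q₂ : QStr S₂} {Q₃ : QStr S₃}

theorem SmoothMfd.isManifold_three (M : SmoothMfd.{u}) : IsManifold M.I (minSmoothness ℝ 3) M := by
  rw [minSmoothness_of_isRCLikeNormedField]
  exact IsManifold.of_le (n := ∞) ENat.LEInfty.out

theorem QStr.vec_liftField (X : ∀ s, Q.TSpace s) (m : Q.M) :
    Q.vec m (Q.liftField X m) = ⟨Q.π m, X (Q.π m)⟩ :=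
  Sigma.ext rfl (heq_of_eq
    ((Equiv.ofBijective _ (Q.bijective_tmapAt_π m)).apply_symm_apply (X (Q.π m))))

theorem QStr.liftField_eq {X : ∀ s, Q.TSpace s} {m : Q.M} {v : TangentSpace Q.M.I m}
    (h : Q.vec m v = ⟨Q.π m, X (Q.π m)⟩) : Q.liftField X m = v :=
  QStr.vec_injective ((Q.vec_liftField X m).trans h.symm)

theorem QStr.TB.mk_apply (X : ∀ s, Q.TSpace s) {a b : S} (h : a = b) :
    (⟨a, X a⟩ : Q.TB) = ⟨b, X b⟩ := by rw [h]

theorem QStr.TB.eq_of_mk_eq {s : S} {v w : Q.TSpace s} (h : (⟨s, v⟩ : Q.TB) = ⟨s, w⟩) : v = w :=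
  eq_of_heq (Sigma.mk.inj h).2

theorem QStr.liftField_out (X : ∀ s, Q.TSpace s) (s : S) : Q.liftField X (Q.out s) = X s :=
  QStr.liftField_eq ((QStr.vec_out ⟨s, X s⟩).trans (QStr.TB.mk_apply X (Q.π_out s).symm))

/-- Smoothness of the representative of a vector field in the atlas. -/
abbrev SmoothMfd.IsSmoothSection (M : SmoothMfd.{u}) (V : ∀ x : M, TangentSpace M.I x) : Prop :=
  ContMDiff M.I M.I.tangent ∞ (fun x => (⟨x, V x⟩ : TangentBundle M.I M))

theorem SmoothMfd.IsSmoothSection.mdifferentiableAt {M : SmoothMfd.{u}}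
    {V : ∀ x : M, TangentSpace M.I x} (h : M.IsSmoothSection V) (x : M) :
    MDifferentiableAt M.I M.I.tangent (fun z => (⟨z, V z⟩ : TangentBundle M.I M)) x :=
  (ContMDiff.contMDiffAt h).mdifferentiableAt (by simp)

/-- A smooth lift `G` of the section to the tangent atlas covers a lift of the identity that fixes
`m`, hence covers the identity near `m`. So `G` is a vector field there, and injectivity of `vec`
identifies it with the lifted field. -/
theorem QStr.IsSmoothField.liftField {X : ∀ s, Q.TSpace s} (hX : Q.IsSmoothField X) :
    Q.M.IsSmoothSection (Q.liftField X) := by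
  intro m
  obtain ⟨G, hG, hGm⟩ := QSmoothAt.exists_lift (Q₂ := Q.tangent) (hX.qSmoothAt (Q.π m))
    (n := (⟨m, Q.liftField X m⟩ : TangentBundle Q.M.I Q.M)) (Q.vec_liftField X m)
  have hp : ContMDiff Q.M.I.tangent Q.M.I ∞ (fun p : TangentBundle Q.M.I Q.M => p.proj) :=
    Bundle.contMDiff_proj _
  have hbase : ∀ᶠ z in 𝓝 m, (G z : TangentBundle Q.M.I Q.M).proj = z := by
    refine Q.eventually_eq_of_lift
      (SmoothNear.comp (N := Q.M.tangent) (hp.smoothNear (M := Q.M.tangent) _) hG.smooth)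
      (smoothNear_id m) ?_ (congrArg Bundle.TotalSpace.proj hGm)
    filter_upwards [hG.lift] with z hz
    exact congrArg Sigma.fst hz
  refine ContMDiffAt.congr_of_eventuallyEq hG.smooth.contMDiffAt ?_
  filter_upwards [hbase, hG.lift] with z hz hl
  have hl' : Q.vec (G z : TangentBundle Q.M.I Q.M).proj (G z : TangentBundle Q.M.I Q.M).2 =
    ⟨Q.π z, X (Q.π z)⟩ := hl
  generalize (G z : TangentBundle Q.M.I Q.M) = p at hz hl'
  obtain ⟨y, v⟩ := p
  obtain rfl : y = z := hz
  exact congrArg (Bundle.TotalSpace.mk y) (QStr.liftField_eq hl')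

theorem QStr.isSmoothField_of_lift {X : ∀ s, Q.TSpace s} {V : ∀ m : Q.M, TangentSpace Q.M.I m}
    (hV : Q.M.IsSmoothSection V) (h : ∀ m, Q.vec m (V m) = ⟨Q.π m, X (Q.π m)⟩) :
    Q.IsSmoothField X :=
  fun _ _ => ⟨Set.univ, fun m => (⟨m, V m⟩ : TangentBundle Q.M.I Q.M), isOpen_univ, trivial,
    hV.contMDiffOn, fun z _ => h z⟩

open VectorField in
-- The bracket on a Q-manifold does not depend on the preimage at which it is computed: a transition
-- from `m` to the chosen preimage relates each lifted field to itself, hence preserves the bracket.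
theorem QStr.vec_mlieBracket {X Y : ∀ s, Q.TSpace s} (hX : Q.IsSmoothField X)
    (hY : Q.IsSmoothField Y) (m : Q.M) :
    Q.vec m (mlieBracket Q.M.I (Q.liftField X) (Q.liftField Y) m) =
      ⟨Q.π m, Q.lieBracket X Y (Q.π m)⟩ := by
  obtain ⟨h, hh, hm⟩ := Q.exists_transition (Q.π_out (Q.π m)).symm
  have hrel : ∀ Z : ∀ s, Q.TSpace s, ∀ᶠ z in 𝓝 m, mfderiv Q.M.I Q.M.I h z (Q.liftField Z z) =
      ∑ _i : Fin 1, (1 : ℝ) • Q.liftField Z (h z) := by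
    intro Z
    filter_upwards [hh.eventually] with z hz
    rw [Fin.sum_univ_one, one_smul]
    apply QStr.vec_injective
    rw [← hz.tmap_vec, tmap_id, QStr.vec_liftField, QStr.vec_liftField]
    exact QStr.TB.mk_apply Z hz.self.symm
  have key := mlieBracket_of_related hh.smooth (ι := Fin 1) (κ := Fin 1)
    (a := fun _ _ => 1) (b := fun _ _ => 1)
    (A := fun _ => Q.liftField X) (B := fun _ => Q.liftField Y)
    (hX.liftField.mdifferentiableAt m) (hY.liftField.mdifferentiableAt m)
    (fun _ => hX.liftField.mdifferentiableAt _) (fun _ => hY.liftField.mdifferentiableAt _)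
    (fun _ => mdifferentiableAt_const) (fun _ => mdifferentiableAt_const) (hrel X) (hrel Y)
  have hd : ∀ v : TangentSpace Q.M.I m, Q.M.dirDeriv (fun _ => 1) m v = 0 := fun v => by
    unfold SmoothMfd.dirDeriv
    rw [mfderiv_const]; rfl
  simp only [Fin.sum_univ_one, hd, zero_smul, mul_one, one_smul, add_zero, sub_zero] at key
  have := hh.tmap_vec (mlieBracket Q.M.I (Q.liftField X) (Q.liftField Y) m)
  rw [tmap_id, key] at this
  rw [this, hm]
  exact QStr.vec_out ⟨Q.π m, Q.lieBracket X Y (Q.π m)⟩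

open VectorField in
theorem QStr.liftField_lieBracket {X Y : ∀ s, Q.TSpace s} (hX : Q.IsSmoothField X)
    (hY : Q.IsSmoothField Y) :
    Q.liftField (Q.lieBracket X Y) = mlieBracket Q.M.I (Q.liftField X) (Q.liftField Y) :=
  funext fun m => QStr.liftField_eq (QStr.vec_mlieBracket hX hY m)

open VectorField in
theorem QStr.IsSmoothField.lieBracket {X Y : ∀ s, Q.TSpace s} (hX : Q.IsSmoothField X)
    (hY : Q.IsSmoothField Y) : Q.IsSmoothField (Q.lieBracket X Y) := by
  refine QStr.isSmoothField_of_lift (V := mlieBracket Q.M.I (Q.liftField X) (Q.liftField Y)) ?_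
    (QStr.vec_mlieBracket hX hY)
  have : CompleteSpace Q.M.E := FiniteDimensional.complete ℝ _
  have := Q.M.isManifold_three
  have : IsManifold Q.M.I (((⊤ : ℕ∞) : WithTop ℕ∞) + 1) Q.M := inferInstanceAs (IsManifold Q.M.I ∞ Q.M)
  exact ContDiff.mlieBracket_vectorField (m := ⊤) (n := ⊤) hX.liftField hY.liftField
    (by rw [minSmoothness_of_isRCLikeNormedField]; exact le_rfl)

theorem QStr.liftField_add (X Y : ∀ s, Q.TSpace s) :
    Q.liftField (fun s => X s + Y s) = Q.liftField X + Q.liftField Y := by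
  funext m
  refine QStr.liftField_eq (Sigma.ext rfl (heq_of_eq ?_))
  have h : ∀ Z, tmapAt Q.M.toQ Q Q.π m (Q.liftField Z m) = Z (Q.π m) := fun Z =>
    QStr.TB.eq_of_mk_eq (QStr.vec_liftField Z m)
  exact (map_add (tmapAt Q.M.toQ Q Q.π m) _ _).trans (congrArg₂ (· + ·) (h X) (h Y))

theorem QStr.lieBracket_add {X Y Z : ∀ s, Q.TSpace s} (hY : Q.IsSmoothField Y)
    (hZ : Q.IsSmoothField Z) (s : S) : Q.lieBracket X (fun s => Y s + Z s) s =
      Q.lieBracket X Y s + Q.lieBracket X Z s := by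
  have : CompleteSpace Q.M.E := FiniteDimensional.complete ℝ _
  have : IsManifold Q.M.I 2 Q.M := IsManifold.of_le (n := ∞) ENat.LEInfty.out
  unfold QStr.lieBracket
  rw [QStr.liftField_add]
  exact VectorField.mlieBracket_add_right (hY.liftField.mdifferentiableAt _)
    (hZ.liftField.mdifferentiableAt _)

theorem QStr.lieBracket_self (X : ∀ s, Q.TSpace s) (s : S) : Q.lieBracket X X s = 0 :=
  congrFun VectorField.mlieBracket_self (Q.out s)

theorem QStr.lieBracket_swap (X Y : ∀ s, Q.TSpace s) (s : S) :
    Q.lieBracket X Y s = -Q.lieBracket Y X s :=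
  VectorField.mlieBracket_swap_apply

theorem QStr.lieBracket_jacobi {X Y Z : ∀ s, Q.TSpace s} (hX : Q.IsSmoothField X)
    (hY : Q.IsSmoothField Y) (hZ : Q.IsSmoothField Z) (s : S) :
    Q.lieBracket X (Q.lieBracket Y Z) s =
      Q.lieBracket (Q.lieBracket X Y) Z s + Q.lieBracket Y (Q.lieBracket X Z) s := by
  have : CompleteSpace Q.M.E := FiniteDimensional.complete ℝ _
  have := Q.M.isManifold_three
  unfold QStr.lieBracket
  have h := fun {X Y : ∀ s, Q.TSpace s} => QStr.liftField_lieBracket (Q := Q) (X := X) (Y := Y)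
  unfold QStr.lieBracket at h
  rw [h hY hZ, h hX hY, h hX hZ]
  have h2 : minSmoothness ℝ 2 ≤ ∞ := by
    rw [minSmoothness_of_isRCLikeNormedField]; exact ENat.LEInfty.out
  exact VectorField.leibniz_identity_mlieBracket_apply ((hX.liftField _).of_le h2)
    ((hY.liftField _).of_le h2) ((hZ.liftField _).of_le h2)

/-- The bracket of Q-vector fields `X`, `Y` with `Tf ∘ X = ∑ aᵢ (Aᵢ ∘ f)` and `Tf ∘ Y = ∑ bⱼ (Bⱼ ∘ f)`. -/
theorem QStr.tmapAt_lieBracket {f : S₁ → S₂} {s : S₁} (hf : QSmoothAt Q₁ Q₂ f s)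
    {ι κ : Type} [Fintype ι] [Fintype κ] {X Y : ∀ s, Q₁.TSpace s}
    {A : ι → ∀ s, Q₂.TSpace s} {B : κ → ∀ s, Q₂.TSpace s} {a : ι → S₁ → ℝ} {b : κ → S₁ → ℝ}
    (hX : Q₁.IsSmoothField X) (hY : Q₁.IsSmoothField Y)
    (hA : ∀ i, Q₂.IsSmoothField (A i)) (hB : ∀ j, Q₂.IsSmoothField (B j))
    (ha : ∀ i, MDifferentiableAt Q₁.M.I 𝓘(ℝ, ℝ) (fun z => a i (Q₁.π z)) (Q₁.out s))
    (hb : ∀ j, MDifferentiableAt Q₁.M.I 𝓘(ℝ, ℝ) (fun z => b j (Q₁.π z)) (Q₁.out s))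
    (hXA : ∀ᶠ x in Q₁.nhd s, tmapAt Q₁ Q₂ f x (X x) = ∑ i, a i x • A i (f x))
    (hYB : ∀ᶠ x in Q₁.nhd s, tmapAt Q₁ Q₂ f x (Y x) = ∑ j, b j x • B j (f x)) :
    tmapAt Q₁ Q₂ f s (Q₁.lieBracket X Y s) =
      (∑ i, ∑ j, (a i s * b j s) • Q₂.lieBracket (A i) (B j) (f s)) +
      (∑ j, Q₁.M.dirDeriv (fun z => b j (Q₁.π z)) (Q₁.out s) (X s) • B j (f s)) -
      ∑ i, Q₁.M.dirDeriv (fun z => a i (Q₁.π z)) (Q₁.out s) (Y s) • A i (f s) := by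
  have hf' : QSmoothAt Q₁ Q₂ f (Q₁.π (Q₁.out s)) := by rwa [Q₁.π_out]
  obtain ⟨g, hg, hgs⟩ := hf'.exists_lift (n := Q₂.out (f s)) (by rw [Q₂.π_out, Q₁.π_out])
  have hrel : ∀ {μ : Type} [Fintype μ] (C : μ → ∀ s, Q₂.TSpace s) (c : μ → S₁ → ℝ)
      (U : ∀ s, Q₁.TSpace s), (∀ᶠ x in Q₁.nhd s, tmapAt Q₁ Q₂ f x (U x) = ∑ i, c i x • C i (f x)) →
      ∀ᶠ z in 𝓝 (Q₁.out s), mfderiv Q₁.M.I Q₂.M.I g z (Q₁.liftField U z) =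
        ∑ i, c i (Q₁.π z) • Q₂.liftField (C i) (g z) := by
    intro μ _ C c U h
    -- The relation along `f` is lifted to one along `g` by comparing the vectors represented in the
    -- Q-manifold.
    filter_upwards [QStr.eventually_nhd.1 h, hg.eventually] with z hz hgz
    apply QStr.vec_injective
    rw [← hgz.tmap_vec, QStr.vec_liftField]
    have h1 : tmap Q₁ Q₂ f ⟨Q₁.π z, U (Q₁.π z)⟩ =
        ⟨f (Q₁.π z), ∑ i, c i (Q₁.π z) • C i (f (Q₁.π z))⟩ :=
      Sigma.ext rfl (heq_of_eq hz)
    rw [h1, ← hgz.self]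
    refine Sigma.ext rfl (heq_of_eq ?_)
    refine Eq.trans ?_ (map_sum (tmapAt Q₂.M.toQ Q₂ Q₂.π (g z)) _ _).symm
    refine Finset.sum_congr rfl fun i _ => ?_
    refine Eq.trans ?_ (map_smul (tmapAt Q₂.M.toQ Q₂ Q₂.π (g z)) _ _).symm
    exact congrArg _ (QStr.TB.eq_of_mk_eq (QStr.vec_liftField (C i) (g z))).symm
  have key := mlieBracket_of_related hg.smooth (hX.liftField.mdifferentiableAt _)
    (hY.liftField.mdifferentiableAt _) (fun i => (hA i).liftField.mdifferentiableAt _)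
    (fun j => (hB j).liftField.mdifferentiableAt _) ha hb (hrel A a X hXA) (hrel B b Y hYB)
  rw [(hg.isLiftAt hgs).tmapAt_eq]
  refine Eq.trans key ?_
  have hpt : ∀ C : ∀ m : Q₂.M, TangentSpace Q₂.M.I m, (C (g (Q₁.out s)) : Q₂.M.E) =
    C (Q₂.out (f s)) := fun C => congrArg (fun p => (C p : Q₂.M.E)) hgs
  have hpt' : ∀ C : ∀ s, Q₂.TSpace s, (Q₂.liftField C (g (Q₁.out s)) : Q₂.M.E) = C (f s) :=
    fun C => (hpt _).trans (QStr.liftField_out C (f s))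
  simp only [hpt', QStr.liftField_out, Q₁.π_out]
  have hpt'' : ∀ i j, (VectorField.mlieBracket Q₂.M.I (Q₂.liftField (A i)) (Q₂.liftField (B j))
    (g (Q₁.out s)) : Q₂.M.E) = Q₂.lieBracket (A i) (B j) (f s) := fun i j => hpt _
  simp only [hpt'']
  rfl

theorem QStr.tmapAt_lieBracket_of_related {f : S₁ → S₂} {s : S₁} (hf : QSmoothAt Q₁ Q₂ f s)
    {X Y : ∀ s, Q₁.TSpace s} {A B : ∀ s, Q₂.TSpace s}
    (hX : Q₁.IsSmoothField X) (hY : Q₁.IsSmoothField Y)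
    (hA : Q₂.IsSmoothField A) (hB : Q₂.IsSmoothField B)
    (hXA : ∀ᶠ x in Q₁.nhd s, tmapAt Q₁ Q₂ f x (X x) = A (f x))
    (hYB : ∀ᶠ x in Q₁.nhd s, tmapAt Q₁ Q₂ f x (Y x) = B (f x)) :
    tmapAt Q₁ Q₂ f s (Q₁.lieBracket X Y s) = Q₂.lieBracket A B (f s) := by
  have key := QStr.tmapAt_lieBracket hf (ι := Fin 1) (κ := Fin 1)
    (a := fun _ _ => 1) (b := fun _ _ => 1) (A := fun _ => A) (B := fun _ => B)
    hX hY (fun _ => hA) (fun _ => hB) (fun _ => mdifferentiableAt_const)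
    (fun _ => mdifferentiableAt_const) (by simpa using hXA) (by simpa using hYB)
  have hd : ∀ v : Q₁.TSpace s, Q₁.M.dirDeriv (fun _ => 1) (Q₁.out s) v = 0 := fun v => by
    unfold SmoothMfd.dirDeriv
    rw [mfderiv_const]; rfl
  simpa only [Fin.sum_univ_one, hd, zero_smul, mul_one, one_smul, add_zero, sub_zero] using key

theorem SmoothMfd.liftField_toQ {M : SmoothMfd.{u}} (X : ∀ x : M, TangentSpace M.I x) :
    M.toQ.liftField X = X := funext fun x => QStr.liftField_eq (SmoothMfd.vec_toQ x _)

theorem SmoothMfd.lieBracket_toQ {M : SmoothMfd.{u}} (X Y : ∀ x : M, TangentSpace M.I x) (x : M) :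
    M.toQ.lieBracket X Y x = VectorField.mlieBracket M.I X Y x := by
  unfold QStr.lieBracket
  rw [SmoothMfd.liftField_toQ, SmoothMfd.liftField_toQ]
  rfl

end

/-! ### Lifting along submersions -/

/-- A smooth map between finite-dimensional vector spaces with surjective derivative has a smooth local section. -/
theorem exists_local_section_of_surjective_fderiv {E F : Type*} [NormedAddCommGroup E] [NormedSpace ℝ E]
    [NormedAddCommGroup F] [NormedSpace ℝ F] [FiniteDimensional ℝ F] {f : E → F} {x : E}
    (hf : ∀ᶠ z in 𝓝 x, ContDiffAt ℝ ∞ f z) (hs : Function.Surjective (fderiv ℝ f x)) :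
    ∃ σ : F → E, σ (f x) = x ∧ (∀ᶠ w in 𝓝 (f x), ContDiffAt ℝ ∞ σ w) ∧ ∀ᶠ w in 𝓝 (f x), f (σ w) = w := by
  have : CompleteSpace F := FiniteDimensional.complete ℝ _
  obtain ⟨L, hL⟩ := (fderiv ℝ f x).exists_rightInverse_of_surjective
    (LinearMap.range_eq_top.2 hs)
  -- An affine slice through `x`, with `L` a right inverse of the derivative: `f ∘ i` has derivative
  -- the identity at `f x`, so it has a local inverse, and `i` composed with that inverse is the
  -- section.
  let i : F → E := fun w => x + L (w - f x)
  have hi : ∀ w, ContDiffAt ℝ ∞ i w := fun w =>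
    contDiffAt_const.add (L.contDiff.contDiffAt.comp w (contDiffAt_id.sub contDiffAt_const))
  have hix : i (f x) = x := by simp [i]
  have hid : ∀ w, HasFDerivAt i L w := fun w => by
    have := (L.hasFDerivAt (x := w - f x)).comp w ((hasFDerivAt_id w).sub_const (f x))
    simpa [i] using this.const_add x
  have hh : ∀ᶠ w in 𝓝 (f x), ContDiffAt ℝ ∞ (fun w => f (i w)) w := by
    have hc : Filter.Tendsto i (𝓝 (f x)) (𝓝 x) := by
      have := (hi (f x)).continuousAt.tendsto
      rwa [hix] at this
    filter_upwards [hc.eventually hf] with w hw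
    exact hw.comp w (hi w)
  have hder : HasFDerivAt (fun w => f (i w)) ((ContinuousLinearEquiv.refl ℝ F : F ≃L[ℝ] F) : F →L[ℝ] F)
      (f x) := by
    have h1 : HasFDerivAt f (fderiv ℝ f x) (i (f x)) := by
      rw [hix]; exact (hf.self_of_nhds.differentiableAt (by simp)).hasFDerivAt
    have := h1.comp (f x) (hid (f x))
    rw [hL] at this
    exact this
  let e := hh.self_of_nhds.toOpenPartialHomeomorph (fun w => f (i w)) hder (by simp)
  have hxs : f x ∈ e.source := hh.self_of_nhds.mem_toOpenPartialHomeomorph_source hder (by simp)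
  have hec : ∀ w, e w = f (i w) := fun w => rfl
  have hex : e (f x) = f x := by rw [hec, hix]
  have hsx : e.symm (f x) = f x := by
    have := e.left_inv hxs
    rwa [hex] at this
  have hxt : f x ∈ e.target := by
    have := e.map_source hxs
    rwa [hex] at this
  have hsc : Filter.Tendsto e.symm (𝓝 (f x)) (𝓝 (f x)) := by
    have := (e.symm.continuousAt hxt).tendsto
    rwa [hsx] at this
  -- Smoothness of the inverse is needed at all nearby points, so the derivative must be invertible
  -- there too; invertible operators form an open set.
  have hinv : ∀ᶠ w in 𝓝 (f x), ∃ L' : F ≃L[ℝ] F, HasFDerivAt (fun w => f (i w)) (L' : F →L[ℝ] F) w := by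
    have hc : ContinuousAt (fderiv ℝ (fun w => f (i w))) (f x) :=
      (hh.self_of_nhds.fderiv_right (m := 0) (by simp)).continuousAt
    have hn := ContinuousLinearEquiv.nhds (ContinuousLinearEquiv.refl ℝ F)
    rw [← hder.fderiv] at hn
    filter_upwards [hc.eventually hn, hh] with w hw hw'
    obtain ⟨L', hL'⟩ := hw
    exact ⟨L', hL' ▸ (hw'.differentiableAt (by simp)).hasFDerivAt⟩
  refine ⟨fun w => i (e.symm w), by simp only [hsx, hix], ?_, ?_⟩
  · filter_upwards [hsc.eventually hinv, hsc.eventually hh, e.open_target.mem_nhds hxt] with w hw hw' ht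
    obtain ⟨L', hL'⟩ := hw
    exact (hi _).comp w (e.contDiffAt_symm ht hL' hw')
  · filter_upwards [e.open_target.mem_nhds hxt] with w ht
    exact e.right_inv ht

theorem SmoothNear.exists_local_section {M N : SmoothMfd.{u}} {F : M → N} {x : M}
    (hF : SmoothNear M N F x) (hs : Function.Surjective (mfderiv M.I N.I F x)) :
    ∃ τ : N → M, τ (F x) = x ∧ SmoothNear N M τ (F x) ∧ ∀ᶠ z in 𝓝 (F x), F (τ z) = z := by
  obtain ⟨k, -, y, rfl, -, hk, hki, -, -, -⟩ := M.exists_param x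
  obtain ⟨l, χ, y', -, hy', hl, hli, hχs, hlχ, -⟩ := N.exists_param (F (k y))
  rw [← hy'] at hl hli
  have hkc : ContinuousAt k y := hk.self_of_nhds.continuousAt
  have hFk : ContinuousAt (fun z => F (k z)) y := hF.continuousAt.comp hkc
  have hχc : ContinuousAt χ (F (k y)) := hχs.self_of_nhds.continuousAt
  have hfs : ∀ᶠ z in 𝓝 y, ContDiffAt ℝ ∞ (fun z => χ (F (k z))) z := by
    filter_upwards [hk, hkc.eventually hF, hFk.eventually hχs] with z h1 h2 h3
    exact contMDiffAt_iff_contDiffAt.1 (h3.comp z (h2.comp z h1))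
  have hsurj : Function.Surjective (fderiv ℝ (fun z => χ (F (k z))) y) := by
    have h1 := hk.self_of_nhds.mdifferentiableAt (by simp)
    have h3 := hfs.self_of_nhds.contMDiffAt.mdifferentiableAt (by simp)
    have hlf : (fun z => l (χ (F (k z)))) =ᶠ[𝓝 y] fun z => F (k z) := hFk.eventually hlχ
    have e1 := fun w => mfderiv_comp_apply (I := 𝓘(ℝ, M.E)) (I' := M.I) (I'' := N.I) y
      hF.mdifferentiableAt h1 w
    have e2 := fun w => mfderiv_comp_apply (I := 𝓘(ℝ, M.E)) (I' := 𝓘(ℝ, N.E)) (I'' := N.I) y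
      (hl.self_of_nhds.mdifferentiableAt (by simp)) h3 w
    intro v
    obtain ⟨w, hw⟩ := hs (N.paramDeriv l (χ (F (k y))) v : N.E)
    obtain ⟨e, he⟩ := hki.self_of_nhds
    refine ⟨e.symm w, ?_⟩
    obtain ⟨e', he'⟩ := hli.self_of_nhds
    apply e'.injective
    have e3 : mfderiv 𝓘(ℝ, M.E) N.I (l ∘ fun z => χ (F (k z))) y = mfderiv 𝓘(ℝ, M.E) N.I (F ∘ k) y :=
      Filter.EventuallyEq.mfderiv_eq hlf
    have e4 := (e2 (e.symm w)).symm.trans ((congrArg (fun L : M.E →L[ℝ] N.E => L (e.symm w)) e3).trans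
      (e1 (e.symm w)))
    rw [mfderiv_eq_fderiv] at e4
    have e5 : M.paramDeriv k y (e.symm w) = w := by rw [← he]; exact e.apply_symm_apply w
    have e6 := e4.trans (congrArg (fun p : M.E => (mfderiv M.I N.I F (k y) p : N.E)) e5)
    have e7 := e6.trans hw
    have e8 : ∀ p, e' p = N.paramDeriv l (χ (F (k y))) p := fun p => by rw [← he']; rfl
    rw [e8, e8]
    exact e7
  obtain ⟨σ, hσ, hσs, hfσ⟩ := exists_local_section_of_surjective_fderiv hfs hsurj
  have hσc : Filter.Tendsto (fun z => σ (χ z)) (𝓝 (F (k y))) (𝓝 y) := by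
    have := (hσs.self_of_nhds.continuousAt.comp hχc).tendsto
    simp only [Function.comp, hσ] at this
    exact this
  refine ⟨fun z => k (σ (χ z)), by simp only [hσ], ?_, ?_⟩
  · filter_upwards [hχs, hχc.eventually hσs, hσc.eventually hk] with z h1 h2 h3
    exact h3.comp z (h2.contMDiffAt.comp z h1)
  · filter_upwards [hlχ, hχc.eventually hfσ, hσc.eventually (hFk.eventually hlχ)] with z h1 h2 h3
    rw [← h3, h2, h1]

section
variable {S S₁ S₂ S₃ : Type u} {Q : QStr S} {Q₁ : QStr S₁} {Q₂ : QStr S₂} {Q₃ : QStr S₃}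

/-- Q-smooth maps from manifolds lift along Q-submersions, with prescribed value at one point. -/
theorem IsQSubmersion.exists_lift {f : S₁ → S₂} (hf : IsQSubmersion Q₁ Q₂ f) {T : SmoothMfd.{u}}
    {c : T → S₂} {t : T} (hc : QSmoothAt T.toQ Q₂ c t) {s : S₁} (e : f s = c t) :
    ∃ c' : T → S₁, QSmoothAt T.toQ Q₁ c' t ∧ c' t = s ∧ ∀ᶠ z in 𝓝 t, f (c' z) = c z := by
  have hf' : QSmoothAt Q₁ Q₂ f (Q₁.π (Q₁.out s)) := hf.1.qSmoothAt _
  obtain ⟨g, hg, hgs⟩ := hf'.exists_lift (n := Q₂.out (f s)) (by rw [Q₂.π_out, Q₁.π_out])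
  obtain ⟨b, hb, hbl, hbt⟩ := hc.exists_lift_toQ (n := g (Q₁.out s)) (by rw [hgs, Q₂.π_out, e])
  have hsurj := hf.2 s
  rw [(hg.isLiftAt hgs).tmapAt_eq] at hsurj
  -- A smooth section of the lift `g` of `f` turns a lift `b` of `c` into the lift `π ∘ τ ∘ b` of
  -- `c` along `f`.
  obtain ⟨τ, hτ, hτs, hgτ⟩ := hg.smooth.exists_local_section hsurj
  rw [← hbt] at hτ hτs hgτ
  have hτc : Filter.Tendsto (fun z => τ (b z)) (𝓝 t) (𝓝 (Q₁.out s)) := by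
    have := (hτs.comp hb).continuousAt.tendsto
    rwa [hτ] at this
  refine ⟨fun z => Q₁.π (τ (b z)), (hτs.comp hb).qSmoothAt_π, by simp only [hτ, Q₁.π_out], ?_⟩
  filter_upwards [hτc.eventually hg.lift, hb.continuousAt.eventually hgτ, hbl] with z h1 h2 h3
  rw [← h1, h2, h3]

/-- The universal property of surjective Q-submersions. -/
theorem IsQSubmersion.qSmoothAt_of_comp {f : S₁ → S₂} (hf : IsQSubmersion Q₁ Q₂ f) {h : S₂ → S₃} {s : S₁}
    (hh : QSmoothAt Q₁ Q₃ (fun x => h (f x)) s) : QSmoothAt Q₂ Q₃ h (f s) := by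
  obtain ⟨m, hm⟩ : ∃ m, Q₂.π m = f s := ⟨_, Q₂.π_out _⟩
  rw [← hm]
  apply qSmoothAt_of_comp_π
  -- The atlas map of `S₂` itself is lifted along `f`, so that `h ∘ π` becomes `(h ∘ f) ∘ c` near
  -- `m`.
  obtain ⟨c, hc, hcs, hfc⟩ := hf.exists_lift (Q₂.qSmooth_π.qSmoothAt m) hm.symm
  rw [← hcs] at hh
  have := QSmoothAt.comp (f := c) hh hc
  refine this.congr ?_
  rw [SmoothMfd.nhd_toQ]
  filter_upwards [hfc] with z hz
  rw [hz]

/-- A Q-smooth map is a Q-submersion at `s` if it has a Q-smooth local section through `s`. -/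
theorem surjective_tmapAt_of_section {f : S₁ → S₂} {σ : S₂ → S₁} {s : S₁} (hσs : σ (f s) = s)
    (hf : QSmoothAt Q₁ Q₂ f s) (hσ : QSmoothAt Q₂ Q₁ σ (f s))
    (h : ∀ᶠ y in Q₂.nhd (f s), f (σ y) = y) : Function.Surjective (tmapAt Q₁ Q₂ f s) := by
  intro v
  have h1 : tmap Q₁ Q₂ f (tmap Q₂ Q₁ σ ⟨f s, v⟩) = ⟨f s, v⟩ := by
    rw [← tmap_comp_of_qSmoothAt (w := (⟨f s, v⟩ : Q₂.TB)) (by rwa [hσs]) hσ]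
    refine (tmap_congr (w := (⟨f s, v⟩ : Q₂.TB)) (f := fun y => y) ((qSmooth_id Q₂).qSmoothAt _) h).trans ?_
    exact tmap_id _ _
  generalize hw : tmap Q₂ Q₁ σ ⟨f s, v⟩ = w at h1
  have hw1 : w.1 = s := by rw [← hw]; exact hσs
  obtain ⟨s', w⟩ := w
  obtain rfl : s' = s := hw1
  exact ⟨w, QStr.TB.eq_of_mk_eq h1⟩

end

/-! ### Glueing Q-manifolds -/

/-- A set with the discrete topology, as a manifold of dimension zero. -/
noncomputable def SmoothMfd.discrete (K : Type u) : SmoothMfd.{u} :=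
  letI : TopologicalSpace K := ⊥
  haveI : DiscreteTopology K := ⟨rfl⟩
  { E := PUnit
    H := PUnit
    carrier := K
    I := 𝓘(ℝ, PUnit)
    charted := ChartedSpace.ofDiscreteTopology
    smooth := IsManifold.of_discreteTopology ∞ }

instance (K : Type u) : DiscreteTopology (SmoothMfd.discrete K) := ⟨rfl⟩

theorem smoothNear_ofOpens {T M : SmoothMfd.{u}} {U : TopologicalSpace.Opens M} {g : T → M.ofOpens U}
    {t : T} (h : SmoothNear T M (fun z => (g z).1) t) : SmoothNear T (M.ofOpens U) g t := by
  filter_upwards [h] with z hz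
  refine contMDiffAt_iff_target.2 ⟨?_, (contMDiffAt_iff_target.1 hz).2⟩
  exact Topology.IsInducing.subtypeVal.continuousAt_iff.2 hz.continuousAt

/-- Smooth germs suffice for transversality. A germ from `x` to `y` and one back compose to lifts of
the identity that fix a point; by `h₂` these are identities nearby, so after shrinking the two germs
form an open partial homeomorphism. -/
theorem IsQChart.of_germs {M : SmoothMfd.{u}} {S : Type u} {π : M → S}
    (h₁ : ∀ x y : M, π x = π y → ∃ h : M → M, SmoothNear M M h x ∧ h x = y ∧ ∀ᶠ z in 𝓝 x, π (h z) = π z)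
    (h₂ : ∀ (T : SmoothMfd.{u}) (f h : T → M), ContMDiff T.I M.I ∞ f →
      ContMDiff T.I M.I ∞ h → π ∘ f = π ∘ h → IsOpen {t | f t = h t}) : IsQChart M π := by
  refine ⟨fun x y e => ?_, h₂⟩
  have key : ∀ {x y : M} {h k : M → M}, SmoothNear M M h x → SmoothNear M M k y → h x = y → k y = x →
      (∀ᶠ z in 𝓝 x, π (h z) = π z) → (∀ᶠ z in 𝓝 y, π (k z) = π z) → ∀ᶠ z in 𝓝 x, k (h z) = z := by
    rintro x _ h k hh hk rfl hx hπ kπ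
    obtain ⟨U, hUs, hU, hxU⟩ := mem_nhds_iff.1 (((hk.comp hh).and hπ).and (hh.continuousAt.eventually kπ))
    have hv : ContMDiff M.I M.I ∞ (Subtype.val : (⟨U, hU⟩ : TopologicalSpace.Opens M) → M) :=
      contMDiff_subtype_val
    have hkh : ContMDiffOn M.I M.I ∞ (fun z => k (h z)) U := fun z hz => (hUs hz).1.1.contMDiffWithinAt
    have ho := h₂ (M.ofOpens ⟨U, hU⟩) (fun z => k (h z.1)) (fun z => z.1)
      (hkh.comp_contMDiff hv fun z => z.2) hv
      (funext fun z => (hUs z.2).2.trans (hUs z.2).1.2)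
    filter_upwards [(hU.isOpenMap_subtype_val _ ho).mem_nhds ⟨⟨x, hxU⟩, hx, rfl⟩] with z hz
    obtain ⟨z, hz, rfl⟩ := hz
    exact hz
  obtain ⟨h, hh, hx, hπ⟩ := h₁ x y e
  obtain ⟨k, hk, ky, kπ⟩ := h₁ y x e.symm
  have hkh := key hh hk hx ky hπ kπ
  have hhk := key hk hh ky hx kπ hπ
  obtain ⟨U, hUs, hU, hxU⟩ := mem_nhds_iff.1 ((hh.and hπ).and hkh)
  obtain ⟨V, hVs, hV, hyV⟩ := mem_nhds_iff.1 (hk.and hhk)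
  have hcU : ContinuousOn h U := fun z hz => (hUs hz).1.1.continuousAt.continuousWithinAt
  have hcV : ContinuousOn k V := fun z hz => (hVs hz).1.continuousAt.continuousWithinAt
  refine ⟨{ toFun := h
            invFun := k
            source := U ∩ h ⁻¹' V
            target := V ∩ k ⁻¹' U
            map_source' := fun z hz => ⟨hz.2, by
              rw [Set.mem_preimage, show k (h z) = z from (hUs hz.1).2]; exact hz.1⟩
            map_target' := fun z hz => ⟨hz.2, by
              rw [Set.mem_preimage, show h (k z) = z from (hVs hz.1).2]; exact hz.1⟩
            left_inv' := fun z hz => (hUs hz.1).2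
            right_inv' := fun z hz => (hVs hz.1).2
            open_source := hcU.isOpen_inter_preimage hU hV
            open_target := hcV.isOpen_inter_preimage hV hU
            continuousOn_toFun := hcU.mono Set.inter_subset_left
            continuousOn_invFun := hcV.mono Set.inter_subset_left }, ⟨hxU, ?_⟩, hx, ?_, ?_, ?_⟩
  · rw [Set.mem_preimage, hx]; exact hyV
  · exact fun z hz => (hUs hz.1).1.1.contMDiffWithinAt
  · exact fun z hz => (hVs hz.1).1.contMDiffWithinAt
  · exact fun z hz => (hUs hz.1).1.2

/-- Data for glueing a Q-manifold from copies of subsets of a Q-manifold `B`. -/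
structure QGlueData {B : Type u} (QB : QStr B) (S : Type u) where
  K : Type u
  χ : K → PartialEquiv S B
  cover : ∀ s, ∃ k, s ∈ (χ k).source
  isOpen_target : ∀ k, IsOpen (QB.π ⁻¹' (χ k).target)
  trans : ∀ k l, ∀ b ∈ (χ k).target, (χ k).symm b ∈ (χ l).source →
    QSmoothAt QB QB (fun b => χ l ((χ k).symm b)) b ∧ ∀ᶠ b' in QB.nhd b, (χ k).symm b' ∈ (χ l).source

namespace QGlueData

variable {B S : Type u} {QB : QStr B} (D : QGlueData QB S)

/-- The domain of the atlas. -/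
def opens : TopologicalSpace.Opens ((SmoothMfd.discrete D.K).prod QB.M) where
  carrier := {z | QB.π z.2 ∈ (D.χ z.1).target}
  is_open' := by
    refine isOpen_iff_mem_nhds.2 fun z hz => ?_
    have h1 : ∀ᶠ w in 𝓝 z, w.1 = z.1 :=
      (smoothNear_fst z).continuousAt.eventually
        (p := fun k => k = z.1) (by rw [nhds_discrete (SmoothMfd.discrete D.K)]; exact Filter.eventually_pure.2 rfl)
    have h2 := (smoothNear_snd z).continuousAt.eventually ((D.isOpen_target z.1).mem_nhds hz)
    filter_upwards [h1, h2] with w h1 h2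
    rw [h1]; exact h2

/-- The domain of the atlas, as a manifold. -/
noncomputable def mfd : SmoothMfd.{u} := ((SmoothMfd.discrete D.K).prod QB.M).ofOpens D.opens

/-- The point of the atlas with index `k` over `m`. -/
def pt (k : D.K) (m : QB.M) (h : QB.π m ∈ (D.χ k).target) : D.mfd := (⟨(k, m), h⟩ : D.opens)

/-- The index of a point of the atlas. -/
def idx (z : D.mfd) : D.K := (show D.opens from z).1.1

/-- The point of the atlas of `B` under a point of the atlas. -/
def coord (z : D.mfd) : QB.M := (show D.opens from z).1.2

theorem mfd_ext {z w : D.mfd} (h₁ : D.idx z = D.idx w) (h₂ : D.coord z = D.coord w) : z = w :=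
  Subtype.ext (Prod.ext h₁ h₂)

theorem coord_mem (z : D.mfd) : QB.π (D.coord z) ∈ (D.χ (D.idx z)).target :=
  (show D.opens from z).2

/-- The atlas. -/
def proj (z : D.mfd) : S := (D.χ (D.idx z)).symm (QB.π (D.coord z))

theorem smoothNear_val (z : D.mfd) : SmoothNear D.mfd ((SmoothMfd.discrete D.K).prod QB.M)
    (fun z => (D.idx z, D.coord z)) z := by
  have hv : ContMDiff ((SmoothMfd.discrete D.K).prod QB.M).I ((SmoothMfd.discrete D.K).prod QB.M).I ∞
    (Subtype.val : D.opens → (SmoothMfd.discrete D.K).prod QB.M) := contMDiff_subtype_val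
  exact ContMDiff.smoothNear (M := D.mfd) hv z

theorem smoothNear_coord (z : D.mfd) : SmoothNear D.mfd QB.M D.coord z :=
  SmoothNear.comp (N := (SmoothMfd.discrete D.K).prod QB.M) (smoothNear_snd _) (D.smoothNear_val z)

theorem eventually_index (z : D.mfd) : ∀ᶠ w in 𝓝 z, D.idx w = D.idx z := by
  have h : SmoothNear D.mfd (SmoothMfd.discrete D.K) D.idx z :=
    SmoothNear.comp (N := (SmoothMfd.discrete D.K).prod QB.M) (smoothNear_fst _) (D.smoothNear_val z)
  exact h.continuousAt.eventually (p := fun k => k = D.idx z)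
    (by rw [nhds_discrete (SmoothMfd.discrete D.K)]; exact Filter.eventually_pure.2 rfl)

open Classical in
/-- The inclusion of one of the pieces, with a default value where it is not defined. -/
noncomputable def incl (k : D.K) (z₀ : D.mfd) (m : QB.M) : D.mfd :=
  if h : QB.π m ∈ (D.χ k).target then D.pt k m h else z₀

theorem incl_of_mem {k : D.K} {z₀ : D.mfd} {m : QB.M} (h : QB.π m ∈ (D.χ k).target) :
    D.incl k z₀ m = D.pt k m h := dif_pos h

theorem smoothNear_incl {k : D.K} {z₀ : D.mfd} {m : QB.M} (h : QB.π m ∈ (D.χ k).target) :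
    SmoothNear QB.M D.mfd (D.incl k z₀) m := by
  apply smoothNear_ofOpens
  refine ((smoothNear_const (N := SmoothMfd.discrete D.K) k m).prodMk (smoothNear_id m)).congr ?_
  filter_upwards [(D.isOpen_target k).mem_nhds h] with z hz
  rw [D.incl_of_mem hz]
  rfl

/-- Two points over the same `s` are joined by a smooth lift of the coordinate change between their
pieces, with its value at the first point prescribed by the second. For condition (b), the index is
locally constant, so two maps that agree at `t` stay in one piece near `t` and rigidity in the atlas
of `B` applies. -/
theorem isQChart : IsQChart D.mfd D.proj := by
  apply IsQChart.of_germs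
  · intro x y e
    have hy : D.proj y ∈ (D.χ (D.idx y)).source := (D.χ (D.idx y)).map_target (D.coord_mem y)
    have hx : D.proj x ∈ (D.χ (D.idx y)).source := by rw [e]; exact hy
    obtain ⟨hs, hev⟩ := D.trans (D.idx x) (D.idx y) (QB.π (D.coord x)) (D.coord_mem x) hx
    obtain ⟨g, hg, hgm⟩ := hs.exists_lift (n := D.coord y) (by
      change _ = D.χ (D.idx y) (D.proj x)
      rw [e]; exact ((D.χ (D.idx y)).right_inv (D.coord_mem y)).symm)
    have ht : QB.π (g (D.coord x)) ∈ (D.χ (D.idx y)).target := by rw [hgm]; exact D.coord_mem y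
    have hg1 : SmoothNear D.mfd QB.M (fun z => g (D.coord z)) x :=
      hg.smooth.comp (D.smoothNear_coord x)
    refine ⟨fun z => D.incl (D.idx y) y (g (D.coord z)), SmoothNear.comp (D.smoothNear_incl ht) hg1, ?_, ?_⟩
    · exact (D.incl_of_mem ht).trans (D.mfd_ext rfl hgm)
    · have hc := (D.smoothNear_coord x).continuousAt
      filter_upwards [D.eventually_index x, hc.eventually hg.lift,
        hc.eventually (QStr.eventually_nhd_π.1 hev)] with z h1 h2 h3
      have h4 : QB.π (g (D.coord z)) ∈ (D.χ (D.idx y)).target := by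
        rw [h2]; exact (D.χ (D.idx y)).map_source h3
      refine (congrArg D.proj (D.incl_of_mem h4)).trans ?_
      change (D.χ (D.idx y)).symm (QB.π (g (D.coord z))) = (D.χ (D.idx z)).symm (QB.π (D.coord z))
      rw [h2, (D.χ (D.idx y)).left_inv h3, h1]
  · intro T f h hf hh e
    refine isOpen_iff_mem_nhds.2 fun t ht => ?_
    have hf1 := hf.smoothNear t
    have hh1 := hh.smoothNear t
    have i1 := hf1.continuousAt.eventually (D.eventually_index (f t))
    have i2 := hh1.continuousAt.eventually (D.eventually_index (h t))
    have ht' : f t = h t := ht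
    have hπ : ∀ᶠ z in 𝓝 t, QB.π (D.coord (f z)) = QB.π (D.coord (h z)) := by
      filter_upwards [i1, i2] with z h1 h2
      have e1 : D.idx (f z) = D.idx (h z) := by rw [h1, h2, ht']
      have e2 : (D.χ (D.idx (f z))).symm (QB.π (D.coord (f z))) =
        (D.χ (D.idx (h z))).symm (QB.π (D.coord (h z))) := congrFun e z
      have m1 : QB.π (D.coord (f z)) ∈ (D.χ (D.idx (h z))).target := e1 ▸ D.coord_mem (f z)
      rw [e1] at e2
      rw [← (D.χ (D.idx (h z))).right_inv m1, e2, (D.χ (D.idx (h z))).right_inv (D.coord_mem (h z))]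
    have := QB.eventually_eq_of_lift ((D.smoothNear_coord _).comp hf1)
      ((D.smoothNear_coord _).comp hh1) hπ (by rw [ht'])
    filter_upwards [this, i1, i2] with z h1 h2 h3
    exact D.mfd_ext (by rw [h2, h3, ht']) h1

theorem exists_pt {k : D.K} {s : S} (hs : s ∈ (D.χ k).source) :
    ∃ z : D.mfd, D.idx z = k ∧ D.proj z = s := by
  have h : QB.π (QB.out (D.χ k s)) ∈ (D.χ k).target := by
    rw [QB.π_out]; exact (D.χ k).map_source hs
  refine ⟨D.pt k _ h, rfl, ?_⟩
  change (D.χ k).symm (QB.π (QB.out (D.χ k s))) = s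
  rw [QB.π_out, (D.χ k).left_inv hs]

theorem surjective_proj : Function.Surjective D.proj := by
  intro s
  obtain ⟨k, hk⟩ := D.cover s
  obtain ⟨z, -, hz⟩ := D.exists_pt hk
  exact ⟨z, hz⟩

/-- The glued Q-manifold. -/
noncomputable def glue : QStr S where
  M := D.mfd
  π := D.proj
  isQChart := D.isQChart
  out := fun s => (D.surjective_proj s).choose
  π_out := fun s => (D.surjective_proj s).choose_spec

theorem qSmoothAt_symm {k : D.K} {b : B} (hb : b ∈ (D.χ k).target) :
    QSmoothAt QB D.glue (D.χ k).symm b := by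
  obtain ⟨m, rfl⟩ : ∃ m, QB.π m = b := ⟨_, QB.π_out b⟩
  refine IsGermLift.qSmoothAt (Q₂ := D.glue) (g := D.incl k (D.pt k m hb))
    ⟨D.smoothNear_incl hb, ?_⟩
  filter_upwards [(D.isOpen_target k).mem_nhds hb] with z hz
  exact congrArg D.proj (D.incl_of_mem hz)

theorem qSmoothAt_chart {k : D.K} {s : S} (hs : s ∈ (D.χ k).source) :
    QSmoothAt D.glue QB (D.χ k) s := by
  obtain ⟨m, rfl, rfl⟩ := D.exists_pt hs
  refine IsGermLift.qSmoothAt (Q₁ := D.glue) (g := D.coord) (m := m) ⟨D.smoothNear_coord m, ?_⟩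
  filter_upwards [D.eventually_index m] with z hz
  have := (D.χ (D.idx z)).right_inv (D.coord_mem z)
  change _ = D.χ (D.idx m) ((D.χ (D.idx z)).symm (QB.π (D.coord z)))
  rw [hz] at this ⊢
  exact this.symm

theorem eventually_mem_source {k : D.K} {s : S} (hs : s ∈ (D.χ k).source) :
    ∀ᶠ x in D.glue.nhd s, x ∈ (D.χ k).source := by
  obtain ⟨m, rfl, rfl⟩ := D.exists_pt hs
  refine (QStr.eventually_nhd_π (Q := D.glue) (m := m)).2 ?_
  filter_upwards [D.eventually_index m] with z hz
  rw [← hz]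
  exact (D.χ (D.idx z)).map_target (D.coord_mem z)

end QGlueData

/-! ### Principal Q-bundles -/

section
variable {S S₁ : Type u} {Q : QStr S}

theorem QGroup.qSmoothAt_mul {G : QGroup.{u}} {a b : S → G} {s : S} (ha : QSmoothAt Q G.Q a s)
    (hb : QSmoothAt Q G.Q b s) : QSmoothAt Q G.Q (fun x => a x * b x) s :=
  QSmoothAt.comp (f := fun x => (a x, b x)) (G.smooth_mul.qSmoothAt (a s, b s)) (ha.prodMk hb)

theorem QGroup.qSmoothAt_inv {G : QGroup.{u}} {a : S → G} {s : S} (ha : QSmoothAt Q G.Q a s) :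
    QSmoothAt Q G.Q (fun x => (a x)⁻¹) s :=
  (G.smooth_inv.qSmoothAt (a s)).comp ha

theorem QSmoothAt.eventually_mem {N : SmoothMfd.{u}} {a : S → N} {s : S} (ha : QSmoothAt Q N.toQ a s)
    {p : N → Prop} (h : ∀ᶠ y in 𝓝 (a s), p y) : ∀ᶠ x in Q.nhd s, p (a x) := by
  have := ha.tendsto
  rw [SmoothMfd.nhd_toQ] at this
  exact this.eventually h

end

namespace PrincipalQBundle
variable (P : PrincipalQBundle.{u})

/-- An equivariant local trivialization. -/
structure Triv where
  U : Set P.N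
  ψ : PartialEquiv P.P (P.N × P.G)
  isOpen : IsOpen U
  source : ψ.source = P.β ⁻¹' U
  target : ψ.target = U ×ˢ Set.univ
  smooth : QSmoothOn P.Q (P.N.toQ.prod P.G.Q) ψ ψ.source
  smooth_symm : QSmoothOn (P.N.toQ.prod P.G.Q) P.Q ψ.symm ψ.target
  equivariant : ∀ p ∈ ψ.source, (ψ p).1 = P.β p ∧ ∀ g, ψ (P.act p g) = (P.β p, (ψ p).2 * g)

theorem exists_triv (n : P.N) : ∃ e : P.Triv, n ∈ e.U := by
  obtain ⟨U, ψ, h1, h2, h3, h4, h5, h6, h7⟩ := P.locallyTrivial n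
  exact ⟨⟨U, ψ, h1, h3, h4, h5, h6, h7⟩, h2⟩

variable {P}
variable {S : Type u} {Q : QStr S}

theorem qSmoothAt_act {a : S → P.P} {b : S → P.G} {s : S} (ha : QSmoothAt Q P.Q a s)
    (hb : QSmoothAt Q P.G.Q b s) : QSmoothAt Q P.Q (fun x => P.act (a x) (b x)) s :=
  QSmoothAt.comp (f := fun x => (a x, b x)) (P.smooth_act.qSmoothAt (a s, b s)) (ha.prodMk hb)

theorem qSmoothAt_β {a : S → P.P} {s : S} (ha : QSmoothAt Q P.Q a s) :
    QSmoothAt Q P.N.toQ (fun x => P.β (a x)) s := (P.smooth_β.qSmoothAt (a s)).comp ha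

namespace Triv
variable (e : P.Triv)

/-- The group component of a trivialization. -/
def fib (p : P.P) : P.G := (e.ψ p).2

/-- The inverse of a trivialization. -/
def sect (x : P.N) (g : P.G) : P.P := e.ψ.symm (x, g)

variable {e}

theorem mem_source {p : P.P} (h : P.β p ∈ e.U) : p ∈ e.ψ.source := by rw [e.source]; exact h

theorem mem_target {x : P.N} (h : x ∈ e.U) (g : P.G) : (x, g) ∈ e.ψ.target := by
  rw [e.target]; exact ⟨h, trivial⟩

theorem β_sect {x : P.N} (h : x ∈ e.U) (g : P.G) : P.β (e.sect x g) = x := by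
  have := (e.equivariant _ (e.ψ.map_target (mem_target h g))).1
  rw [e.ψ.right_inv (mem_target h g)] at this
  exact this.symm

theorem fib_sect {x : P.N} (h : x ∈ e.U) (g : P.G) : e.fib (e.sect x g) = g :=
  congrArg Prod.snd (e.ψ.right_inv (mem_target h g))

theorem sect_fib {p : P.P} (h : P.β p ∈ e.U) : e.sect (P.β p) (e.fib p) = p := by
  have h' := e.ψ.left_inv (mem_source h)
  rwa [show e.ψ p = (P.β p, e.fib p) from Prod.ext (e.equivariant p (mem_source h)).1 rfl] at h'

theorem fib_act {p : P.P} (h : P.β p ∈ e.U) (g : P.G) : e.fib (P.act p g) = e.fib p * g :=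
  congrArg Prod.snd ((e.equivariant p (mem_source h)).2 g)

theorem qSmoothAt_fib {a : S → P.P} {s : S} (ha : QSmoothAt Q P.Q a s) (h : P.β (a s) ∈ e.U) :
    QSmoothAt Q P.G.Q (fun x => e.fib (a x)) s :=
  ((e.smooth.qSmoothAt (mem_source h)).comp ha).snd

theorem qSmoothAt_sect {a : S → P.N} {b : S → P.G} {s : S} (ha : QSmoothAt Q P.N.toQ a s)
    (hb : QSmoothAt Q P.G.Q b s) (h : a s ∈ e.U) : QSmoothAt Q P.Q (fun x => e.sect (a x) (b x)) s :=
  QSmoothAt.comp (f := fun x => (a x, b x)) (e.smooth_symm.qSmoothAt (mem_target h (b s))) (ha.prodMk hb)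

end Triv

variable (P) in
open Classical in
/-- The element of the structure group that maps `p` to `q`, for points of the same fibre. -/
noncomputable def div (p q : P.P) : P.G := if h : ∃ g, P.act p g = q then h.choose else 1

theorem act_div {p q : P.P} (h : P.β q = P.β p) : P.act p (P.div p q) = q := by
  have h' := (P.fiber_eq p q).1 h
  rw [div, dif_pos h']
  exact h'.choose_spec

/-- In a trivialization the group element is `(fib p)⁻¹ * fib q`, which is smooth in both points. -/
theorem qSmoothAt_div {a b : S → P.P} {s : S} (ha : QSmoothAt Q P.Q a s) (hb : QSmoothAt Q P.Q b s)
    (h : ∀ᶠ x in Q.nhd s, P.β (b x) = P.β (a x)) : QSmoothAt Q P.G.Q (fun x => P.div (a x) (b x)) s := by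
  obtain ⟨e, he⟩ := P.exists_triv (P.β (a s))
  have he' : P.β (b s) ∈ e.U := by rw [QStr.self_of_nhd h]; exact he
  refine QSmoothAt.congr (QGroup.qSmoothAt_mul (QGroup.qSmoothAt_inv (Triv.qSmoothAt_fib ha he))
    (Triv.qSmoothAt_fib hb he')) ?_
  filter_upwards [h, (qSmoothAt_β ha).eventually_mem (e.isOpen.mem_nhds he)] with x h1 h2
  have := Triv.fib_act h2 (P.div (a x) (b x))
  rw [act_div h1] at this
  rw [this, inv_mul_cancel_left]

/-- `τ` is a Q-smooth section of `β` near `x`. -/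
structure IsLocalSection (τ : P.N → P.P) (x : P.N) : Prop where
  smooth : QSmoothAt P.N.toQ P.Q τ x
  right : ∀ᶠ y in 𝓝 x, P.β (τ y) = y

theorem IsLocalSection.self {τ : P.N → P.P} {x : P.N} (h : IsLocalSection τ x) : P.β (τ x) = x :=
  h.right.self_of_nhds

theorem exists_localSection (p : P.P) : ∃ τ, IsLocalSection τ (P.β p) ∧ τ (P.β p) = p := by
  obtain ⟨e, he⟩ := P.exists_triv (P.β p)
  refine ⟨fun y => e.sect y (e.fib p), ⟨?_, ?_⟩, Triv.sect_fib he⟩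
  · exact Triv.qSmoothAt_sect ((qSmooth_id _).qSmoothAt _) ((qSmooth_const _ _ _).qSmoothAt _) he
  · filter_upwards [e.isOpen.mem_nhds he] with y hy
    exact Triv.β_sect hy _

theorem Triv.isLocalSection {e : P.Triv} {x : P.N} (h : x ∈ e.U) (g : P.G) :
    IsLocalSection (fun y => e.sect y g) x := by
  refine ⟨Triv.qSmoothAt_sect ((qSmooth_id _).qSmoothAt _) ((qSmooth_const _ _ _).qSmoothAt _) h, ?_⟩
  filter_upwards [e.isOpen.mem_nhds h] with y hy
  exact Triv.β_sect hy _

/-! ### The Q-manifold structure of the gauge groupoid -/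

theorem Gauge.mk_injective {p p' q : P.P} (h : Gauge.mk p q = Gauge.mk p' q) : p = p' := by
  obtain ⟨g, rfl, hg⟩ := Gauge.exact P h
  rw [P.act_free _ _ hg, P.act_one]

@[simp] theorem gaugeS_mk (p q : P.P) : gaugeS (Gauge.mk p q) = P.β q := rfl

open Classical in
/-- For a local section `τ` of `β`, the point `p` with `a = [p, τ (s a)]`. -/
noncomputable def rho (τ : P.N → P.P) (a : P.Gauge) : P.P :=
  if h : ∃ p, Gauge.mk p (τ (gaugeS a)) = a then h.choose else P.point (gaugeT a)

theorem rho_eq {τ : P.N → P.P} {a : P.Gauge} {p : P.P} (h : Gauge.mk p (τ (gaugeS a)) = a) :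
    rho τ a = p := by
  have h' : ∃ p, Gauge.mk p (τ (gaugeS a)) = a := ⟨p, h⟩
  rw [rho, dif_pos h']
  exact Gauge.mk_injective (h'.choose_spec.trans h.symm)

theorem rho_mk {τ : P.N → P.P} {p q : P.P} (h : P.β (τ (P.β q)) = P.β q) :
    rho τ (Gauge.mk p q) = P.act p (P.div q (τ (P.β q))) := by
  apply rho_eq
  have := Gauge.mk_act P p q (P.div q (τ (P.β q)))
  rwa [act_div h] at this

theorem rho_mk_of_eq {τ : P.N → P.P} {p q : P.P} (h : τ (P.β q) = q) : rho τ (Gauge.mk p q) = p := by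
  apply rho_eq
  rw [gaugeS_mk, h]

theorem mk_rho {τ : P.N → P.P} {a : P.Gauge} (h : P.β (τ (gaugeS a)) = gaugeS a) :
    Gauge.mk (rho τ a) (τ (gaugeS a)) = a := by
  obtain ⟨p, q, rfl⟩ := Gauge.ind' P a
  rw [gaugeS_mk] at h
  rw [rho_mk h, gaugeS_mk]
  have := Gauge.mk_act P p q (P.div q (τ (P.β q)))
  rwa [act_div h] at this

theorem β_rho (τ : P.N → P.P) (a : P.Gauge) : P.β (rho τ a) = gaugeT a := by
  by_cases h : ∃ p, Gauge.mk p (τ (gaugeS a)) = a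
  · rw [rho, dif_pos h]
    exact congrArg gaugeT h.choose_spec
  · rw [rho, dif_neg h, P.β_point]

/-- On representatives `rho` translates `p` by the group element that carries `q` to `τ (β q)`, a
composition of smooth maps. No structure on the quotient is involved, so this serves both to
construct one and to work with any other. -/
theorem qSmoothAt_rho_mk {τ : P.N → P.P} {a b : S → P.P} {s : S} (ha : QSmoothAt Q P.Q a s)
    (hb : QSmoothAt Q P.Q b s) (hτ : IsLocalSection τ (P.β (b s))) :
    QSmoothAt Q P.Q (fun x => rho τ (Gauge.mk (a x) (b x))) s := by
  have hτb : QSmoothAt Q P.Q (fun x => τ (P.β (b x))) s := QSmoothAt.comp hτ.smooth (qSmoothAt_β hb)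
  have h := (qSmoothAt_β hb).eventually_mem hτ.right
  refine QSmoothAt.congr (qSmoothAt_act ha (qSmoothAt_div hb hτb h)) ?_
  filter_upwards [h] with x hx
  exact rho_mk hx

/-- The charts of the gauge groupoid given by pairs of trivializations. -/
noncomputable def gaugeChart (k : P.Triv × P.Triv) : PartialEquiv P.Gauge ((P.N × P.N) × P.G) where
  -- The second entry of the representative is normalised to the section of `k.2` with group
  -- component `1`; the group component of the first entry in `k.1` is then the only coordinate left
  -- besides target and source.
  toFun a := ((gaugeT a, gaugeS a), k.1.fib (rho (fun y => k.2.sect y 1) a))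
  invFun b := Gauge.mk (k.1.sect b.1.1 b.2) (k.2.sect b.1.2 1)
  source := {a | gaugeT a ∈ k.1.U ∧ gaugeS a ∈ k.2.U}
  target := {b | b.1.1 ∈ k.1.U ∧ b.1.2 ∈ k.2.U}
  map_source' _ h := h
  map_target' b h := by
    change P.β _ ∈ _ ∧ P.β _ ∈ _
    rw [Triv.β_sect h.1, Triv.β_sect h.2]
    exact h
  left_inv' a h := by
    have hT : P.β (rho (fun y => k.2.sect y 1) a) ∈ k.1.U := by rw [β_rho]; exact h.1
    have h1 := Triv.sect_fib hT
    rw [β_rho] at h1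
    simp only [h1]
    exact mk_rho (τ := fun y => k.2.sect y 1) (Triv.β_sect h.2 1)
  right_inv' b h := by
    refine Prod.ext (Prod.ext (Triv.β_sect h.1 _) (Triv.β_sect h.2 _)) ?_
    have h1 : rho (fun y => k.2.sect y 1) (Gauge.mk (k.1.sect b.1.1 b.2) (k.2.sect b.1.2 1)) =
      k.1.sect b.1.1 b.2 := rho_mk_of_eq (by rw [Triv.β_sect h.2])
    exact (congrArg k.1.fib h1).trans (Triv.fib_sect h.1 _)

theorem qSmoothAt_gaugeChart_mk {k : P.Triv × P.Triv} {a b : S → P.P} {s : S} (ha : QSmoothAt Q P.Q a s)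
    (hb : QSmoothAt Q P.Q b s) (h₁ : P.β (a s) ∈ k.1.U) (h₂ : P.β (b s) ∈ k.2.U) :
    QSmoothAt Q ((P.N.toQ.prod P.N.toQ).prod P.G.Q) (fun x => gaugeChart k (Gauge.mk (a x) (b x))) s := by
  refine ((qSmoothAt_β ha).prodMk (qSmoothAt_β hb)).prodMk (Triv.qSmoothAt_fib
    (qSmoothAt_rho_mk ha hb (Triv.isLocalSection h₂ 1)) ?_)
  rw [β_rho]
  exact h₁

/-- The inverse chart factors through a smooth map to `P × P`. Smoothness of coordinate changes, and
of maps on the glued quotient, is thereby reduced to smoothness on representatives. -/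
theorem qSmoothAt_gaugeChart_symm {k : P.Triv × P.Triv} {b : (P.N × P.N) × P.G}
    (h : b ∈ (gaugeChart k).target) :
    QSmoothAt ((P.N.toQ.prod P.N.toQ).prod P.G.Q) P.Q (fun b => k.1.sect b.1.1 b.2) b ∧
    QSmoothAt ((P.N.toQ.prod P.N.toQ).prod P.G.Q) P.Q (fun b => k.2.sect b.1.2 1) b := by
  have h0 := (qSmooth_id ((P.N.toQ.prod P.N.toQ).prod P.G.Q)).qSmoothAt b
  exact ⟨Triv.qSmoothAt_sect h0.fst.fst h0.snd h.1,
    Triv.qSmoothAt_sect h0.fst.snd ((qSmooth_const _ _ _).qSmoothAt _) h.2⟩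

variable (P) in
/-- The glueing data of the gauge groupoid. -/
noncomputable def gaugeGlueData : QGlueData ((P.N.toQ.prod P.N.toQ).prod P.G.Q) P.Gauge where
  K := P.Triv × P.Triv
  χ := gaugeChart
  cover a := by
    obtain ⟨e, he⟩ := P.exists_triv (gaugeT a)
    obtain ⟨e', he'⟩ := P.exists_triv (gaugeS a)
    exact ⟨(e, e'), he, he'⟩
  isOpen_target k := by
    refine isOpen_iff_mem_nhds.2 fun z hz => ?_
    have h0 := (qSmooth_id ((P.N.toQ.prod P.N.toQ).prod P.G.Q)).qSmoothAt
      (((P.N.toQ.prod P.N.toQ).prod P.G.Q).π z)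
    exact QStr.eventually_nhd_π.1 ((h0.fst.fst.eventually_mem (k.1.isOpen.mem_nhds hz.1)).and
      (h0.fst.snd.eventually_mem (k.2.isOpen.mem_nhds hz.2)))
  trans k l b hb hl := by
    obtain ⟨h1, h2⟩ := qSmoothAt_gaugeChart_symm hb
    exact ⟨qSmoothAt_gaugeChart_mk h1 h2 hl.1 hl.2,
      ((qSmoothAt_β h1).eventually_mem (l.1.isOpen.mem_nhds hl.1)).and
      ((qSmoothAt_β h2).eventually_mem (l.2.isOpen.mem_nhds hl.2))⟩

theorem qSmoothAt_gaugeGlue {f : P.Gauge → S} {a : P.Gauge}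
    (h : ∀ k, a ∈ (gaugeChart k).source → QSmoothAt ((P.N.toQ.prod P.N.toQ).prod P.G.Q) Q
      (fun b => f ((gaugeChart k).symm b)) (gaugeChart k a)) : QSmoothAt P.gaugeGlueData.glue Q f a := by
  obtain ⟨k, hk⟩ := P.gaugeGlueData.cover a
  refine ((h k hk).comp (P.gaugeGlueData.qSmoothAt_chart hk)).congr ?_
  filter_upwards [P.gaugeGlueData.eventually_mem_source hk] with x hx
  exact congrArg f ((gaugeChart k).left_inv hx).symm

/-- With `τ` a local section of `β` through `q`, the map `a ↦ (rho τ a, τ (s a))` is a smooth local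
section of the quotient map through `(p, q)`; this makes the tangent map there surjective. -/
theorem isGaugeStr_glue : P.IsGaugeStr P.gaugeGlueData.glue := by
  have hsm : ∀ x : P.P × P.P, QSmoothAt (P.Q.prod P.Q) P.gaugeGlueData.glue
      (fun x => Gauge.mk x.1 x.2) x := fun x => by
    obtain ⟨k, hk⟩ := P.gaugeGlueData.cover (Gauge.mk x.1 x.2)
    have h0 := (qSmooth_id (P.Q.prod P.Q)).qSmoothAt x
    refine QSmoothAt.congr (QSmoothAt.comp (P.gaugeGlueData.qSmoothAt_symm
      ((gaugeChart k).map_source hk)) (qSmoothAt_gaugeChart_mk h0.fst h0.snd hk.1 hk.2)) ?_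
    filter_upwards [(qSmoothAt_β h0.fst).eventually_mem (k.1.isOpen.mem_nhds hk.1),
      (qSmoothAt_β h0.snd).eventually_mem (k.2.isOpen.mem_nhds hk.2)] with y h1 h2
    exact ((gaugeChart k).left_inv (x := Gauge.mk y.1 y.2) ⟨h1, h2⟩).symm
  refine ⟨qSmooth_iff.2 hsm, ?_⟩
  rintro ⟨p, q⟩
  obtain ⟨τ, hτ, hτq⟩ := exists_localSection q
  have hS : QSmoothAt P.gaugeGlueData.glue P.N.toQ gaugeS (Gauge.mk p q) :=
    qSmoothAt_gaugeGlue fun k hk => qSmoothAt_β (qSmoothAt_gaugeChart_symm ((gaugeChart k).map_source hk)).2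
  refine surjective_tmapAt_of_section (σ := fun a => (rho τ a, τ (gaugeS a))) ?_ (hsm _) ?_ ?_
  · exact Prod.ext (rho_mk_of_eq hτq) hτq
  · refine QSmoothAt.prodMk (qSmoothAt_gaugeGlue fun k hk => ?_) (QSmoothAt.comp hτ.smooth hS)
    obtain ⟨h1, h2⟩ := qSmoothAt_gaugeChart_symm ((gaugeChart k).map_source hk)
    refine qSmoothAt_rho_mk h1 h2 ?_
    have : k.2.sect (gaugeChart k (Gauge.mk p q)).1.2 1 = k.2.sect (P.β q) 1 := rfl
    have h3 : P.β (k.2.sect (P.β q) 1) = P.β q := Triv.β_sect hk.2 1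
    rw [this, h3]
    exact hτ
  · filter_upwards [hS.eventually_mem hτ.right] with a ha
    exact mk_rho ha

/-! ### Smooth maps on the gauge groupoid -/

theorem qSmoothAt_gauge {R : QStr P.Gauge} (hR : P.IsGaugeStr R) {a b : S → P.P} {s : S}
    (ha : QSmoothAt Q P.Q a s) (hb : QSmoothAt Q P.Q b s) :
    QSmoothAt Q R (fun x => Gauge.mk (a x) (b x)) s :=
  QSmoothAt.comp (f := fun x => (a x, b x)) (hR.1.qSmoothAt (a s, b s)) (ha.prodMk hb)

namespace IsGaugeStr
variable {R : QStr P.Gauge}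

/-- The universal property of the quotient `(P × P)/G`. -/
theorem qSmooth_of_comp (hR : P.IsGaugeStr R) {f : P.Gauge → S}
    (h : QSmooth (P.Q.prod P.Q) Q (fun x => f (Gauge.mk x.1 x.2))) : QSmooth R Q f := by
  refine qSmooth_iff.2 fun a => ?_
  obtain ⟨p, q, rfl⟩ := Gauge.ind' P a
  exact IsQSubmersion.qSmoothAt_of_comp (s := (p, q)) hR (h.qSmoothAt _)

theorem qSmooth_gaugeS (hR : P.IsGaugeStr R) : QSmooth R P.N.toQ gaugeS := hR.qSmooth_of_comp (P.smooth_β.comp qSmooth_snd)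

theorem qSmooth_gaugeT (hR : P.IsGaugeStr R) : QSmooth R P.N.toQ gaugeT := hR.qSmooth_of_comp (P.smooth_β.comp qSmooth_fst)

theorem qSmoothAt_rho (hR : P.IsGaugeStr R) {τ : P.N → P.P} {a : P.Gauge} (hτ : IsLocalSection τ (gaugeS a)) :
    QSmoothAt R P.Q (rho τ) a := by
  obtain ⟨p, q, rfl⟩ := Gauge.ind' P a
  have h0 := (qSmooth_id (P.Q.prod P.Q)).qSmoothAt (p, q)
  exact IsQSubmersion.qSmoothAt_of_comp (s := (p, q)) hR (qSmoothAt_rho_mk h0.fst h0.snd hτ)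

/-- Uniqueness of the quotient structure: composed with the quotient map, the identity becomes the
quotient map again, which is smooth for `R'`. Exchanging `R` and `R'` gives the inverse. -/
theorem qSmooth_id (hR : P.IsGaugeStr R) {R' : QStr P.Gauge} (hR' : P.IsGaugeStr R') : QSmooth R R' (fun a => a) :=
  hR.qSmooth_of_comp hR'.1

end IsGaugeStr
end PrincipalQBundle

/-! ### The gauge groupoid as a Q-groupoid -/

namespace PrincipalQBundle
variable {P P' : PrincipalQBundle.{u}} {S : Type u} {Q : QStr S}

@[simp] theorem gauge_s (a : P.Gauge) : P.gauge.s a = gaugeS a := rfl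
@[simp] theorem gauge_t (a : P.Gauge) : P.gauge.t a = gaugeT a := rfl
@[simp] theorem gauge_inv_mk (p q : P.P) : P.gauge.inv (Gauge.mk p q) = Gauge.mk q p := rfl

theorem gauge_one_β (p : P.P) : P.gauge.one (P.β p) = Gauge.mk p p := P.mk_point p

theorem gauge_one_eq {τ : P.N → P.P} {x : P.N} (h : P.β (τ x) = x) :
    P.gauge.one x = Gauge.mk (τ x) (τ x) := by
  have := gauge_one_β (τ x)
  rwa [h] at this

theorem gauge_mul_congr {a a' b b' : P.Gauge} (ha : a = a') (hb : b = b') (e : gaugeS a = gaugeT b) :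
    P.gauge.mul a b e = P.gauge.mul a' b' (by rw [gauge_s, gauge_t, ← ha, ← hb, e]) := by
  subst ha hb; rfl

theorem gauge_mul_mk (p q r : P.P) (e) :
    P.gauge.mul (Gauge.mk p q) (Gauge.mk q r) e = Gauge.mk p r := gaugeMul_mk p q r e

/-- Normalised by `τ` at the common object, `a` ends and `b` begins with `τ (s a)`, so the outer
entries give the product. The formula involves no choice of representatives and is visibly smooth in
`a` and `b`. -/
theorem gauge_mul_eq {τ : P.N → P.P} {a b : P.Gauge} (h : P.β (τ (gaugeS a)) = gaugeS a)
    (e : gaugeS a = gaugeT b) : P.gauge.mul a b e = Gauge.mk (rho τ a) (rho τ (P.gauge.inv b)) := by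
  have hb : b = Gauge.mk (τ (gaugeS a)) (rho τ (P.gauge.inv b)) := by
    have h1 : gaugeS (P.gauge.inv b) = gaugeS a := (P.gauge.s_inv b).trans e.symm
    have h2 := mk_rho (τ := τ) (a := P.gauge.inv b) (by rw [h1, h])
    rw [h1] at h2
    have h3 := congrArg P.gauge.inv h2
    rw [gauge_inv_mk] at h3
    rw [h3]
    obtain ⟨p, q, rfl⟩ := Gauge.ind' P b
    rfl
  exact (gauge_mul_congr (mk_rho h).symm hb e).trans (gauge_mul_mk _ _ _ _)

namespace IsGaugeStr
variable {R : QStr P.Gauge}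

theorem qSmooth_inv (hR : P.IsGaugeStr R) : QSmooth R R P.gauge.inv :=
  hR.qSmooth_of_comp (hR.1.comp (qSmooth_snd.prodMk qSmooth_fst))

/-- Local sections `τ` of `β` give all the formulas: `y ↦ [p, τ y]` is a section of the source, `y ↦
[τ y, τ y]` is the unit map, and products are given by `gauge_mul_eq`. -/
theorem isQGroupoid (hR : P.IsGaugeStr R) : P.gauge.IsQGroupoid R where
  submersion_s := by
    refine ⟨hR.qSmooth_gaugeS, fun a => ?_⟩
    obtain ⟨p, q, rfl⟩ := Gauge.ind' P a
    obtain ⟨τ, hτ, hτq⟩ := exists_localSection q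
    refine surjective_tmapAt_of_section (σ := fun y => Gauge.mk p (τ y)) ?_
      (hR.qSmooth_gaugeS.qSmoothAt _) ?_ ?_
    · exact congrArg (Gauge.mk p) hτq
    · exact qSmoothAt_gauge hR ((qSmooth_const _ _ p).qSmoothAt _) hτ.smooth
    · rw [SmoothMfd.nhd_toQ]
      exact hτ.right
  smooth_inv := hR.qSmooth_inv
  smooth_one := by
    refine qSmooth_iff.2 fun x => ?_
    obtain ⟨p, rfl⟩ := P.surjective_β x
    obtain ⟨τ, hτ, -⟩ := exists_localSection p
    refine (qSmoothAt_gauge hR hτ.smooth hτ.smooth).congr ?_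
    rw [SmoothMfd.nhd_toQ]
    filter_upwards [hτ.right] with y hy
    exact gauge_one_eq hy
  smooth_mul := by
    intro T a b e ha hb
    refine qSmooth_iff.2 fun z => ?_
    obtain ⟨p, hp⟩ := P.surjective_β (gaugeS (a z))
    obtain ⟨τ, hτ, -⟩ := exists_localSection p
    rw [hp] at hτ
    have hsa := (hR.qSmooth_gaugeS.qSmoothAt (a z)).comp (ha.qSmoothAt z)
    have hib := (hR.qSmooth_inv.qSmoothAt (b z)).comp (hb.qSmoothAt z)
    have hτ' : IsLocalSection τ (gaugeS (P.gauge.inv (b z))) := by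
      have : gaugeS (P.gauge.inv (b z)) = gaugeS (a z) := (P.gauge.s_inv _).trans (e z).symm
      rwa [this]
    refine (qSmoothAt_gauge hR (QSmoothAt.comp (hR.qSmoothAt_rho hτ) (ha.qSmoothAt z))
      (QSmoothAt.comp (hR.qSmoothAt_rho hτ') hib)).congr ?_
    filter_upwards [hsa.eventually_mem hτ.right] with w hw
    exact gauge_mul_eq hw (e w)

theorem isLocallyTrivial (hR : P.IsGaugeStr R) : P.gauge.IsLocallyTrivial R := by
  have hsm : QSmooth R (P.N.toQ.prod P.N.toQ) (fun a => (P.gauge.s a, P.gauge.t a)) :=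
    hR.qSmooth_gaugeS.prodMk hR.qSmooth_gaugeT
  refine ⟨?_, hsm, fun a => ?_⟩
  · rintro ⟨x, y⟩
    exact ⟨Gauge.mk (P.point y) (P.point x), Prod.ext (P.β_point x) (P.β_point y)⟩
  · obtain ⟨p, q, rfl⟩ := Gauge.ind' P a
    obtain ⟨τ, hτ, hτq⟩ := exists_localSection q
    obtain ⟨τ', hτ', hτp⟩ := exists_localSection p
    have h0 := (_root_.qSmooth_id (P.N.toQ.prod P.N.toQ)).qSmoothAt (P.β q, P.β p)
    -- The anchor map is `(s, t)`, in this order, while an arrow lists its target first; hence the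
    -- exchange of components.
    refine surjective_tmapAt_of_section (σ := fun y => Gauge.mk (τ' y.2) (τ y.1)) ?_
      (hsm.qSmoothAt _) ?_ ?_
    · exact congrArg₂ Gauge.mk hτp hτq
    · exact qSmoothAt_gauge hR (QSmoothAt.comp hτ'.smooth h0.snd) (QSmoothAt.comp hτ.smooth h0.fst)
    · filter_upwards [h0.fst.eventually_mem hτ.right, h0.snd.eventually_mem hτ'.right] with y h1 h2
      exact Prod.ext h1 h2

end IsGaugeStr

@[simp] theorem Hom.gauge_mk (F : P ⟶ P') (p q : P.P) :
    Hom.gauge F (Gauge.mk p q) = Gauge.mk (F.F p) (F.F q) := rfl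

theorem Hom.isQGroupoidHom (F : P ⟶ P') {R : QStr P.Gauge} {R' : QStr P'.Gauge} (hR : P.IsGaugeStr R)
    (hR' : P'.IsGaugeStr R') :
    GroupoidOn.IsQGroupoidHom P.gauge R P'.gauge R' F.f (Hom.gauge F) where
  map_s a := by
    obtain ⟨p, q, rfl⟩ := Gauge.ind' P a
    exact F.comm q
  map_t a := by
    obtain ⟨p, q, rfl⟩ := Gauge.ind' P a
    exact F.comm p
  map_one x := by
    obtain ⟨p, rfl⟩ := P.surjective_β x
    rw [gauge_one_β, ← F.comm, gauge_one_β, gauge_mk]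
  map_mul a b e := by
    obtain ⟨p, q, r, rfl, rfl⟩ := exists_gauge_rep a b e
    exact (congrArg (Hom.gauge F) (gauge_mul_mk p q r e)).trans (gauge_mul_mk (F.F p) (F.F q) (F.F r) _).symm
  smooth := hR.qSmooth_of_comp
    (hR'.1.comp ((F.smooth_F.comp qSmooth_fst).prodMk (F.smooth_F.comp qSmooth_snd)))

end PrincipalQBundle

/-! ### The Atiyah algebroid -/

theorem QSmoothAt.toQ_tangent {T N : SmoothMfd.{u}} {f : T → N.toQ.TB} {t : T}
    (h : QSmoothAt T.toQ N.toQ.tangent f t) :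
    SmoothNear T N.tangent (fun z => (⟨(f z).1, (f z).2⟩ : TangentBundle N.I N)) t := by
  obtain ⟨g, hg, hgf, -⟩ := h.exists_lift_toQ (n := (⟨(f t).1, (f t).2⟩ : TangentBundle N.I N))
    (SmoothMfd.vec_toQ _ _)
  refine hg.congr ?_
  filter_upwards [hgf] with z hz
  have h1 := (SmoothMfd.vec_toQ (M := N) (g z).proj (g z).2).symm.trans hz
  rw [← h1]
  rfl

theorem SmoothNear.exists_isOpen {T N : SmoothMfd.{u}} {f : T → N} {t : T} (h : SmoothNear T N f t)
    {p : T → Prop} (hp : ∀ᶠ z in 𝓝 t, p z) :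
    ∃ W : Set T, IsOpen W ∧ t ∈ W ∧ ContMDiffOn T.I N.I ∞ f W ∧ ∀ z ∈ W, p z := by
  obtain ⟨W, hW, hWo, ht⟩ := mem_nhds_iff.1 (Filter.Eventually.and h hp)
  exact ⟨W, hWo, ht, fun z hz => (hW hz).1.contMDiffWithinAt, fun z hz => (hW hz).2⟩

theorem QSmoothAt.exists_isOpen {S : Type u} {Q : QStr S} {T : SmoothMfd.{u}} {f : T → S} {t : T}
    (h : QSmoothAt T.toQ Q f t) {p : T → Prop} (hp : ∀ᶠ z in 𝓝 t, p z) :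
    ∃ W : Set T, IsOpen W ∧ t ∈ W ∧ QSmoothOn T.toQ Q f W ∧ ∀ z ∈ W, p z := by
  have h' := h.eventually
  rw [SmoothMfd.nhd_toQ] at h'
  obtain ⟨W, hW, hWo, ht⟩ := mem_nhds_iff.1 (Filter.Eventually.and h' hp)
  exact ⟨W, hWo, ht, QSmoothAt.qSmoothOn fun z hz => (hW hz).1, fun z hz => (hW hz).2⟩

namespace PrincipalQBundle
variable {P P' : PrincipalQBundle.{u}} {S : Type u} {Q : QStr S}

theorem Atiyah.mk_tact (w : P.Q.TB) (g : P.G) : Atiyah.mk (P.tact w g) = Atiyah.mk w :=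
  (Quotient.sound (s := P.tangentSetoid) (a := w) (b := P.tact w g) ⟨g, rfl⟩).symm

theorem Atiyah.exact {w w' : P.Q.TB} (h : Atiyah.mk w = Atiyah.mk w') : ∃ g, P.tact w g = w' :=
  Quotient.exact h

theorem Atiyah.mk_injective {w w' : P.Q.TB} (h : Atiyah.mk w = Atiyah.mk w') (e : w.1 = w'.1) :
    w = w' := by
  obtain ⟨g, rfl⟩ := Atiyah.exact h
  rw [P.act_free w.1 g e.symm, P.tact_one]

@[simp] theorem Atiyah.base_mk (w : P.Q.TB) : (Atiyah.mk w).base = P.β w.1 := rfl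

theorem qSmoothAt_tact {a : S → P.Q.TB} {b : S → P.G} {s : S} (ha : QSmoothAt Q P.Q.tangent a s)
    (hb : QSmoothAt Q P.G.Q b s) : QSmoothAt Q P.Q.tangent (fun x => P.tact (a x) (b x)) s :=
  QSmoothAt.comp (f := fun x => (a x, b x))
    (qSmoothAt_tmap_left (A := fun y => P.act y.1 y.2) (x := (a s, b s)) (P.smooth_act.qSmoothAt _))
    (ha.prodMk hb)

/-- The quotient map is linear on each tangent space. -/
noncomputable def fibLinearEquiv {p : P.P} {x : P.N} (h : P.β p = x) : P.Q.TSpace p ≃ₗ[ℝ] P.AtiyahFib x :=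
  let L₀ : P.Q.TSpace (P.point x) ≃ₗ[ℝ] P.AtiyahFib x :=
    ((fibEquiv (P.β_point x)).symm.linearEquiv ℝ).symm
  -- The translation from the chosen point to `p` has a linear tangent map that preserves classes.
  -- Linearity at `p` is transported along it from the chosen point, where it holds by definition.
  have key : ∃ L : P.Q.TSpace (P.point x) →L[ℝ] P.Q.TSpace p,
      ∀ v, fibEquiv h (L v) = L₀ v := by
    obtain ⟨g, rfl⟩ := (P.fiber_eq (P.point x) p).1 (h.trans (P.β_point x).symm)
    exact ⟨tmapAt P.Q P.Q (fun p => P.act p g) (P.point x), fun v => Subtype.ext (Atiyah.mk_tact ⟨_, v⟩ g)⟩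
  have hv : ∀ v, ∃ u, key.choose u = v := fun v =>
    ⟨L₀.symm (fibEquiv h v), (fibEquiv h).injective (by rw [key.choose_spec, L₀.apply_symm_apply])⟩
  { fibEquiv h with
    map_add' := fun v w => by
      obtain ⟨v, rfl⟩ := hv v
      obtain ⟨w, rfl⟩ := hv w
      change fibEquiv h _ = fibEquiv h _ + fibEquiv h _
      rw [← map_add, key.choose_spec, key.choose_spec, key.choose_spec, map_add]
    map_smul' := fun r v => by
      obtain ⟨v, rfl⟩ := hv v
      change fibEquiv h _ = r • fibEquiv h _
      rw [← map_smul, key.choose_spec, key.choose_spec, map_smul] }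

theorem fibLinearEquiv_apply {p : P.P} {x : P.N} (h : P.β p = x) (v : P.Q.TSpace p) :
    fibLinearEquiv h v = fibEquiv h v := rfl

theorem fibEquiv_invField (σ : ∀ x, P.AtiyahFib x) (p : P.P) : fibEquiv rfl (P.invField σ p) = σ (P.β p) :=
  Equiv.apply_symm_apply _ _

theorem mk_invField (σ : ∀ x, P.AtiyahFib x) (p : P.P) : Atiyah.mk ⟨p, P.invField σ p⟩ = (σ (P.β p)).1 :=
  congrArg Subtype.val (fibEquiv_invField σ p)

theorem invField_eq {σ : ∀ x, P.AtiyahFib x} {p : P.P} {v : P.Q.TSpace p}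
    (h : Atiyah.mk ⟨p, v⟩ = (σ (P.β p)).1) : P.invField σ p = v :=
  (fibEquiv (rfl : P.β p = P.β p)).symm_apply_eq.2 (Subtype.ext h.symm)

theorem invField_eq_symm (σ : ∀ x, P.AtiyahFib x) (p : P.P) :
    P.invField σ p = (fibLinearEquiv (rfl : P.β p = P.β p)).symm (σ (P.β p)) :=
  (LinearEquiv.eq_symm_apply _).2 (fibEquiv_invField σ p)

theorem eq_of_invField {σ τ : ∀ x, P.AtiyahFib x} {p : P.P} (h : P.invField σ p = P.invField τ p) :
    σ (P.β p) = τ (P.β p) := by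
  exact (fibEquiv_invField σ p).symm.trans ((congrArg _ h).trans (fibEquiv_invField τ p))

variable (P) in
/-- The invariant vector field of a section, as a map into the tangent bundle. -/
noncomputable def invVec (σ : ∀ x, P.AtiyahFib x) (p : P.P) : P.Q.TB := ⟨p, P.invField σ p⟩

theorem mk_invVec (σ : ∀ x, P.AtiyahFib x) (p : P.P) : Atiyah.mk (P.invVec σ p) = (σ (P.β p)).1 :=
  mk_invField σ p

theorem tact_invVec (σ : ∀ x, P.AtiyahFib x) (p : P.P) (g : P.G) :
    P.tact (P.invVec σ p) g = P.invVec σ (P.act p g) := by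
  refine Atiyah.mk_injective ?_ rfl
  rw [Atiyah.mk_tact, mk_invVec, mk_invVec, P.β_act]

theorem Atiyah.exists_rep {p : P.P} {ξ : P.Atiyah} (h : ξ.base = P.β p) :
    ∃ w : P.Q.TB, w.1 = p ∧ Atiyah.mk w = ξ := by
  obtain ⟨v, hv⟩ := (fibEquiv (rfl : P.β p = P.β p)).surjective ⟨ξ, h⟩
  exact ⟨⟨p, v⟩, rfl, congrArg Subtype.val hv⟩

open Classical in
/-- The representative of `ξ` at the point `p` above the base of `ξ`. -/
noncomputable def liftAt (p : P.P) (ξ : P.Atiyah) : P.Q.TB :=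
  if h : ξ.base = P.β p then (Atiyah.exists_rep h).choose else ⟨p, 0⟩

theorem liftAt_fst {p : P.P} {ξ : P.Atiyah} (h : ξ.base = P.β p) : (liftAt p ξ).1 = p := by
  have e : liftAt p ξ = (Atiyah.exists_rep h).choose := dif_pos h
  exact (congrArg Sigma.fst e).trans (Atiyah.exists_rep h).choose_spec.1

theorem mk_liftAt {p : P.P} {ξ : P.Atiyah} (h : ξ.base = P.β p) : Atiyah.mk (liftAt p ξ) = ξ := by
  have e : liftAt p ξ = (Atiyah.exists_rep h).choose := dif_pos h
  exact (congrArg Atiyah.mk e).trans (Atiyah.exists_rep h).choose_spec.2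

theorem liftAt_mk {p : P.P} {w : P.Q.TB} (h : w.1 = p) : liftAt p (Atiyah.mk w) = w := by
  subst h
  exact Atiyah.mk_injective (mk_liftAt rfl) (liftAt_fst rfl)

theorem liftAt_section (σ : ∀ x, P.AtiyahFib x) (p : P.P) :
    liftAt p (σ (P.β p)).1 = P.invVec σ p := by
  rw [← mk_invVec]
  exact liftAt_mk rfl

theorem liftAt_mk_eq {p : P.P} {w : P.Q.TB} (h : P.β p = P.β w.1) :
    liftAt p (Atiyah.mk w) = P.tact w (P.div w.1 p) := by
  have h' : (Atiyah.mk w).base = P.β p := h.symm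
  refine Atiyah.mk_injective ?_ ?_
  · rw [mk_liftAt h', Atiyah.mk_tact]
  · rw [liftAt_fst h']
    exact (act_div h).symm

theorem atiyah_isSmoothAt_iff {T : SmoothMfd.{u}} {c : T → Σ x, P.AtiyahFib x} {t : T} :
    P.atiyah.IsSmoothAt c t ↔ ∃ ĉ : T → P.Q.TB, QSmoothAt T.toQ P.Q.tangent ĉ t ∧
      ∀ᶠ z in 𝓝 t, (c z).2.1 = Atiyah.mk (ĉ z) := by
  constructor
  · rintro ⟨W, ĉ, hW, ht, hs, h⟩
    exact ⟨ĉ, hs.qSmoothAt ht, Filter.mem_of_superset (hW.mem_nhds ht) h⟩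
  · rintro ⟨ĉ, hs, h⟩
    obtain ⟨W, hW, ht, hs, h⟩ := hs.exists_isOpen h
    exact ⟨W, ĉ, hW, ht, hs, h⟩

/-- A smooth representative over another map into `P` is moved over the prescribed `p` by the
tangent action of a smoothly varying group element. Hence the existence of some smooth lift can be
tested on one explicit lift. -/
theorem atiyah_isSmoothAt_iff_liftAt {T : SmoothMfd.{u}} {c : T → Σ x, P.AtiyahFib x} {t : T} {p : T → P.P}
    (hp : QSmoothAt T.toQ P.Q p t) (h : ∀ᶠ z in 𝓝 t, P.β (p z) = (c z).1) :
    P.atiyah.IsSmoothAt c t ↔ QSmoothAt T.toQ P.Q.tangent (fun z => liftAt (p z) (c z).2.1) t := by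
  rw [atiyah_isSmoothAt_iff]
  constructor
  · rintro ⟨ĉ, hs, hc⟩
    have h1 : QSmoothAt T.toQ P.Q (fun z => (ĉ z).1) t := (QStr.qSmooth_tangent_fst.qSmoothAt _).comp hs
    have h2 : ∀ᶠ z in 𝓝 t, P.β (p z) = P.β (ĉ z).1 := by
      filter_upwards [h, hc] with z h1 h2
      rw [h1, ← (c z).2.2, h2, Atiyah.base_mk]
    refine QSmoothAt.congr (qSmoothAt_tact hs (qSmoothAt_div h1 hp (by rwa [SmoothMfd.nhd_toQ]))) ?_
    rw [SmoothMfd.nhd_toQ]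
    filter_upwards [h2, hc] with z h2 h3
    rw [h3, liftAt_mk_eq h2]
  · intro hs
    refine ⟨_, hs, ?_⟩
    filter_upwards [h] with z hz
    exact (mk_liftAt ((c z).2.2.trans hz.symm)).symm

theorem atiyah_isSmoothAt_comp {T T' : SmoothMfd.{u}} {c : T → Σ x, P.AtiyahFib x} {f : T' → T} {t : T'}
    (hc : P.atiyah.IsSmoothAt c (f t)) (hf : SmoothNear T' T f t) :
    P.atiyah.IsSmoothAt (fun z => c (f z)) t := by
  obtain ⟨ĉ, hs, h⟩ := atiyah_isSmoothAt_iff.1 hc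
  exact atiyah_isSmoothAt_iff.2 ⟨fun z => ĉ (f z), QSmoothAt.comp hs (qSmoothAt_toQ.2 hf),
    hf.continuousAt.eventually h⟩

/-- In one direction the section is pulled back to the atlas of `P`, where the lift over the
tautological point is the invariant field. In the other, the field is restricted along a local
section of `β`. -/
theorem atiyah_isSmoothSection_iff {σ : ∀ x, P.AtiyahFib x} :
    P.atiyah.IsSmoothSection σ ↔ P.Q.IsSmoothField (P.invField σ) := by
  constructor
  · intro h
    refine qSmooth_iff.2 fun p => ?_
    obtain ⟨m, rfl⟩ : ∃ m, P.Q.π m = p := ⟨_, P.Q.π_out p⟩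
    apply qSmoothAt_of_comp_π
    have hβ := (P.smooth_β.qSmoothAt (P.Q.π m)).comp_π
    have h1 := atiyah_isSmoothAt_comp (f := fun z => P.β (P.Q.π z)) (h _) (qSmoothAt_toQ.1 hβ)
    have h2 := (atiyah_isSmoothAt_iff_liftAt (P.Q.qSmooth_π.qSmoothAt m)
      (Filter.Eventually.of_forall fun z => rfl)).1 h1
    simp only [liftAt_section] at h2
    exact h2
  · intro h x
    obtain ⟨p, rfl⟩ := P.surjective_β x
    obtain ⟨τ, hτ, -⟩ := exists_localSection p
    refine (atiyah_isSmoothAt_iff_liftAt hτ.smooth hτ.right).2 ?_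
    refine QSmoothAt.congr (QSmoothAt.comp (h.qSmoothAt _) hτ.smooth) ?_
    rw [SmoothMfd.nhd_toQ]
    filter_upwards [hτ.right] with y hy
    have := liftAt_section σ (τ y)
    rwa [hy] at this

end PrincipalQBundle

/-! ### Smooth maps into tangent bundles, and directional derivatives along Q-smooth maps -/

theorem SmoothMfd.smoothNear_tangent_proj {N : SmoothMfd.{u}} (p : N.tangent) :
    SmoothNear N.tangent N (fun p => (p : TangentBundle N.I N).proj) p := by
  have hp : ContMDiff N.I.tangent N.I ∞ (fun p : TangentBundle N.I N => p.proj) :=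
    Bundle.contMDiff_proj _
  exact ContMDiff.smoothNear (M := N.tangent) hp p

theorem smoothNear_tangent_iff {T N : SmoothMfd.{u}} {g : T → TangentBundle N.I N} {t : T} (x₀ : N)
    (h : (g t).proj ∈ (trivializationAt N.E (TangentSpace N.I) x₀).baseSet) :
    SmoothNear T N.tangent g t ↔ SmoothNear T N (fun z => (g z).proj) t ∧
      ∀ᶠ z in 𝓝 t, ContMDiffAt T.I 𝓘(ℝ, N.E) ∞
        (fun z => (trivializationAt N.E (TangentSpace N.I) x₀ (g z)).2) z := by
  have hb : ContinuousAt (fun z => (g z).proj) t →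
      ∀ᶠ z in 𝓝 t, g z ∈ (trivializationAt N.E (TangentSpace N.I) x₀).source := fun hc => by
    filter_upwards [hc.eventually ((trivializationAt N.E (TangentSpace N.I) x₀).open_baseSet.mem_nhds h)] with z hz
    exact (Bundle.Trivialization.mem_source _).2 hz
  constructor
  · intro hg
    have hp : SmoothNear T N (fun z => (g z).proj) t :=
      SmoothNear.comp (N := N.tangent) (SmoothMfd.smoothNear_tangent_proj _) hg
    refine ⟨hp, ?_⟩
    filter_upwards [hb hp.continuousAt, hg] with z h1 h2
    exact ((Bundle.Trivialization.contMDiffAt_iff h1).1 h2).2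
  · rintro ⟨hp, hg⟩
    filter_upwards [hb hp.continuousAt, hp, hg] with z h1 h2 h3
    exact (Bundle.Trivialization.contMDiffAt_iff h1).2 ⟨h2, h3⟩

section
variable {S : Type u} {Q : QStr S}

/-- A smooth lift `k` with the value of `g` at `t` has the same base component near `t` by rigidity,
and then the same vectors because `vec` is injective. -/
theorem QStr.smoothNear_of_tangent_π {T : SmoothMfd.{u}} {g : T → TangentBundle Q.M.I Q.M} {t : T}
    (hp : SmoothNear T Q.M (fun z => (g z).proj) t)
    (h : QSmoothAt T.toQ Q.tangent (fun z => Q.vec (g z).proj (g z).2) t) :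
    SmoothNear T Q.M.tangent g t := by
  obtain ⟨k, hk, hkg, hkt⟩ := h.exists_lift_toQ (n := g t) rfl
  have hkp : SmoothNear T Q.M (fun z => (k z : TangentBundle Q.M.I Q.M).proj) t :=
    SmoothNear.comp (N := Q.M.tangent) (SmoothMfd.smoothNear_tangent_proj _) hk
  have := Q.eventually_eq_of_lift hkp hp (by
    filter_upwards [hkg] with z hz
    exact congrArg Sigma.fst hz) (congrArg Bundle.TotalSpace.proj hkt)
  refine hk.congr ?_
  filter_upwards [hkg, this] with z h1 h2
  change Q.vec (k z).proj (k z).2 = Q.vec (g z).proj (g z).2 at h1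
  generalize (g z : TangentBundle Q.M.I Q.M) = a at h1 h2
  generalize (k z : TangentBundle Q.M.I Q.M) = b at h1 h2
  obtain ⟨a, v⟩ := a
  obtain ⟨b, w⟩ := b
  obtain rfl : b = a := h2
  exact (congrArg (Bundle.TotalSpace.mk b) (QStr.vec_injective h1)).symm

theorem QStr.dirDeriv_comp {N : SmoothMfd.{u}} {h : S → N} {s : S} (hh : QSmoothAt Q N.toQ h s)
    {f : N → ℝ} (hf : MDifferentiableAt N.I 𝓘(ℝ, ℝ) f (h s)) (v : Q.TSpace s) :
    MDifferentiableAt Q.M.I 𝓘(ℝ, ℝ) (fun z => f (h (Q.π z))) (Q.out s) ∧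
    Q.M.dirDeriv (fun z => f (h (Q.π z))) (Q.out s) v = N.dirDeriv f (h s) (tmapAt Q N.toQ h s v) := by
  obtain ⟨g, hg⟩ := hh.exists_isLiftAt
  have hb : g (Q.out s) = h s := hg.base
  have hd := hg.mdifferentiableAt
  obtain ⟨U, hU, hm, -, hl⟩ := hg.lift
  have he : (fun z => f (h (Q.π z))) =ᶠ[𝓝 (Q.out s)] f ∘ g := by
    filter_upwards [hU.mem_nhds hm] with z hz
    exact congrArg f (hl z hz).symm
  have hf' : MDifferentiableAt N.I 𝓘(ℝ, ℝ) f (g (Q.out s)) := by rw [hb]; exact hf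
  refine ⟨(hf'.comp _ hd).congr_of_eventuallyEq he, ?_⟩
  have h1 := mfderiv_comp_apply (I := Q.M.I) (I' := N.I) (I'' := 𝓘(ℝ, ℝ)) (Q.out s) hf' hd v
  have h2 : mfderiv Q.M.I 𝓘(ℝ, ℝ) (fun z => f (h (Q.π z))) (Q.out s) = mfderiv Q.M.I 𝓘(ℝ, ℝ) (f ∘ g) (Q.out s) :=
    Filter.EventuallyEq.mfderiv_eq he
  have h3 : ∀ x y : N, x = y → ∀ u : N.E, (mfderiv N.I 𝓘(ℝ, ℝ) f x u : ℝ) = mfderiv N.I 𝓘(ℝ, ℝ) f y u := by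
    rintro x _ rfl u; rfl
  exact (congrArg (fun L : Q.M.E →L[ℝ] ℝ => L v) h2).trans (h1.trans ((h3 _ _ hb _).trans
    (congrArg (fun L : Q.M.E →L[ℝ] N.E => (mfderiv N.I 𝓘(ℝ, ℝ) f (h s) (L v) : ℝ)) hg.tmapAt_eq.symm)))

end

/-! ### The vector bundle structure of the Atiyah algebroid -/

namespace PrincipalQBundle
variable {P P' : PrincipalQBundle.{u}}

/-- The fibre of the Atiyah algebroid as the tangent space of the Q-atlas of the bundle. -/
noncomputable def atlasEquiv (m : P.Q.M) {x : P.N} (h : P.β (P.Q.π m) = x) :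
    TangentSpace P.Q.M.I m ≃ₗ[ℝ] P.AtiyahFib x :=
  (LinearEquiv.ofBijective (tmapAt P.Q.M.toQ P.Q P.Q.π m : P.Q.M.toQ.TSpace m →ₗ[ℝ] P.Q.TSpace (P.Q.π m))
    (P.Q.bijective_tmapAt_π m)).trans (fibLinearEquiv h)

theorem atiyah_smooth_base {T : SmoothMfd.{u}} {c : T → Σ x, P.AtiyahFib x} {t : T}
    (h : P.atiyah.IsSmoothAt c t) : SmoothNear T P.N (fun z => (c z).1) t := by
  obtain ⟨ĉ, hs, hc⟩ := atiyah_isSmoothAt_iff.1 h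
  have h1 := qSmoothAt_toQ.1 (qSmoothAt_β (QSmoothAt.comp (QStr.qSmooth_tangent_fst.qSmoothAt _) hs))
  refine h1.congr ?_
  filter_upwards [hc] with z hz
  exact (c z).2.2.symm.trans (congrArg Atiyah.base hz)

open Classical in
-- A local section of `β`, lifted to a map `ŝ` into the atlas of `P`, identifies the fibre over `y`
-- with the tangent space of the atlas at `ŝ y`. A trivialization of the tangent bundle of the atlas
-- near `ŝ (β p)` then trivializes the Atiyah algebroid.
theorem atiyah_isVectorBundle : P.atiyah.IsVectorBundle := by
  refine ⟨P.Q.M.E, inferInstance, inferInstance, inferInstance, fun x₀ => ?_⟩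
  obtain ⟨p, rfl⟩ := P.surjective_β x₀
  obtain ⟨τ, hτ, -⟩ := exists_localSection p
  obtain ⟨ŝ, hs, hsτ, -⟩ := hτ.smooth.exists_lift_toQ (P.Q.π_out _)
  let B := trivializationAt P.Q.M.E (TangentSpace P.Q.M.I) (ŝ (P.β p))
  have hev : ∀ᶠ y in 𝓝 (P.β p), SmoothNear P.N P.Q.M ŝ y ∧ P.β (P.Q.π (ŝ y)) = y ∧ ŝ y ∈ B.baseSet := by
    filter_upwards [hs.eventually, hτ.right, hsτ, hs.continuousAt.eventually
      (B.open_baseSet.mem_nhds (FiberBundle.mem_baseSet_trivializationAt' _))] with y h1 h2 h3 h4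
    exact ⟨h1, by rw [h3, h2], h4⟩
  obtain ⟨U, hU, hUo, hx⟩ := mem_nhds_iff.1 hev
  -- The value `0` is taken only where `ŝ y` does not lie over `y` or leaves the trivialization,
  -- which does not happen over `U`.
  let e : ∀ y, P.AtiyahFib y →ₗ[ℝ] P.Q.M.E := fun y =>
    if h : P.β (P.Q.π (ŝ y)) = y ∧ ŝ y ∈ B.baseSet then
      ((atlasEquiv (ŝ y) h.1).symm.trans (B.linearEquivAt ℝ (ŝ y) h.2)).toLinearMap else 0
  have he : ∀ y (h : P.β (P.Q.π (ŝ y)) = y) (h' : ŝ y ∈ B.baseSet),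
      e y = ((atlasEquiv (ŝ y) h).symm.trans (B.linearEquivAt ℝ (ŝ y) h')).toLinearMap :=
    fun y h h' => dif_pos ⟨h, h'⟩
  refine ⟨U, e, hx, hUo, fun y hy => ?_, fun T c t ht => ?_⟩
  · rw [he y (hU hy).2.1 (hU hy).2.2]
    exact ((atlasEquiv (ŝ y) (hU hy).2.1).symm.trans (B.linearEquivAt ℝ (ŝ y) (hU hy).2.2)).bijective
  · let g : T → TangentBundle P.Q.M.I P.Q.M := fun z => ⟨ŝ (c z).1,
      if h : P.β (P.Q.π (ŝ (c z).1)) = (c z).1 then (atlasEquiv (ŝ (c z).1) h).symm (c z).2 else 0⟩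
    have hg : ∀ z, (c z).1 ∈ U → Atiyah.mk (P.Q.vec (g z).proj (g z).2) = (c z).2.1 ∧
        (B (g z)).2 = e (c z).1 (c z).2 := fun z hz => by
      have h1 : (g z).2 = (atlasEquiv (ŝ (c z).1) (hU hz).2.1).symm (c z).2 := dif_pos (hU hz).2.1
      rw [he _ (hU hz).2.1 (hU hz).2.2, h1]
      refine ⟨?_, ?_⟩
      · exact congrArg Subtype.val ((atlasEquiv (ŝ (c z).1) (hU hz).2.1).apply_symm_apply (c z).2)
      · refine (congrArg (fun v => (B ⟨ŝ (c z).1, v⟩).2) h1).trans ?_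
        rfl
    -- Over a smooth base map, the lift of `c` along `ŝ` is represented by `g`, and `g` is smooth
    -- exactly when its component in the trivialization `B` is; that component is `e`.
    have key : SmoothNear T P.N (fun z => (c z).1) t →
        (P.atiyah.IsSmoothAt c t ↔ ∀ᶠ z in 𝓝 t, ContMDiffAt T.I 𝓘(ℝ, P.Q.M.E) ∞ (fun z => e (c z).1 (c z).2) z) := by
      intro hc
      have hcU := hc.continuousAt.eventually (hUo.mem_nhds ht)
      have hp : SmoothNear T P.Q.M (fun z => ŝ (c z).1) t := SmoothNear.comp (hU ht).1 hc
      refine (atiyah_isSmoothAt_iff_liftAt hp.qSmoothAt_π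
        (by filter_upwards [hcU] with z hz using (hU hz).2.1)).trans ?_
      have hl : ∀ᶠ z in 𝓝 t, liftAt (P.Q.π (ŝ (c z).1)) (c z).2.1 = P.Q.vec (g z).proj (g z).2 := by
        filter_upwards [hcU] with z hz
        rw [← (hg z hz).1]
        exact liftAt_mk rfl
      have he2 : ∀ᶠ z in 𝓝 t, ∀ᶠ z in 𝓝 z, e (c z).1 (c z).2 = (B (g z)).2 := by
        refine Filter.Eventually.eventually_nhds ?_
        filter_upwards [hcU] with z hz
        exact (hg z hz).2.symm
      have hgb := smoothNear_tangent_iff (g := g) (t := t) (ŝ (P.β p)) (hU ht).2.2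
      constructor
      · intro h
        have h1 := (hgb.1 (QStr.smoothNear_of_tangent_π hp (h.congr (by
          rw [SmoothMfd.nhd_toQ]
          filter_upwards [hl] with z hz using hz.symm)))).2
        filter_upwards [h1, he2] with z h1 h2
        exact h1.congr_of_eventuallyEq h2
      · intro h
        have h1 : SmoothNear T P.Q.M.tangent g t := hgb.2 ⟨hp, by
          filter_upwards [h, he2] with z h1 h2
          exact h1.congr_of_eventuallyEq (by filter_upwards [h2] with w hw using hw.symm)⟩
        refine QSmoothAt.congr (SmoothNear.qSmoothAt_π (Q := P.Q.tangent) h1) ?_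
        rw [SmoothMfd.nhd_toQ]
        exact hl
    constructor
    · intro h
      have hc := atiyah_smooth_base h
      obtain ⟨W, hW, hWo, htW⟩ := mem_nhds_iff.1 (Filter.Eventually.and hc
        ((hc.continuousAt.eventually (hUo.mem_nhds ht)).and ((key hc).1 h)))
      exact ⟨W, hWo, htW, fun z hz => (hW hz).2.1, fun z hz => (hW hz).1.contMDiffWithinAt,
        fun z hz => (hW hz).2.2.contMDiffWithinAt⟩
    · rintro ⟨W, hWo, htW, -, h1, h2⟩
      refine (key (h1.smoothNear hWo htW)).2 ?_
      filter_upwards [hWo.mem_nhds htW] with z hz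
      exact h2.contMDiffAt (hWo.mem_nhds hz)

/-! #### Anchor and bracket -/

theorem atiyah_mk_anchor {x : P.N} (ξ : P.AtiyahFib x) :
    (⟨x, P.atiyah.anchor x ξ⟩ : P.N.toQ.TB) = ξ.1.anchor :=
  QStr.TB.mk_vecAt _ _

theorem atiyah_anchor_fibEquiv {p : P.P} (v : P.Q.TSpace p) :
    P.atiyah.anchor (P.β p) (fibEquiv rfl v) = tmapAt P.Q P.N.toQ P.β p v := rfl

theorem atiyah_anchor_section (σ : ∀ x, P.AtiyahFib x) (p : P.P) :
    P.atiyah.anchor (P.β p) (σ (P.β p)) = tmapAt P.Q P.N.toQ P.β p (P.invField σ p) := by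
  rw [← atiyah_anchor_fibEquiv, fibEquiv_invField]

theorem fibEquiv_invField_of_eq (σ : ∀ x, P.AtiyahFib x) {p : P.P} {x : P.N} (h : P.β p = x) :
    fibEquiv h (P.invField σ p) = σ x := by
  subst h
  exact fibEquiv_invField σ p

theorem tmapAt_act_invField (σ : ∀ x, P.AtiyahFib x) (p : P.P) (g : P.G) :
    tmapAt P.Q P.Q (fun p => P.act p g) p (P.invField σ p) = P.invField σ (P.act p g) :=
  QStr.TB.eq_of_mk_eq (tact_invVec σ p g)

/-- A right translation relates invariant fields to themselves, so their bracket is invariant. It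
therefore agrees everywhere with the invariant field defined from its values at the chosen points of
the fibres. -/
theorem invField_bracket {σ τ : ∀ x, P.AtiyahFib x} (hσ : P.atiyah.IsSmoothSection σ)
    (hτ : P.atiyah.IsSmoothSection τ) :
    P.invField (P.atiyah.bracket σ τ) = P.Q.lieBracket (P.invField σ) (P.invField τ) := by
  funext p
  obtain ⟨g, hg⟩ := (P.fiber_eq (P.point (P.β p)) p).1 (P.β_point _).symm
  apply invField_eq
  have h1 : ∀ q, tmapAt P.Q P.Q (fun p => P.act p g) q (P.Q.lieBracket (P.invField σ) (P.invField τ) q) =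
      P.Q.lieBracket (P.invField σ) (P.invField τ) (P.act q g) := fun q =>
    QStr.tmapAt_lieBracket_of_related ((P.qSmooth_act g).qSmoothAt q)
      (atiyah_isSmoothSection_iff.1 hσ) (atiyah_isSmoothSection_iff.1 hτ)
      (atiyah_isSmoothSection_iff.1 hσ) (atiyah_isSmoothSection_iff.1 hτ)
      (Filter.Eventually.of_forall fun x => tmapAt_act_invField σ x g)
      (Filter.Eventually.of_forall fun x => tmapAt_act_invField τ x g)
  have h2 := QStr.TB.mk_apply (P.Q.lieBracket (P.invField σ) (P.invField τ)) hg
  refine (congrArg Atiyah.mk (h2.symm.trans (congrArg (Sigma.mk _) (h1 (P.point (P.β p))).symm))).trans ?_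
  exact Atiyah.mk_tact ⟨_, _⟩ g

theorem invField_add (σ τ : ∀ x, P.AtiyahFib x) :
    P.invField (σ + τ) = fun p => P.invField σ p + P.invField τ p := by
  funext p
  simp only [invField_eq_symm]
  exact map_add _ _ _

theorem invField_neg (σ : ∀ x, P.AtiyahFib x) :
    P.invField (-σ) = fun p => -P.invField σ p := by
  funext p
  simp only [invField_eq_symm]
  exact map_neg _ _

theorem invField_smul (f : P.N → ℝ) (σ : ∀ x, P.AtiyahFib x) :
    P.invField (fun x => f x • σ x) = fun p => f (P.β p) • P.invField σ p := by
  funext p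
  simp only [invField_eq_symm]
  exact map_smul _ _ _

end PrincipalQBundle

/-! ### Sums and multiples of vector fields on Q-manifolds -/

section
variable {S : Type u} {Q : QStr S}

theorem QStr.IsSmoothField.add {X Y : ∀ s, Q.TSpace s} (hX : Q.IsSmoothField X) (hY : Q.IsSmoothField Y) :
    Q.IsSmoothField (fun s => X s + Y s) := by
  refine QStr.isSmoothField_of_lift (V := Q.liftField X + Q.liftField Y)
    (ContMDiff.add_section hX.liftField hY.liftField) fun m => ?_
  rw [← Q.liftField_add]
  exact Q.vec_liftField _ m

theorem QStr.liftField_smul (a : S → ℝ) (X : ∀ s, Q.TSpace s) (m : Q.M) :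
    Q.liftField (fun s => a s • X s) m = a (Q.π m) • Q.liftField X m := by
  refine QStr.liftField_eq ?_
  have h1 := QStr.TB.eq_of_mk_eq (Q.vec_liftField X m)
  exact congrArg (Sigma.mk _) ((map_smul (tmapAt Q.M.toQ Q Q.π m) _ _).trans (congrArg _ h1))

theorem QStr.IsSmoothField.smul {a : S → ℝ} {X : ∀ s, Q.TSpace s}
    (ha : ContMDiff Q.M.I 𝓘(ℝ, ℝ) ∞ (fun z => a (Q.π z))) (hX : Q.IsSmoothField X) :
    Q.IsSmoothField (fun s => a s • X s) := by
  refine QStr.isSmoothField_of_lift (V := fun m => a (Q.π m) • Q.liftField X m)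
    (ContMDiff.smul_section ha hX.liftField) fun m => ?_
  rw [← QStr.liftField_smul]
  exact Q.vec_liftField _ m

theorem QSmoothAt.contMDiffAt_comp {N : SmoothMfd.{u}} {h : S → N} {m : Q.M}
    (hh : QSmoothAt Q N.toQ h (Q.π m)) {f : N → ℝ} (hf : ContMDiffAt N.I 𝓘(ℝ, ℝ) ∞ f (h (Q.π m))) :
    ContMDiffAt Q.M.I 𝓘(ℝ, ℝ) ∞ (fun z => f (h (Q.π z))) m :=
  ContMDiffAt.comp (g := f) (f := fun z => h (Q.π z)) m hf (qSmoothAt_toQ.1 hh.comp_π).contMDiffAt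

end

/-! ### The Lie algebroid axioms and the morphisms of Atiyah algebroids -/

namespace PrincipalQBundle
variable {P P' : PrincipalQBundle.{u}}

theorem atiyah_isSmoothSection_add {σ τ : ∀ x, P.AtiyahFib x} (hσ : P.atiyah.IsSmoothSection σ)
    (hτ : P.atiyah.IsSmoothSection τ) : P.atiyah.IsSmoothSection (σ + τ) := by
  refine atiyah_isSmoothSection_iff.2 ?_
  rw [invField_add]
  exact (atiyah_isSmoothSection_iff.1 hσ).add (atiyah_isSmoothSection_iff.1 hτ)

theorem atiyah_isSmoothSection_smul {f : P.N → ℝ} {σ : ∀ x, P.AtiyahFib x}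
    (hf : ContMDiff P.N.I 𝓘(ℝ, ℝ) ∞ f) (hσ : P.atiyah.IsSmoothSection σ) :
    P.atiyah.IsSmoothSection (fun x => f x • σ x) := by
  refine atiyah_isSmoothSection_iff.2 ?_
  rw [invField_smul]
  exact (atiyah_isSmoothSection_iff.1 hσ).smul fun m => (P.smooth_β.qSmoothAt _).contMDiffAt_comp hf.contMDiffAt

theorem atiyah_bracket_smooth {σ τ : ∀ x, P.AtiyahFib x} (hσ : P.atiyah.IsSmoothSection σ)
    (hτ : P.atiyah.IsSmoothSection τ) : P.atiyah.IsSmoothSection (P.atiyah.bracket σ τ) := by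
  refine atiyah_isSmoothSection_iff.2 ?_
  rw [invField_bracket hσ hτ]
  exact (atiyah_isSmoothSection_iff.1 hσ).lieBracket (atiyah_isSmoothSection_iff.1 hτ)

theorem ext_invField {σ τ : ∀ x, P.AtiyahFib x} (h : P.invField σ = P.invField τ) : σ = τ := by
  funext x
  obtain ⟨p, rfl⟩ := P.surjective_β x
  exact eq_of_invField (congrFun h p)

theorem atiyah_anchor_add {x : P.N} (v w : P.AtiyahFib x) :
    P.atiyah.anchor x (v + w) = P.atiyah.anchor x v + P.atiyah.anchor x w := by
  obtain ⟨p, rfl⟩ := P.surjective_β x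
  obtain ⟨v, rfl⟩ := (fibLinearEquiv (rfl : P.β p = P.β p)).surjective v
  obtain ⟨w, rfl⟩ := (fibLinearEquiv (rfl : P.β p = P.β p)).surjective w
  rw [← map_add]
  exact map_add (tmapAt P.Q P.N.toQ P.β p) v w

theorem atiyah_anchor_smul {x : P.N} (r : ℝ) (v : P.AtiyahFib x) :
    P.atiyah.anchor x (r • v) = r • P.atiyah.anchor x v := by
  obtain ⟨p, rfl⟩ := P.surjective_β x
  obtain ⟨v, rfl⟩ := (fibLinearEquiv (rfl : P.β p = P.β p)).surjective v
  rw [← map_smul]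
  exact map_smul (tmapAt P.Q P.N.toQ P.β p) r v

/-- The bracket of the Atiyah algebroid is related along a bundle morphism, for fields that decompose with
coefficients. -/
theorem tmapAt_invField_bracket (F : P ⟶ P') {p : P.P} {k l : ℕ} {σ τ : ∀ x, P.AtiyahFib x}
    {a : Fin k → P.N → ℝ} {b : Fin l → P.N → ℝ} {A : Fin k → ∀ y, P'.AtiyahFib y} {B : Fin l → ∀ y, P'.AtiyahFib y}
    (hσ : P.atiyah.IsSmoothSection σ) (hτ : P.atiyah.IsSmoothSection τ)
    (ha : ∀ i, MDifferentiableAt P.N.I 𝓘(ℝ, ℝ) (a i) (P.β p))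
    (hb : ∀ j, MDifferentiableAt P.N.I 𝓘(ℝ, ℝ) (b j) (P.β p))
    (hA : ∀ i, P'.atiyah.IsSmoothSection (A i)) (hB : ∀ j, P'.atiyah.IsSmoothSection (B j))
    (hσA : ∀ᶠ x in P.Q.nhd p, tmapAt P.Q P'.Q F.F x (P.invField σ x) = ∑ i, a i (P.β x) • P'.invField (A i) (F.F x))
    (hτB : ∀ᶠ x in P.Q.nhd p, tmapAt P.Q P'.Q F.F x (P.invField τ x) = ∑ j, b j (P.β x) • P'.invField (B j) (F.F x)) :
    tmapAt P.Q P'.Q F.F p (P.invField (P.atiyah.bracket σ τ) p) =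
      (∑ i, ∑ j, (a i (P.β p) * b j (P.β p)) • P'.invField (P'.atiyah.bracket (A i) (B j)) (F.F p)) +
      (∑ j, P.N.dirDeriv (b j) (P.β p) (P.atiyah.anchor (P.β p) (σ (P.β p))) • P'.invField (B j) (F.F p)) -
      ∑ i, P.N.dirDeriv (a i) (P.β p) (P.atiyah.anchor (P.β p) (τ (P.β p))) • P'.invField (A i) (F.F p) := by
  have h := QStr.tmapAt_lieBracket (F.smooth_F.qSmoothAt p) (a := fun i x => a i (P.β x))
    (b := fun j x => b j (P.β x)) (atiyah_isSmoothSection_iff.1 hσ) (atiyah_isSmoothSection_iff.1 hτ)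
    (fun i => atiyah_isSmoothSection_iff.1 (hA i)) (fun j => atiyah_isSmoothSection_iff.1 (hB j))
    (fun i => (QStr.dirDeriv_comp (P.smooth_β.qSmoothAt p) (ha i) 0).1)
    (fun i => (QStr.dirDeriv_comp (P.smooth_β.qSmoothAt p) (hb i) 0).1) hσA hτB
  rw [invField_bracket hσ hτ]
  refine h.trans ?_
  have e1 : ∀ i j, P'.Q.lieBracket (P'.invField (A i)) (P'.invField (B j)) (F.F p) =
      P'.invField (P'.atiyah.bracket (A i) (B j)) (F.F p) := fun i j => by
    rw [invField_bracket (hA i) (hB j)]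
  have e2 : ∀ j, P.Q.M.dirDeriv (fun z => b j (P.β (P.Q.π z))) (P.Q.out p) (P.invField σ p) =
      P.N.dirDeriv (b j) (P.β p) (P.atiyah.anchor (P.β p) (σ (P.β p))) := fun j => by
    rw [atiyah_anchor_section]
    exact (QStr.dirDeriv_comp (P.smooth_β.qSmoothAt p) (hb j) _).2
  have e3 : ∀ j, P.Q.M.dirDeriv (fun z => a j (P.β (P.Q.π z))) (P.Q.out p) (P.invField τ p) =
      P.N.dirDeriv (a j) (P.β p) (P.atiyah.anchor (P.β p) (τ (P.β p))) := fun j => by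
    rw [atiyah_anchor_section]
    exact (QStr.dirDeriv_comp (P.smooth_β.qSmoothAt p) (ha j) _).2
  simp only [e1, e2, e3]

theorem Hom.atiyah_section (F : P ⟶ P') (σ : ∀ x, P.AtiyahFib x) (p : P.P) :
    Hom.atiyah F (P.β p) (σ (P.β p)) =
      fibLinearEquiv (F.comm p) (tmapAt P.Q P'.Q F.F p (P.invField σ p)) := by
  rw [← fibEquiv_invField σ p]
  rfl

theorem Hom.atiyah_add (F : P ⟶ P') {x : P.N} (v w : P.AtiyahFib x) :
    Hom.atiyah F x (v + w) = Hom.atiyah F x v + Hom.atiyah F x w := by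
  obtain ⟨p, rfl⟩ := P.surjective_β x
  obtain ⟨v, rfl⟩ := (fibLinearEquiv (rfl : P.β p = P.β p)).surjective v
  obtain ⟨w, rfl⟩ := (fibLinearEquiv (rfl : P.β p = P.β p)).surjective w
  rw [← map_add]
  refine (congrArg (fibLinearEquiv (F.comm p)) (map_add (tmapAt P.Q P'.Q F.F p) v w)).trans ?_
  exact map_add (fibLinearEquiv (F.comm p)) _ _

theorem Hom.atiyah_smul (F : P ⟶ P') {x : P.N} (r : ℝ) (v : P.AtiyahFib x) :
    Hom.atiyah F x (r • v) = r • Hom.atiyah F x v := by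
  obtain ⟨p, rfl⟩ := P.surjective_β x
  obtain ⟨v, rfl⟩ := (fibLinearEquiv (rfl : P.β p = P.β p)).surjective v
  rw [← map_smul]
  refine (congrArg (fibLinearEquiv (F.comm p)) (map_smul (tmapAt P.Q P'.Q F.F p) r v)).trans ?_
  exact map_smul (fibLinearEquiv (F.comm p)) _ _

/-- The anchor condition is the chain rule for `β' ∘ F = f ∘ β`. The bracket condition is
`tmapAt_invField_bracket` read in the fibre through the linear identification at `F p`. -/
theorem Hom.atiyah_isHom (F : P ⟶ P') : P.atiyah.IsHom P'.atiyah F.f (Hom.atiyah F) where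
  smooth_base := F.smooth_f
  map_add _ v w := Hom.atiyah_add F v w
  map_smul _ r v := Hom.atiyah_smul F r v
  smooth T c t h := by
    obtain ⟨ĉ, hs, hc⟩ := atiyah_isSmoothAt_iff.1 h
    refine atiyah_isSmoothAt_iff.2 ⟨fun z => tmap P.Q P'.Q F.F (ĉ z),
      QSmoothAt.comp (F.smooth_F.tmap.qSmoothAt _) hs, ?_⟩
    filter_upwards [hc] with z hz
    exact congrArg (Hom.atiyahTotal F) hz
  anchor x ξ := by
    obtain ⟨p, rfl⟩ := P.surjective_β x
    obtain ⟨v, rfl⟩ := (fibEquiv (rfl : P.β p = P.β p)).surjective ξ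
    refine QStr.TB.eq_of_mk_eq (Q := P'.N.toQ) ?_
    refine (atiyah_mk_anchor (P := P') _).trans ?_
    have h1 : tmap P'.Q P'.N.toQ P'.β (tmap P.Q P'.Q F.F ⟨p, v⟩) =
        tmap P.N.toQ P'.N.toQ F.f (tmap P.Q P.N.toQ P.β ⟨p, v⟩) := by
      refine (tmap_comp P'.smooth_β F.smooth_F _).symm.trans ?_
      refine Eq.trans ?_ (tmap_comp F.smooth_f.qSmooth P.smooth_β _)
      simp only [F.comm]
    exact h1.trans (tmap_toQ_toQ (F.smooth_f.smoothNear _) _)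
  bracket W σ τ k l a b A B hW hσ hτ ha hb hA hB hσA hτB x hx := by
    obtain ⟨p, rfl⟩ := P.surjective_β x
    -- A decomposition over `W` is pulled back to the points of `P` above `W`, where an equation of
    -- classes over `F q` is an equation of vectors at `F q`.
    have key : ∀ {n : ℕ} {ρ : ∀ x, P.AtiyahFib x} {a : Fin n → P.N → ℝ} {A : Fin n → ∀ y, P'.AtiyahFib y},
        (∀ x ∈ W, Hom.atiyah F x (ρ x) = ∑ i, a i x • A i (F.f x)) → ∀ᶠ x in P.Q.nhd p,
          tmapAt P.Q P'.Q F.F x (P.invField ρ x) = ∑ i, a i (P.β x) • P'.invField (A i) (F.F x) := by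
      intro n ρ a A h
      filter_upwards [(P.smooth_β.qSmoothAt p).eventually_mem (hW.mem_nhds hx)] with q hq
      apply (fibLinearEquiv (F.comm q)).injective
      rw [← Hom.atiyah_section, h _ hq, map_sum]
      refine Finset.sum_congr rfl fun i _ => ?_
      rw [map_smul, fibLinearEquiv_apply, fibEquiv_invField_of_eq]
    have h := tmapAt_invField_bracket F hσ hτ
      (fun i => ((ha i).contMDiffAt (hW.mem_nhds hx)).mdifferentiableAt (by simp))
      (fun j => ((hb j).contMDiffAt (hW.mem_nhds hx)).mdifferentiableAt (by simp)) hA hB (key hσA) (key hτB)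
    refine (Hom.atiyah_section F (P.atiyah.bracket σ τ) p).trans ?_
    have hAF : ∀ A : ∀ y, P'.AtiyahFib y, fibLinearEquiv (F.comm p) (P'.invField A (F.F p)) = A (F.f (P.β p)) :=
      fun A => fibEquiv_invField_of_eq A (F.comm p)
    rw [h]
    simp only [map_sub, map_add, map_sum, map_smul]
    exact congrArg₂ (· - ·) (congrArg₂ (· + ·)
      (Finset.sum_congr rfl fun i _ => Finset.sum_congr rfl fun j _ => congrArg (_ • ·) (hAF _))
      (Finset.sum_congr rfl fun j _ => congrArg (_ • ·) (hAF _)))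
      (Finset.sum_congr rfl fun i _ => congrArg (_ • ·) (hAF _))

theorem atiyah_anchor_smoothNear {T : SmoothMfd.{u}} {c : T → Σ x, P.AtiyahFib x} {t : T}
    (h : P.atiyah.IsSmoothAt c t) : SmoothNear T P.N.tangent
      (fun z => (⟨(c z).1, P.atiyah.anchor (c z).1 (c z).2⟩ : TangentBundle P.N.I P.N)) t := by
  obtain ⟨ĉ, hs, hc⟩ := atiyah_isSmoothAt_iff.1 h
  refine (QSmoothAt.toQ_tangent (QSmoothAt.comp (P.smooth_β.tmap.qSmoothAt _) hs)).congr ?_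
  filter_upwards [hc] with z hz
  have h3 := (atiyah_mk_anchor (c z).2).trans (congrArg Atiyah.anchor hz)
  exact congrArg (fun w : P.N.toQ.TB => (⟨w.1, w.2⟩ : TangentBundle P.N.I P.N)) h3

theorem atiyah_anchor_isSmoothField {σ : ∀ x, P.AtiyahFib x} (hσ : P.atiyah.IsSmoothSection σ) :
    P.N.toQ.IsSmoothField (fun x => P.atiyah.anchor x (σ x)) :=
  QStr.isSmoothField_of_lift (Q := P.N.toQ) (V := fun x => P.atiyah.anchor x (σ x))
    (fun x => (atiyah_anchor_smoothNear (hσ x)).self_of_nhds) fun x => SmoothMfd.vec_toQ x _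

/-- By `ext_invField` the identities for the bracket need only be checked for invariant fields on
`P`, where they are those of the bracket on a Q-manifold. -/
theorem atiyah_isLieAlgebroid (P : PrincipalQBundle.{u}) : P.atiyah.IsLieAlgebroid where
  isVectorBundle := atiyah_isVectorBundle
  anchor_add _ v w := atiyah_anchor_add v w
  anchor_smul _ r v := atiyah_anchor_smul r v
  anchor_smooth T c t h := by
    obtain ⟨W, hW, ht, hs, -⟩ := (atiyah_anchor_smoothNear h).exists_isOpen (p := fun _ => True)
      (Filter.Eventually.of_forall fun _ => trivial)
    exact ⟨W, hW, ht, hs⟩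
  bracket_smooth σ τ hσ hτ := atiyah_bracket_smooth hσ hτ
  bracket_add σ τ ρ hσ hτ hρ := by
    refine ext_invField ?_
    refine (invField_bracket hσ (atiyah_isSmoothSection_add hτ hρ)).trans ?_
    refine Eq.trans ?_ (invField_add _ _).symm
    funext p
    rw [invField_bracket hσ hτ, invField_bracket hσ hρ]
    refine Eq.trans ?_ (QStr.lieBracket_add (atiyah_isSmoothSection_iff.1 hτ) (atiyah_isSmoothSection_iff.1 hρ) p)
    exact congrArg (fun X => P.Q.lieBracket (P.invField σ) X p) (invField_add τ ρ)
  bracket_self σ hσ := by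
    refine ext_invField ?_
    refine (invField_bracket hσ hσ).trans ?_
    funext p
    exact (QStr.lieBracket_self _ p).trans ((invField_eq_symm (P := P) 0 p).trans
      (map_zero (fibLinearEquiv (rfl : P.β p = P.β p)).symm)).symm
  bracket_skew σ τ hσ hτ := by
    refine ext_invField ?_
    refine (invField_bracket hσ hτ).trans ?_
    refine Eq.trans ?_ (invField_neg _).symm
    funext p
    rw [invField_bracket hτ hσ]
    exact QStr.lieBracket_swap _ _ p
  jacobi σ τ ρ hσ hτ hρ := by
    refine ext_invField ?_
    refine (invField_bracket hσ (atiyah_bracket_smooth hτ hρ)).trans ?_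
    refine Eq.trans ?_ (invField_add _ _).symm
    funext p
    rw [invField_bracket (atiyah_bracket_smooth hσ hτ) hρ, invField_bracket hτ (atiyah_bracket_smooth hσ hρ),
      invField_bracket hτ hρ, invField_bracket hσ hτ, invField_bracket hσ hρ]
    exact QStr.lieBracket_jacobi (atiyah_isSmoothSection_iff.1 hσ) (atiyah_isSmoothSection_iff.1 hτ)
      (atiyah_isSmoothSection_iff.1 hρ) p
  leibniz f σ τ hf hσ hτ x := by
    have hid : ∀ x (v : P.AtiyahFib x), Hom.atiyah (𝟙 P) x v = v := fun x v => by
      obtain ⟨p, rfl⟩ := P.surjective_β x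
      obtain ⟨v, rfl⟩ := (fibEquiv (rfl : P.β p = P.β p)).surjective v
      exact Subtype.ext (congrArg Atiyah.mk (tmap_id P.Q ⟨p, v⟩))
    -- The Leibniz rule is the bracket condition for the identity morphism, with `σ` decomposed with
    -- coefficient `1` and `f τ` with coefficient `f`.
    have h := (Hom.atiyah_isHom (𝟙 P)).bracket Set.univ σ (fun y => f y • τ y) 1 1 (fun _ _ => 1) (fun _ => f)
      (fun _ => σ) (fun _ => τ) isOpen_univ hσ (atiyah_isSmoothSection_smul hf hτ)
      (fun _ => contMDiffOn_const) (fun _ => hf.contMDiffOn) (fun _ => hσ) (fun _ => hτ)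
      (fun x _ => by rw [Fin.sum_univ_one, one_smul]; exact hid x _)
      (fun x _ => by rw [Fin.sum_univ_one]; exact hid x _) x trivial
    simp only [Fin.sum_univ_one, one_mul] at h
    have hd : ∀ v, P.N.dirDeriv (fun _ => (1 : ℝ)) x v = 0 := fun v =>
      congrArg (fun L : P.N.E →L[ℝ] ℝ => L v) (mfderiv_const (c := (1 : ℝ)) (x := x) (I := P.N.I))
    rw [hd, zero_smul, sub_zero] at h
    exact (hid x _).symm.trans h
  anchor_bracket σ τ hσ hτ x := by
    obtain ⟨p, rfl⟩ := P.surjective_β x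
    -- An invariant field is `β`-related to the anchor of its section, so `Tβ` carries the bracket
    -- to the bracket of the anchors.
    have h := QStr.tmapAt_lieBracket_of_related (P.smooth_β.qSmoothAt p) (atiyah_isSmoothSection_iff.1 hσ)
      (atiyah_isSmoothSection_iff.1 hτ) (atiyah_anchor_isSmoothField hσ) (atiyah_anchor_isSmoothField hτ)
      (Filter.Eventually.of_forall fun q => (atiyah_anchor_section σ q).symm)
      (Filter.Eventually.of_forall fun q => (atiyah_anchor_section τ q).symm)
    rw [SmoothMfd.lieBracket_toQ] at h
    refine (atiyah_anchor_section _ p).trans ?_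
    rw [invField_bracket hσ hτ]
    exact h

end PrincipalQBundle

/-! ### Isomorphisms of Lie algebroid data -/

namespace LieAlgebroidData
variable {M : SmoothMfd.{u}}

/-- A family of linear isomorphisms that identifies the data of two Lie algebroids. -/
structure IsStrictIso (D₁ D₂ : LieAlgebroidData M) (φ : ∀ x, D₁.Fib x ≃ₗ[ℝ] D₂.Fib x) : Prop where
  smooth_iff : ∀ {T : SmoothMfd.{u}} (c : T → Σ x, D₁.Fib x) (t : T), D₁.IsSmoothAt c t ↔
    D₂.IsSmoothAt (fun z => ⟨(c z).1, φ (c z).1 (c z).2⟩) t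
  anchor : ∀ x v, D₂.anchor x (φ x v) = D₁.anchor x v
  bracket : ∀ σ τ, D₁.IsSmoothSection σ → D₁.IsSmoothSection τ → ∀ x,
    φ x (D₁.bracket σ τ x) = D₂.bracket (fun y => φ y (σ y)) (fun y => φ y (τ y)) x

namespace IsStrictIso
variable {D₁ D₂ : LieAlgebroidData M} {φ : ∀ x, D₁.Fib x ≃ₗ[ℝ] D₂.Fib x}

theorem refl (D : LieAlgebroidData M) : IsStrictIso D D (fun _ => LinearEquiv.refl ℝ _) :=
  ⟨fun _ _ => Iff.rfl, fun _ _ => rfl, fun _ _ _ _ _ => rfl⟩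

theorem smooth_symm_iff (h : IsStrictIso D₁ D₂ φ) {T : SmoothMfd.{u}} (c : T → Σ x, D₂.Fib x) (t : T) :
    D₂.IsSmoothAt c t ↔ D₁.IsSmoothAt (fun z => ⟨(c z).1, (φ (c z).1).symm (c z).2⟩) t := by
  rw [h.smooth_iff]
  simp only [LinearEquiv.apply_symm_apply]

theorem section_iff (h : IsStrictIso D₁ D₂ φ) (σ : ∀ x, D₁.Fib x) :
    D₁.IsSmoothSection σ ↔ D₂.IsSmoothSection (fun x => φ x (σ x)) :=
  forall_congr' fun _ => h.smooth_iff _ _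

theorem symm (h : IsStrictIso D₁ D₂ φ) : IsStrictIso D₂ D₁ (fun x => (φ x).symm) := by
  refine ⟨fun c t => h.smooth_symm_iff c t, fun x v => ?_, fun σ τ hσ hτ x => ?_⟩
  · rw [← h.anchor, LinearEquiv.apply_symm_apply]
  · have h1 := h.bracket (fun x => (φ x).symm (σ x)) (fun x => (φ x).symm (τ x))
      ((h.section_iff _).2 (by simpa only [LinearEquiv.apply_symm_apply] using hσ))
      ((h.section_iff _).2 (by simpa only [LinearEquiv.apply_symm_apply] using hτ)) x
    simp only [LinearEquiv.apply_symm_apply] at h1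
    rw [← h1, LinearEquiv.symm_apply_apply]

theorem exists_section (h : IsStrictIso D₁ D₂ φ) {σ : ∀ x, D₂.Fib x} (hσ : D₂.IsSmoothSection σ) :
    ∃ σ' : ∀ x, D₁.Fib x, D₁.IsSmoothSection σ' ∧ σ = fun x => φ x (σ' x) :=
  ⟨fun x => (φ x).symm (σ x), (h.symm.section_iff σ).1 hσ, by simp only [LinearEquiv.apply_symm_apply]⟩

theorem bracket_eq (h : IsStrictIso D₁ D₂ φ) {σ τ : ∀ x, D₁.Fib x} (hσ : D₁.IsSmoothSection σ)
    (hτ : D₁.IsSmoothSection τ) :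
    D₂.bracket (fun y => φ y (σ y)) (fun y => φ y (τ y)) = fun x => φ x (D₁.bracket σ τ x) :=
  funext fun x => (h.bracket σ τ hσ hτ x).symm

theorem isVectorBundle (h : IsStrictIso D₁ D₂ φ) (hD : D₁.IsVectorBundle) : D₂.IsVectorBundle := by
  obtain ⟨F, i₁, i₂, i₃, hF⟩ := hD
  refine ⟨F, i₁, i₂, i₃, fun x => ?_⟩
  obtain ⟨U, e, hx, he⟩ := hF x
  refine ⟨U, fun x => e x ∘ₗ (φ x).symm.toLinearMap, hx, he.isOpen,
    fun y hy => (he.bijective y hy).comp (φ y).symm.bijective, fun T c t ht => ?_⟩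
  exact (h.smooth_symm_iff c t).trans (he.smooth_iff T _ t ht)

/-- Additivity and the Leibniz rule involve the brackets of `σ` with `τ + ρ` and `f τ`, which can be
transported only for smooth sections. Closure under sums and multiples is not a field of the
structure and so enters as the hypotheses `hadd` and `hsmul`. -/
theorem isLieAlgebroid (h : IsStrictIso D₁ D₂ φ) (hD : D₁.IsLieAlgebroid)
    (hadd : ∀ σ τ, D₁.IsSmoothSection σ → D₁.IsSmoothSection τ → D₁.IsSmoothSection (σ + τ))
    (hsmul : ∀ (f : M → ℝ) σ, ContMDiff M.I 𝓘(ℝ, ℝ) ∞ f → D₁.IsSmoothSection σ →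
      D₁.IsSmoothSection (fun x => f x • σ x)) : D₂.IsLieAlgebroid where
  isVectorBundle := h.isVectorBundle hD.isVectorBundle
  anchor_add x v w := by
    simp only [← h.symm.anchor, map_add, hD.anchor_add]
  anchor_smul x r v := by
    simp only [← h.symm.anchor, map_smul, hD.anchor_smul]
  anchor_smooth T c t hc := by
    have := hD.anchor_smooth T _ t ((h.smooth_symm_iff c t).1 hc)
    simpa only [h.symm.anchor] using this
  bracket_smooth σ τ hσ hτ := by
    obtain ⟨σ, hσ', rfl⟩ := h.exists_section hσ
    obtain ⟨τ, hτ', rfl⟩ := h.exists_section hτ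
    rw [h.bracket_eq hσ' hτ']
    exact (h.section_iff _).1 (hD.bracket_smooth σ τ hσ' hτ')
  bracket_add σ τ ρ hσ hτ hρ := by
    obtain ⟨σ, hσ', rfl⟩ := h.exists_section hσ
    obtain ⟨τ, hτ', rfl⟩ := h.exists_section hτ
    obtain ⟨ρ, hρ', rfl⟩ := h.exists_section hρ
    have e : ((fun x => φ x (τ x)) + fun x => φ x (ρ x)) = fun x => φ x ((τ + ρ) x) :=
      funext fun x => (map_add (φ x) _ _).symm
    rw [e, h.bracket_eq hσ' (hadd τ ρ hτ' hρ'), h.bracket_eq hσ' hτ', h.bracket_eq hσ' hρ',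
      hD.bracket_add σ τ ρ hσ' hτ' hρ']
    exact funext fun x => map_add (φ x) _ _
  bracket_self σ hσ := by
    obtain ⟨σ, hσ', rfl⟩ := h.exists_section hσ
    rw [h.bracket_eq hσ' hσ', hD.bracket_self σ hσ']
    exact funext fun x => map_zero (φ x)
  bracket_skew σ τ hσ hτ := by
    obtain ⟨σ, hσ', rfl⟩ := h.exists_section hσ
    obtain ⟨τ, hτ', rfl⟩ := h.exists_section hτ
    rw [h.bracket_eq hσ' hτ', h.bracket_eq hτ' hσ', hD.bracket_skew σ τ hσ' hτ']
    exact funext fun x => map_neg (φ x) _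
  jacobi σ τ ρ hσ hτ hρ := by
    obtain ⟨σ, hσ', rfl⟩ := h.exists_section hσ
    obtain ⟨τ, hτ', rfl⟩ := h.exists_section hτ
    obtain ⟨ρ, hρ', rfl⟩ := h.exists_section hρ
    rw [h.bracket_eq hτ' hρ', h.bracket_eq hσ' hτ', h.bracket_eq hσ' hρ',
      h.bracket_eq hσ' (hD.bracket_smooth _ _ hτ' hρ'), h.bracket_eq (hD.bracket_smooth _ _ hσ' hτ') hρ',
      h.bracket_eq hτ' (hD.bracket_smooth _ _ hσ' hρ'), hD.jacobi σ τ ρ hσ' hτ' hρ']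
    exact funext fun x => map_add (φ x) _ _
  leibniz f σ τ hf hσ hτ x := by
    obtain ⟨σ, hσ', rfl⟩ := h.exists_section hσ
    obtain ⟨τ, hτ', rfl⟩ := h.exists_section hτ
    simp only [← map_smul]
    rw [h.bracket_eq hσ' (hsmul f τ hf hτ'), h.bracket_eq hσ' hτ', h.anchor]
    simp only [hD.leibniz f σ τ hf hσ' hτ' x, map_add, map_smul]
  anchor_bracket σ τ hσ hτ x := by
    obtain ⟨σ, hσ', rfl⟩ := h.exists_section hσ
    obtain ⟨τ, hτ', rfl⟩ := h.exists_section hτ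
    simp only [h.bracket_eq hσ' hτ', h.anchor]
    exact hD.anchor_bracket σ τ hσ' hτ' x

/-- Morphisms of Lie algebroids can be transported along strict isomorphisms. -/
theorem isHom {N : SmoothMfd.{u}} {D₁' D₂' : LieAlgebroidData N} {φ' : ∀ x, D₁'.Fib x ≃ₗ[ℝ] D₂'.Fib x}
    (h : IsStrictIso D₁ D₂ φ) (h' : IsStrictIso D₁' D₂' φ') {f : M → N} {Φ : ∀ x, D₁.Fib x → D₁'.Fib (f x)}
    {Ψ : ∀ x, D₂.Fib x → D₂'.Fib (f x)} (hΦ : D₁.IsHom D₁' f Φ)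
    (e : ∀ x v, Ψ x (φ x v) = φ' (f x) (Φ x v)) : D₂.IsHom D₂' f Ψ := by
  have e' : ∀ x v, Ψ x v = φ' (f x) (Φ x ((φ x).symm v)) := fun x v => by
    rw [← e, LinearEquiv.apply_symm_apply]
  refine ⟨hΦ.smooth_base, fun x v w => ?_, fun x r v => ?_, fun T c t hc => ?_, fun x v => ?_, ?_⟩
  · simp only [e', map_add, hΦ.map_add]
  · simp only [e', map_smul, hΦ.map_smul]
  · simp only [e']
    exact (h'.smooth_iff _ t).1 (hΦ.smooth T _ t ((h.smooth_symm_iff c t).1 hc))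
  · rw [e', h'.anchor, hΦ.anchor, h.symm.anchor]
  · intro W σ τ k l a b A B hW hσ hτ ha hb hA hB hσA hτB x hx
    obtain ⟨σ, hσ', rfl⟩ := h.exists_section hσ
    obtain ⟨τ, hτ', rfl⟩ := h.exists_section hτ
    choose A' hA' hAA using fun i => h'.exists_section (hA i)
    choose B' hB' hBB using fun i => h'.exists_section (hB i)
    obtain rfl : A = fun i y => φ' y (A' i y) := funext hAA
    obtain rfl : B = fun i y => φ' y (B' i y) := funext hBB
    have h1 := hΦ.bracket W σ τ k l a b A' B' hW hσ' hτ' ha hb hA' hB'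
      (fun x hx => (φ' (f x)).injective (by
        rw [← e, hσA x hx, map_sum]
        simp only [map_smul]))
      (fun x hx => (φ' (f x)).injective (by
        rw [← e, hτB x hx, map_sum]
        simp only [map_smul])) x hx
    have h2 : ∀ i j, D₂'.bracket (fun y => φ' y (A' i y)) (fun y => φ' y (B' j y)) =
        fun y => φ' y (D₁'.bracket (A' i) (B' j) y) := fun i j => h'.bracket_eq (hA' i) (hB' j)
    simp only [h.bracket_eq hσ' hτ', e, h1, map_add, map_sub, map_sum, map_smul, h2, h.anchor]

theorem isIso (h : IsStrictIso D₁ D₂ φ) (hid : D₁.IsHom D₁ (fun x => x) (fun _ v => v)) :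
    D₁.IsIso D₂ (fun x v => φ x v) :=
  ⟨(refl D₁).isHom h hid fun _ _ => rfl, fun x v => (φ x).symm v,
    h.isHom (refl D₁) hid fun x v => (φ x).symm_apply_apply v,
    fun x v => (φ x).symm_apply_apply v, fun x v => (φ x).apply_symm_apply v⟩

end IsStrictIso
end LieAlgebroidData

/-! ### The Ehresmann map -/

section
variable {S : Type u} {Q : QStr S}

theorem QStr.TB.vecAt_add {a b : S} (h : a = b) (v w : Q.TSpace a) :
    QStr.TB.vecAt (Q := Q) ⟨a, v + w⟩ h = QStr.TB.vecAt (Q := Q) ⟨a, v⟩ h + QStr.TB.vecAt (Q := Q) ⟨a, w⟩ h := by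
  subst h; rfl

theorem QStr.TB.vecAt_smul {a b : S} (h : a = b) (r : ℝ) (v : Q.TSpace a) :
    QStr.TB.vecAt (Q := Q) ⟨a, r • v⟩ h = r • QStr.TB.vecAt (Q := Q) ⟨a, v⟩ h := by
  subst h; rfl

end

namespace PrincipalQBundle
variable {P P' : PrincipalQBundle.{u}} {R : QStr P.Gauge}

/-- The tangent map of `p' ↦ [p', q]`. -/
noncomputable def mkTangent (R : QStr P.Gauge) (q : P.P) (w : P.Q.TB) : R.TB :=
  tmap P.Q R (fun p' => Gauge.mk p' q) w

theorem mkTangent_tact (hR : P.IsGaugeStr R) (q : P.P) (w : P.Q.TB) (g : P.G) :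
    mkTangent R (P.act q g) (P.tact w g) = mkTangent R q w := by
  have h := tmap_comp (hR.smooth_mk (P.act q g)) (P.qSmooth_act g) w
  simp only [Gauge.mk_act] at h
  exact h.symm

/-- If `τ` passes through `q`, then `rho τ` is a left inverse of `p' ↦ [p', q]`; the chain rule
gives the statement. -/
theorem tmap_rho_mkTangent (hR : P.IsGaugeStr R) {τ : P.N → P.P} {q : P.P} (hτ : IsLocalSection τ (P.β q))
    (hq : τ (P.β q) = q) (w : P.Q.TB) : tmap R P.Q (rho τ) (mkTangent R q w) = w := by
  have h := tmap_comp_of_qSmoothAt (f := fun p' => Gauge.mk p' q) (w := w)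
    (hR.qSmoothAt_rho (a := Gauge.mk w.1 q) hτ) ((hR.smooth_mk q).qSmoothAt _)
  refine h.symm.trans ?_
  simp only [rho_mk_of_eq hq]
  exact tmap_id _ _

theorem mkTangent_injective (hR : P.IsGaugeStr R) (q : P.P) : Function.Injective (mkTangent R q) := by
  obtain ⟨τ, hτ, hq⟩ := exists_localSection q
  intro w w' h
  rw [← tmap_rho_mkTangent hR hτ hq w, h, tmap_rho_mkTangent hR hτ hq]

theorem tmap_gaugeS_mkTangent (hR : P.IsGaugeStr R) (q : P.P) (w : P.Q.TB) :
    tmap R P.N.toQ gaugeS (mkTangent R q w) = ⟨P.β q, 0⟩ := by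
  refine (tmap_comp hR.qSmooth_gaugeS (hR.smooth_mk q) w).symm.trans ?_
  exact Sigma.ext rfl (heq_of_eq (congrArg (fun L => L w.2) (tmapAt_const P.Q P.N.toQ (P.β q) w.1)))

theorem tmap_gaugeT_mkTangent (hR : P.IsGaugeStr R) (q : P.P) (w : P.Q.TB) :
    tmap R P.N.toQ gaugeT (mkTangent R q w) = tmap P.Q P.N.toQ P.β w :=
  (tmap_comp hR.qSmooth_gaugeT (hR.smooth_mk q) w).symm

theorem qSmooth_mkTangent (hR : P.IsGaugeStr R) :
    QSmooth (P.Q.tangent.prod P.Q) R.tangent (fun x => mkTangent R x.2 x.1) :=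
  qSmooth_iff.2 fun x => qSmoothAt_tmap_left (A := fun y => Gauge.mk y.1 y.2) (x := x) (hR.1.qSmoothAt _)

theorem tmap_of_zero {S S' : Type u} {Q : QStr S} {Q' : QStr S'} (f : S → S') (s : S) :
    tmap Q Q' f ⟨s, 0⟩ = ⟨f s, 0⟩ := Sigma.ext rfl (heq_of_eq (map_zero _))

/-- Vectors tangent to a source fibre come from `P`. -/
theorem mkTangent_tmap_rho (hR : P.IsGaugeStr R) {τ : P.N → P.P} {w : R.TB}
    (hτ : IsLocalSection τ (gaugeS w.1)) (hw : tmap R P.N.toQ gaugeS w = ⟨gaugeS w.1, 0⟩) :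
    mkTangent R (τ (gaugeS w.1)) (tmap R P.Q (rho τ) w) = w := by
  have hs := hR.qSmooth_gaugeS.qSmoothAt w.1
  have hρ := hR.qSmoothAt_rho hτ
  have hτs : QSmoothAt R P.Q (fun a => τ (gaugeS a)) w.1 := QSmoothAt.comp hτ.smooth hs
  have hc : QSmoothAt R P.Q (fun _ => τ (gaugeS w.1)) w.1 := (qSmooth_const _ _ _).qSmoothAt _
  -- Since `Ts` kills `w`, the map `τ ∘ s` has the same tangent vector as a constant map. In the
  -- factorization `a = [rho τ a, τ (s a)]` only the first entry then contributes.
  have h1 : tmap R P.Q (fun a => τ (gaugeS a)) w = tmap R P.Q (fun _ => τ (gaugeS w.1)) w := by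
    refine (tmap_comp_of_qSmoothAt (f' := τ) hτ.smooth hs).trans ?_
    rw [hw]
    refine (tmap_of_zero τ (gaugeS w.1)).trans ?_
    exact Sigma.ext rfl (heq_of_eq (congrArg (fun L => L w.2) (tmapAt_const R P.Q (τ (gaugeS w.1)) w.1)).symm)
  have h2 := tmap_prodMk_congr hρ hτs hc h1
  have h3 := congrArg (tmap (P.Q.prod P.Q) R (fun x => Gauge.mk x.1 x.2)) h2
  have h4 : tmap (P.Q.prod P.Q) R (fun x => Gauge.mk x.1 x.2)
      (tmap R (P.Q.prod P.Q) (fun a => (rho τ a, τ (gaugeS a))) w) = w := by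
    refine (tmap_comp_of_qSmoothAt (f := fun a => (rho τ a, τ (gaugeS a))) (hR.1.qSmoothAt _)
      (hρ.prodMk hτs)).symm.trans ?_
    refine (tmap_congr ((qSmooth_id R).qSmoothAt w.1) ?_).trans (tmap_id R w)
    filter_upwards [hs.eventually_mem hτ.right] with a ha
    exact mk_rho ha
  have h5 : tmap (P.Q.prod P.Q) R (fun x => Gauge.mk x.1 x.2)
      (tmap R (P.Q.prod P.Q) (fun a => (rho τ a, τ (gaugeS w.1))) w) =
      mkTangent R (τ (gaugeS w.1)) (tmap R P.Q (rho τ) w) := by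
    refine (tmap_comp_of_qSmoothAt (f := fun a => (rho τ a, τ (gaugeS w.1))) (hR.1.qSmoothAt _)
      (hρ.prodMk hc)).symm.trans ?_
    exact tmap_comp_of_qSmoothAt (f := rho τ) ((hR.smooth_mk _).qSmoothAt _) hρ
  exact h5.symm.trans (h3.symm.trans h4)

theorem ehrTotal_mk (hR : P.IsGaugeStr R) (w : P.Q.TB) : ehrTotal hR (Atiyah.mk w) = mkTangent R w.1 w := rfl

theorem mk_ehr (hR : P.IsGaugeStr R) {x : P.N} (ξ : P.AtiyahFib x) :
    (⟨P.gauge.one x, (ehr hR x ξ).1⟩ : R.TB) = ehrTotal hR ξ.1 :=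
  QStr.TB.mk_vecAt _ _

theorem ehr_fibEquiv (hR : P.IsGaugeStr R) {p : P.P} (v : P.Q.TSpace p) :
    (ehr hR (P.β p) (fibEquiv rfl v)).1 =
      QStr.TB.vecAt (Q := R) ⟨Gauge.mk p p, tmapAt P.Q R (fun p' => Gauge.mk p' p) p v⟩ (gauge_one_β p).symm := rfl

/-- The Ehresmann map on a fibre, as a linear isomorphism. -/
noncomputable def ehrEquiv (hR : P.IsGaugeStr R) (x : P.N) : P.AtiyahFib x ≃ₗ[ℝ] P.gauge.LieFib R x :=
  LinearEquiv.ofBijective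
    { toFun := ehr hR x
      map_add' := fun v w => by
        obtain ⟨p, rfl⟩ := P.surjective_β x
        obtain ⟨v, rfl⟩ := (fibLinearEquiv (rfl : P.β p = P.β p)).surjective v
        obtain ⟨w, rfl⟩ := (fibLinearEquiv (rfl : P.β p = P.β p)).surjective w
        rw [← map_add]
        refine Subtype.ext ?_
        refine (ehr_fibEquiv hR (v + w)).trans ?_
        rw [map_add]
        exact QStr.TB.vecAt_add _ _ _
      map_smul' := fun r v => by
        obtain ⟨p, rfl⟩ := P.surjective_β x
        obtain ⟨v, rfl⟩ := (fibLinearEquiv (rfl : P.β p = P.β p)).surjective v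
        rw [← map_smul]
        refine Subtype.ext ?_
        refine (ehr_fibEquiv hR (r • v)).trans ?_
        rw [map_smul]
        exact QStr.TB.vecAt_smul _ _ _ }
    (by
      obtain ⟨p, rfl⟩ := P.surjective_β x
      constructor
      · intro ξ ξ' h
        have h' : ehr hR (P.β p) ξ = ehr hR (P.β p) ξ' := h
        obtain ⟨v, rfl⟩ := (fibEquiv (rfl : P.β p = P.β p)).surjective ξ
        obtain ⟨v', rfl⟩ := (fibEquiv (rfl : P.β p = P.β p)).surjective ξ'
        have h1 := (mk_ehr hR (fibEquiv rfl v)).symm.trans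
          ((congrArg (fun u : P.gauge.LieFib R (P.β p) => (⟨P.gauge.one (P.β p), u.1⟩ : R.TB)) h').trans
            (mk_ehr hR (fibEquiv rfl v')))
        have h2 : (⟨p, v⟩ : P.Q.TB) = ⟨p, v'⟩ := mkTangent_injective hR p h1
        exact congrArg (fibEquiv rfl) (QStr.TB.eq_of_mk_eq h2)
      · rintro ⟨u, hu⟩
        obtain ⟨τ, hτ, hp⟩ := exists_localSection p
        generalize hw : (⟨P.gauge.one (P.β p), u⟩ : R.TB) = w
        have hw1 : w.1 = Gauge.mk p p := by rw [← hw]; exact gauge_one_β p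
        have hs : gaugeS w.1 = P.β p := congrArg gaugeS hw1
        have hw2 : tmap R P.N.toQ gaugeS w = ⟨gaugeS w.1, 0⟩ := by
          rw [← hw]
          exact Sigma.ext rfl (heq_of_eq hu)
        -- The preimage of `u` is the class of its image under the tangent map of `rho τ`, a vector
        -- at `τ (β p) = p`.
        have h1 := mkTangent_tmap_rho hR (w := w) (hs ▸ hτ) hw2
        rw [hs, hp] at h1
        generalize hw' : tmap R P.Q (rho τ) w = w' at h1
        have hw3 : w'.1 = p := by
          rw [← hw']
          refine (congrArg (rho τ) hw1).trans (rho_mk_of_eq hp)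
        obtain ⟨p', v⟩ := w'
        obtain rfl : p' = p := hw3
        refine ⟨fibEquiv rfl v, Subtype.ext ?_⟩
        refine QStr.TB.eq_of_mk_eq ((mk_ehr hR (fibEquiv rfl v)).trans ?_)
        exact h1.trans hw.symm)

theorem tmap_rho_ehrTotal (hR : P.IsGaugeStr R) {τ : P.N → P.P} {ξ : P.Atiyah} (hτ : IsLocalSection τ ξ.base) :
    tmap R P.Q (rho τ) (ehrTotal hR ξ) = liftAt (τ ξ.base) ξ := by
  obtain ⟨w, hw, rfl⟩ := Atiyah.exists_rep (ξ := ξ) (p := τ ξ.base) hτ.self.symm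
  rw [liftAt_mk hw]
  have hb : (Atiyah.mk w).base = P.β w.1 := rfl
  rw [hb] at hw hτ
  exact tmap_rho_mkTangent hR hτ hw.symm w

/-! #### Right-invariant vector fields -/

open Classical in
/-- The right-invariant vector field on the gauge groupoid that corresponds to an invariant vector field on `P`. -/
noncomputable def rightField (R : QStr P.Gauge) (σ : ∀ x, P.AtiyahFib x) (a : P.Gauge) : R.TSpace a :=
  QStr.TB.vecAt (mkTangent R (Gauge.ind' P a).choose_spec.choose (P.invVec σ (Gauge.ind' P a).choose))
    (Gauge.ind' P a).choose_spec.choose_spec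

/-- The value does not depend on the representative: moving `(p, q)` by `g` moves the vector of the
invariant field by `g`, and `[p'g, qg] = [p', q]`. -/
theorem mk_rightField (hR : P.IsGaugeStr R) (σ : ∀ x, P.AtiyahFib x) (p q : P.P) :
    (⟨Gauge.mk p q, rightField R σ (Gauge.mk p q)⟩ : R.TB) = mkTangent R q (P.invVec σ p) := by
  refine (QStr.TB.mk_vecAt _ _).trans ?_
  have h := (Gauge.ind' P (Gauge.mk p q)).choose_spec.choose_spec
  obtain ⟨g, h1, h2⟩ := Gauge.exact P h
  have h3 := mkTangent_tact hR (Gauge.ind' P (Gauge.mk p q)).choose_spec.choose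
    (P.invVec σ (Gauge.ind' P (Gauge.mk p q)).choose) g
  rw [tact_invVec, h1, h2] at h3
  exact h3.symm

theorem isSmoothField_rightField (hR : P.IsGaugeStr R) {σ : ∀ x, P.AtiyahFib x} (hσ : P.atiyah.IsSmoothSection σ) :
    R.IsSmoothField (rightField R σ) := by
  refine IsGaugeStr.qSmooth_of_comp hR (f := fun a => (⟨a, rightField R σ a⟩ : R.TB)) ?_
  simp only [mk_rightField hR]
  exact (qSmooth_mkTangent hR).comp
    (((atiyah_isSmoothSection_iff.1 hσ).comp qSmooth_fst).prodMk qSmooth_snd)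

/-- A map `c` into the source fibre over `β q` is `[rho τ c, q]`, and right translation by `[q, r]`
only replaces `q` by `r`. The vectors of the field come from the first entry, which is untouched. -/
theorem isRightInvariant_rightField (hR : P.IsGaugeStr R) {σ : ∀ x, P.AtiyahFib x}
    (hσ : P.atiyah.IsSmoothSection σ) : P.gauge.IsRightInvariant R (rightField R σ) where
  smooth := isSmoothField_rightField hR hσ
  vertical a := by
    obtain ⟨p, q, rfl⟩ := Gauge.ind' P a
    refine QStr.TB.eq_of_mk_eq (Q := P.N.toQ) ?_
    exact (congrArg (tmap R P.N.toQ gaugeS) (mk_rightField hR σ p q)).trans (tmap_gaugeS_mkTangent hR q _)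
  invariant a T c e hc z w hw := by
    obtain ⟨q, r, rfl⟩ := Gauge.ind' P a
    obtain ⟨τ, hτ, hq⟩ := exists_localSection q
    have he : ∀ z, gaugeS (c z) = P.β q := e
    have h1 : ∀ z, Gauge.mk (rho τ (c z)) q = c z := fun z => by
      have := mk_rho (τ := τ) (a := c z) (by rw [he, hq])
      rwa [he, hq] at this
    have h2 : ∀ z, P.gauge.mul (c z) (Gauge.mk q r) (e z) = Gauge.mk (rho τ (c z)) r := fun z =>
      (gauge_mul_congr (b := Gauge.mk q r) (h1 z).symm rfl (e z)).trans (gauge_mul_mk _ _ _ _)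
    have hρ : QSmoothAt R P.Q (rho τ) (c z) := hR.qSmoothAt_rho (by rw [he]; exact hτ)
    refine QStr.TB.eq_of_mk_eq ?_
    change tmap T.toQ R (fun z => P.gauge.mul (c z) (Gauge.mk q r) (e z)) ⟨z, w⟩ = _
    have h3 : tmap T.toQ R (fun z => Gauge.mk (rho τ (c z)) r) ⟨z, w⟩ =
        mkTangent R r (tmap R P.Q (rho τ) (tmap T.toQ R c ⟨z, w⟩)) := by
      refine (tmap_comp_of_qSmoothAt (f := fun z => rho τ (c z)) (f' := fun p' => Gauge.mk p' r)
        ((hR.smooth_mk r).qSmoothAt _) (QSmoothAt.comp hρ (hc.qSmoothAt z))).trans ?_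
      exact congrArg (mkTangent R r) (tmap_comp_of_qSmoothAt (f := c) hρ (hc.qSmoothAt z))
    have h4 : tmap T.toQ R c ⟨z, w⟩ = mkTangent R q (P.invVec σ (rho τ (c z))) := by
      refine (congrArg (Sigma.mk (c z)) hw).trans ?_
      refine (QStr.TB.mk_apply (Q := R) (rightField R σ) (h1 z).symm).trans ?_
      exact mk_rightField hR σ _ _
    rw [h4, tmap_rho_mkTangent hR hτ hq] at h3
    refine (congrArg (fun f => tmap T.toQ R f ⟨z, w⟩) (funext h2)).trans (h3.trans ?_)
    exact (mk_rightField hR σ _ r).symm.trans (QStr.TB.mk_apply (Q := R) (rightField R σ) (h2 z)).symm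

theorem mk_rightField_one (hR : P.IsGaugeStr R) (σ : ∀ x, P.AtiyahFib x) (x : P.N) :
    (⟨P.gauge.one x, rightField R σ (P.gauge.one x)⟩ : R.TB) = ehrTotal hR (σ x).1 := by
  obtain ⟨p, rfl⟩ := P.surjective_β x
  rw [← mk_invVec]
  refine (QStr.TB.mk_apply (Q := R) (rightField R σ) (gauge_one_β p)).trans ?_
  exact mk_rightField hR σ p p

/-- Uniqueness of the right-invariant extension: since `[p, q] = [p, p][p, q]`, the value at `[p,
q]` is the right translate of the value at the unit `[p, p]`. -/
theorem mk_of_isRightInvariant (hR : P.IsGaugeStr R) {σ : ∀ x, P.AtiyahFib x} {X : ∀ a, R.TSpace a}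
    (hX : P.gauge.IsRightInvariant R X)
    (h : ∀ x, X (P.gauge.one x) = (ehr hR x (σ x)).1) (p q : P.P) :
    (⟨Gauge.mk p q, X (Gauge.mk p q)⟩ : R.TB) = mkTangent R q (P.invVec σ p) := by
  obtain ⟨m, rfl⟩ : ∃ m, P.Q.π m = p := ⟨_, P.Q.π_out p⟩
  let p := P.Q.π m
  -- Invariance is tested on maps from manifolds into the source fibre; the atlas of `P`, followed
  -- by `p' ↦ [p', p]`, is such a map and represents the required vector.
  have hc : QSmooth P.Q.M.toQ R (fun z => Gauge.mk (P.Q.π z) p) := (hR.smooth_mk p).comp P.Q.qSmooth_π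
  have h1 : ∀ r, tmap P.Q.M.toQ R (fun z => Gauge.mk (P.Q.π z) r) ⟨m, P.Q.liftField (P.invField σ) m⟩ =
      mkTangent R r (P.invVec σ p) := fun r => by
    refine (tmap_comp (hR.smooth_mk r) P.Q.qSmooth_π _).trans ?_
    exact congrArg (mkTangent R r) (P.Q.vec_liftField (P.invField σ) m)
  have h2 : (⟨Gauge.mk p p, X (Gauge.mk p p)⟩ : R.TB) = mkTangent R p (P.invVec σ p) := by
    refine (QStr.TB.mk_apply (Q := R) X (gauge_one_β p)).symm.trans ?_
    refine (congrArg (Sigma.mk _) (h (P.β p))).trans ?_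
    refine (mk_ehr hR (σ (P.β p))).trans ?_
    rw [← mk_invVec]
    rfl
  have h3 := hX.invariant (Gauge.mk p q) P.Q.M (fun z => Gauge.mk (P.Q.π z) p) (fun _ => rfl) hc m
    (P.Q.liftField (P.invField σ) m) (QStr.TB.eq_of_mk_eq ((h1 p).trans h2.symm))
  have h4 : ∀ z, P.gauge.mul (Gauge.mk (P.Q.π z) p) (Gauge.mk p q) rfl = Gauge.mk (P.Q.π z) q :=
    fun z => gauge_mul_mk _ _ _ _
  refine (QStr.TB.mk_apply (Q := R) X (h4 m)).symm.trans ((congrArg (Sigma.mk _) h3).symm.trans ?_)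
  exact (congrArg (fun f => tmap P.Q.M.toQ R f ⟨m, P.Q.liftField (P.invField σ) m⟩) (funext h4)).trans (h1 q)

theorem rightInvExt_ehr (hR : P.IsGaugeStr R) {σ : ∀ x, P.AtiyahFib x} (hσ : P.atiyah.IsSmoothSection σ) :
    P.gauge.rightInvExt R (fun x => ehr hR x (σ x)) = rightField R σ := by
  have h : ∃ X, P.gauge.IsRightInvariant R X ∧ ∀ x, X (P.gauge.one x) = (ehr hR x (σ x)).1 :=
    ⟨_, isRightInvariant_rightField hR hσ, fun x => QStr.TB.eq_of_mk_eq
      ((mk_rightField_one hR σ x).trans (mk_ehr hR (σ x)).symm)⟩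
  refine (dif_pos h).trans ?_
  funext a
  obtain ⟨p, q, rfl⟩ := Gauge.ind' P a
  exact QStr.TB.eq_of_mk_eq ((mk_of_isRightInvariant hR h.choose_spec.1 h.choose_spec.2 p q).trans
    (mk_rightField hR σ p q).symm)

/-- The map `p' ↦ [p', p]` relates each invariant field on `P` to the corresponding right-invariant
field, hence also their brackets; the equation is read at `p`. -/
theorem lieBracket_rightField (hR : P.IsGaugeStr R) {σ τ : ∀ x, P.AtiyahFib x}
    (hσ : P.atiyah.IsSmoothSection σ) (hτ : P.atiyah.IsSmoothSection τ) (x : P.N) :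
    R.lieBracket (rightField R σ) (rightField R τ) (P.gauge.one x) = (ehr hR x (P.atiyah.bracket σ τ x)).1 := by
  obtain ⟨p, rfl⟩ := P.surjective_β x
  refine QStr.TB.eq_of_mk_eq ?_
  refine (QStr.TB.mk_apply (Q := R) (R.lieBracket (rightField R σ) (rightField R τ)) (gauge_one_β p)).trans ?_
  refine Eq.trans ?_ (mk_ehr hR _).symm
  rw [← congrArg (ehrTotal hR) (mk_invVec (P.atiyah.bracket σ τ) p), ehrTotal_mk]
  have hrel : ∀ (ρ : ∀ x, P.AtiyahFib x) (q : P.P), tmapAt P.Q R (fun p' => Gauge.mk p' p) q (P.invField ρ q) =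
      rightField R ρ (Gauge.mk q p) := fun ρ q => QStr.TB.eq_of_mk_eq (mk_rightField hR ρ q p).symm
  have h := QStr.tmapAt_lieBracket_of_related ((hR.smooth_mk p).qSmoothAt p)
    (atiyah_isSmoothSection_iff.1 hσ) (atiyah_isSmoothSection_iff.1 hτ)
    (isSmoothField_rightField hR hσ) (isSmoothField_rightField hR hτ)
    (Filter.Eventually.of_forall (hrel σ)) (Filter.Eventually.of_forall (hrel τ))
  rw [← invField_bracket hσ hτ] at h
  exact (congrArg (Sigma.mk _) h).symm

theorem lie_isSmoothAt_iff {T : SmoothMfd.{u}} {c : T → Σ x, P.gauge.LieFib R x} {t : T} :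
    (P.gauge.lie R).IsSmoothAt c t ↔ SmoothNear T P.N (fun z => (c z).1) t ∧
      QSmoothAt T.toQ R.tangent (fun z => (⟨P.gauge.one (c z).1, (c z).2.1⟩ : R.TB)) t := by
  constructor
  · rintro ⟨W, hW, ht, h1, h2⟩
    exact ⟨h1.smoothNear hW ht, h2.qSmoothAt ht⟩
  · rintro ⟨h1, h2⟩
    obtain ⟨W, hW, ht, h2, h1⟩ := h2.exists_isOpen h1
    exact ⟨W, hW, ht, fun z hz => (h1 z hz).contMDiffWithinAt, h2⟩

/-- Smooth representatives are pushed forward by the jointly smooth map `mkTangent`; conversely the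
tangent map of `rho τ` recovers the lift over `τ`. Brackets agree because the right-invariant
extension of the image of a smooth section is `rightField` (`rightInvExt_ehr`). -/
theorem ehr_isStrictIso (hR : P.IsGaugeStr R) :
    LieAlgebroidData.IsStrictIso P.atiyah (P.gauge.lie R) (ehrEquiv hR) where
  smooth_iff {T} c t := by
    refine Iff.trans ?_ lie_isSmoothAt_iff.symm
    have he : ∀ z, (⟨P.gauge.one (c z).1, (ehrEquiv hR (c z).1 (c z).2).1⟩ : R.TB) = ehrTotal hR (c z).2.1 :=
      fun z => mk_ehr hR (c z).2
    constructor
    · intro h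
      refine ⟨atiyah_smooth_base h, ?_⟩
      obtain ⟨ĉ, hs, hc⟩ := atiyah_isSmoothAt_iff.1 h
      have hs1 := QSmoothAt.comp (QStr.qSmooth_tangent_fst.qSmoothAt _) hs
      refine QSmoothAt.congr (QSmoothAt.comp (f := fun z => (ĉ z, (ĉ z).1))
        ((qSmooth_mkTangent hR).qSmoothAt _) (hs.prodMk hs1)) ?_
      rw [SmoothMfd.nhd_toQ]
      filter_upwards [hc] with z hz
      exact (he z).trans (congrArg (ehrTotal hR) hz)
    · rintro ⟨h1, h2⟩
      have h2' : QSmoothAt T.toQ R.tangent (fun z => ehrTotal hR (c z).2.1) t :=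
        h2.congr (Filter.Eventually.of_forall fun z => (he z).symm)
      obtain ⟨p, hp⟩ := P.surjective_β (c t).1
      obtain ⟨τ, hτ, -⟩ := exists_localSection p
      rw [hp] at hτ
      have hτc : QSmoothAt T.toQ P.Q (fun z => τ (c z).1) t := QSmoothAt.comp hτ.smooth (qSmoothAt_toQ.2 h1)
      have hev : ∀ᶠ z in 𝓝 t, IsLocalSection τ (c z).1 := by
        have h3 := hτ.smooth.eventually
        rw [SmoothMfd.nhd_toQ] at h3
        filter_upwards [h1.continuousAt.eventually h3,
          h1.continuousAt.eventually hτ.right.eventually_nhds] with z h4 h5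
        exact ⟨h4, h5⟩
      refine (atiyah_isSmoothAt_iff_liftAt hτc (by filter_upwards [hev] with z hz using hz.self)).2 ?_
      have hρ : QSmoothAt R P.Q (rho τ) (ehrTotal hR (c t).2.1).1 := by
        refine hR.qSmoothAt_rho ?_
        have : gaugeS (ehrTotal hR (c t).2.1).1 = (c t).1 := by
          rw [← he t]
          exact P.gauge.s_one _
        rwa [this]
      refine QSmoothAt.congr (QSmoothAt.comp (f := fun z => ehrTotal hR (c z).2.1) hρ.tmap h2') ?_
      rw [SmoothMfd.nhd_toQ]
      filter_upwards [hev] with z hz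
      have hb : (c z).2.1.base = (c z).1 := (c z).2.2
      have := tmap_rho_ehrTotal hR (ξ := (c z).2.1) (by rw [hb]; exact hz)
      rw [hb] at this
      exact this.symm
  anchor x ξ := by
    obtain ⟨p, rfl⟩ := P.surjective_β x
    obtain ⟨v, rfl⟩ := (fibEquiv (rfl : P.β p = P.β p)).surjective ξ
    refine QStr.TB.eq_of_mk_eq (Q := P.N.toQ) ?_
    refine Eq.trans (b := tmap R P.N.toQ gaugeT ⟨P.gauge.one (P.β p), (ehr hR (P.β p) (fibEquiv rfl v)).1⟩)
      (QStr.TB.mk_vecAt _ _) ?_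
    refine (congrArg (tmap R P.N.toQ gaugeT) (mk_ehr hR (fibEquiv rfl v))).trans ?_
    refine (tmap_gaugeT_mkTangent hR p ⟨p, v⟩).trans ?_
    exact (atiyah_mk_anchor (fibEquiv rfl v)).symm
  bracket σ τ hσ hτ x := by
    have h := lieBracket_rightField hR hσ hτ x
    rw [← rightInvExt_ehr hR hσ, ← rightInvExt_ehr hR hτ] at h
    have hk : R.lieBracket (P.gauge.rightInvExt R (fun x => ehr hR x (σ x)))
        (P.gauge.rightInvExt R (fun x => ehr hR x (τ x))) (P.gauge.one x) ∈
        (tmapAt R P.N.toQ P.gauge.s (P.gauge.one x)).ker := by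
      rw [h]
      exact (ehr hR x (P.atiyah.bracket σ τ x)).2
    refine Eq.trans ?_ (dif_pos hk).symm
    exact Subtype.ext h.symm

end PrincipalQBundle

/-! ### Functoriality and naturality -/

theorem GroupoidOn.IsQGroupoidHom.mk_lieMap {M N : SmoothMfd.{u}} {Γ Δ : Type u} {𝒢 : GroupoidOn M Γ}
    {Q : QStr Γ} {ℋ : GroupoidOn N Δ} {R : QStr Δ} {φ : M → N} {Φ : Γ → Δ}
    (hΦ : GroupoidOn.IsQGroupoidHom 𝒢 Q ℋ R φ Φ) (h𝒢 : 𝒢.IsQGroupoid Q) (hℋ : ℋ.IsQGroupoid R)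
    (x : M) (v : 𝒢.LieFib Q x) :
    (⟨ℋ.one (φ x), (hΦ.lieMap h𝒢 hℋ x v).1⟩ : R.TB) = tmap Q R Φ ⟨𝒢.one x, v.1⟩ :=
  QStr.TB.mk_vecAt _ _

namespace PrincipalQBundle
variable {P P₁ P₂ P₃ : PrincipalQBundle.{u}}

/-- The composites of `p' ↦ [p', p]` with the gauge map and of `F` with `p' ↦ [p', F p]` are the
same map; both sides are its tangent map by the chain rule. -/
theorem Hom.tmap_gauge_ehrTotal (F : P₁ ⟶ P₂) {R₁ : QStr P₁.Gauge} {R₂ : QStr P₂.Gauge}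
    (hR₁ : P₁.IsGaugeStr R₁) (hR₂ : P₂.IsGaugeStr R₂) (ξ : P₁.Atiyah) :
    tmap R₁ R₂ (Hom.gauge F) (ehrTotal hR₁ ξ) = ehrTotal hR₂ (Hom.atiyahTotal F ξ) := by
  obtain ⟨w, rfl⟩ : ∃ w, Atiyah.mk w = ξ := Quotient.exists_rep ξ
  refine (tmap_comp (Hom.isQGroupoidHom F hR₁ hR₂).smooth (hR₁.smooth_mk w.1) w).symm.trans ?_
  exact tmap_comp (hR₂.smooth_mk (F.F w.1)) F.smooth_F w

theorem ehr_naturality (F : P₁ ⟶ P₂) {R₁ : QStr P₁.Gauge} {R₂ : QStr P₂.Gauge}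
    (hR₁ : P₁.IsGaugeStr R₁) (hR₂ : P₂.IsGaugeStr R₂) (h₁ : P₁.gauge.IsQGroupoid R₁)
    (h₂ : P₂.gauge.IsQGroupoid R₂)
    (hF : GroupoidOn.IsQGroupoidHom P₁.gauge R₁ P₂.gauge R₂ F.f (Hom.gauge F)) (x : P₁.N) (ξ : P₁.AtiyahFib x) :
    ehr hR₂ (F.f x) (Hom.atiyah F x ξ) = hF.lieMap h₁ h₂ x (ehr hR₁ x ξ) := by
  refine Subtype.ext (QStr.TB.eq_of_mk_eq ((mk_ehr hR₂ (Hom.atiyah F x ξ)).trans ?_))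
  refine Eq.trans ?_ (hF.mk_lieMap h₁ h₂ x (ehr hR₁ x ξ)).symm
  refine Eq.trans ?_ (congrArg (tmap R₁ R₂ (Hom.gauge F)) (mk_ehr hR₁ ξ)).symm
  exact (Hom.tmap_gauge_ehrTotal F hR₁ hR₂ ξ.1).symm

/-- By naturality this map is the Atiyah map of `F` conjugated by the Ehresmann isomorphisms, so it
inherits the morphism property. -/
theorem lieMap_isHom (F : P₁ ⟶ P₂) {R₁ : QStr P₁.Gauge} {R₂ : QStr P₂.Gauge}
    (hR₁ : P₁.IsGaugeStr R₁) (hR₂ : P₂.IsGaugeStr R₂) (h₁ : P₁.gauge.IsQGroupoid R₁)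
    (h₂ : P₂.gauge.IsQGroupoid R₂)
    (hF : GroupoidOn.IsQGroupoidHom P₁.gauge R₁ P₂.gauge R₂ F.f (Hom.gauge F)) :
    (P₁.gauge.lie R₁).IsHom (P₂.gauge.lie R₂) F.f (hF.lieMap h₁ h₂) :=
  (ehr_isStrictIso hR₁).isHom (ehr_isStrictIso hR₂) (Hom.atiyah_isHom F)
    fun x v => (ehr_naturality F hR₁ hR₂ h₁ h₂ hF x v).symm

theorem Hom.atiyahTotal_id (P : PrincipalQBundle.{u}) : Hom.atiyahTotal (𝟙 P) = id := by
  funext ξ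
  obtain ⟨w, rfl⟩ : ∃ w, Atiyah.mk w = ξ := Quotient.exists_rep ξ
  exact congrArg Atiyah.mk (tmap_id P.Q w)

theorem Hom.gauge_id (P : PrincipalQBundle.{u}) : Hom.gauge (𝟙 P) = id := by
  funext a
  obtain ⟨p, q, rfl⟩ := Gauge.ind' P a
  rfl

theorem Hom.atiyahTotal_comp (F : P₁ ⟶ P₂) (F' : P₂ ⟶ P₃) :
    Hom.atiyahTotal (F ≫ F') = Hom.atiyahTotal F' ∘ Hom.atiyahTotal F := by
  funext ξ
  obtain ⟨w, rfl⟩ : ∃ w, Atiyah.mk w = ξ := Quotient.exists_rep ξ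
  exact congrArg Atiyah.mk (tmap_comp F'.smooth_F F.smooth_F w)

theorem Hom.gauge_comp (F : P₁ ⟶ P₂) (F' : P₂ ⟶ P₃) :
    Hom.gauge (F ≫ F') = Hom.gauge F' ∘ Hom.gauge F := by
  funext a
  obtain ⟨p, q, rfl⟩ := Gauge.ind' P₁ a
  rfl

theorem ehr_isIso {R : QStr P.Gauge} (hR : P.IsGaugeStr R) : P.atiyah.IsIso (P.gauge.lie R) (ehr hR) := by
  have hid : (fun x v => Hom.atiyah (𝟙 P) x v) = fun (x : P.N) (v : P.AtiyahFib x) => v := by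
    funext x v
    exact Subtype.ext (congrFun (Hom.atiyahTotal_id P) v.1)
  have h : P.atiyah.IsHom P.atiyah (fun x => x) (fun x v => Hom.atiyah (𝟙 P) x v) := Hom.atiyah_isHom (𝟙 P)
  exact (ehr_isStrictIso hR).isIso (Eq.mp (congrArg
    (fun Φ : ∀ x, P.atiyah.Fib x → P.atiyah.Fib x => P.atiyah.IsHom P.atiyah (fun x => x) Φ) hid) h)

theorem lie_isLieAlgebroid {R : QStr P.Gauge} (hR : P.IsGaugeStr R) : (P.gauge.lie R).IsLieAlgebroid :=
  (ehr_isStrictIso hR).isLieAlgebroid (atiyah_isLieAlgebroid P)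
    (fun _ _ hσ hτ => atiyah_isSmoothSection_add hσ hτ) fun _ _ hf hσ => atiyah_isSmoothSection_smul hf hσ

end PrincipalQBundle

/-! ### The theorem -/

theorem theorem8p6 :
    (∀ P : PrincipalQBundle.{u}, ∃ R, P.IsGaugeStr R) ∧
    (∀ (P : PrincipalQBundle.{u}) (R R' : QStr P.Gauge), P.IsGaugeStr R → P.IsGaugeStr R' →
      QSmooth R R' (fun a => a)) ∧
    (∀ P : PrincipalQBundle.{u}, P.atiyah.IsLieAlgebroid) ∧
    (∀ (P : PrincipalQBundle.{u}) (R : QStr P.Gauge) (hR : P.IsGaugeStr R),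
      P.gauge.IsQGroupoid R ∧ P.gauge.IsLocallyTrivial R ∧ (P.gauge.lie R).IsLieAlgebroid ∧
      P.atiyah.IsIso (P.gauge.lie R) (PrincipalQBundle.ehr hR) ∧
      ∀ (p : P.P) (v : P.Q.TSpace p),
        (⟨P.gauge.one (P.β p),
          (PrincipalQBundle.ehr hR (P.β p) ⟨PrincipalQBundle.Atiyah.mk ⟨p, v⟩, rfl⟩).1⟩ : R.TB) =
          tmap P.Q R (fun p' => PrincipalQBundle.Gauge.mk p' p) ⟨p, v⟩) ∧
    (∀ (P₁ P₂ : PrincipalQBundle.{u}) (F : P₁ ⟶ P₂),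
      P₁.atiyah.IsHom P₂.atiyah F.f (PrincipalQBundle.Hom.atiyah F)) ∧
    (∀ (P₁ P₂ : PrincipalQBundle.{u}) (F : P₁ ⟶ P₂) (R₁ : QStr P₁.Gauge) (R₂ : QStr P₂.Gauge)
      (hR₁ : P₁.IsGaugeStr R₁) (hR₂ : P₂.IsGaugeStr R₂),
      GroupoidOn.IsQGroupoidHom P₁.gauge R₁ P₂.gauge R₂ F.f (PrincipalQBundle.Hom.gauge F) ∧
      ∀ (h₁ : P₁.gauge.IsQGroupoid R₁) (h₂ : P₂.gauge.IsQGroupoid R₂)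
        (hF : GroupoidOn.IsQGroupoidHom P₁.gauge R₁ P₂.gauge R₂ F.f (PrincipalQBundle.Hom.gauge F)),
        (P₁.gauge.lie R₁).IsHom (P₂.gauge.lie R₂) F.f (hF.lieMap h₁ h₂) ∧
        ∀ (x : P₁.N) (ξ : P₁.AtiyahFib x),
          PrincipalQBundle.ehr hR₂ (F.f x) (PrincipalQBundle.Hom.atiyah F x ξ) =
            hF.lieMap h₁ h₂ x (PrincipalQBundle.ehr hR₁ x ξ)) ∧
    (∀ P : PrincipalQBundle.{u},
      PrincipalQBundle.Hom.atiyahTotal (𝟙 P) = id ∧ PrincipalQBundle.Hom.gauge (𝟙 P) = id ∧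
      ∀ (R : QStr P.Gauge) (h : P.gauge.IsQGroupoid R)
        (hI : GroupoidOn.IsQGroupoidHom P.gauge R P.gauge R (fun x => x)
          (PrincipalQBundle.Hom.gauge (𝟙 P))) (x : P.N) (v : P.gauge.LieFib R x),
        hI.lieMap h h x v = v) ∧
    (∀ (P₁ P₂ P₃ : PrincipalQBundle.{u}) (F : P₁ ⟶ P₂) (F' : P₂ ⟶ P₃),
      PrincipalQBundle.Hom.atiyahTotal (F ≫ F') =
        PrincipalQBundle.Hom.atiyahTotal F' ∘ PrincipalQBundle.Hom.atiyahTotal F ∧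
      PrincipalQBundle.Hom.gauge (F ≫ F') =
        PrincipalQBundle.Hom.gauge F' ∘ PrincipalQBundle.Hom.gauge F ∧
      ∀ (R₁ : QStr P₁.Gauge) (R₂ : QStr P₂.Gauge) (R₃ : QStr P₃.Gauge)
        (h₁ : P₁.gauge.IsQGroupoid R₁) (h₂ : P₂.gauge.IsQGroupoid R₂) (h₃ : P₃.gauge.IsQGroupoid R₃)
        (hF : GroupoidOn.IsQGroupoidHom P₁.gauge R₁ P₂.gauge R₂ F.f (PrincipalQBundle.Hom.gauge F))
        (hF' : GroupoidOn.IsQGroupoidHom P₂.gauge R₂ P₃.gauge R₃ F'.f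
          (PrincipalQBundle.Hom.gauge F'))
        (hC : GroupoidOn.IsQGroupoidHom P₁.gauge R₁ P₃.gauge R₃ (fun x => F'.f (F.f x))
          (PrincipalQBundle.Hom.gauge (F ≫ F')))
        (x : P₁.N) (v : P₁.gauge.LieFib R₁ x),
        hC.lieMap h₁ h₃ x v = hF'.lieMap h₂ h₃ (F.f x) (hF.lieMap h₁ h₂ x v)) := by
  refine ⟨fun P => ⟨_, PrincipalQBundle.isGaugeStr_glue⟩, fun P R R' hR hR' => hR.qSmooth_id hR',
    PrincipalQBundle.atiyah_isLieAlgebroid, fun P R hR => ⟨hR.isQGroupoid, hR.isLocallyTrivial,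
      PrincipalQBundle.lie_isLieAlgebroid hR, PrincipalQBundle.ehr_isIso hR, fun p v =>
      PrincipalQBundle.mk_ehr hR _⟩, fun P₁ P₂ F => PrincipalQBundle.Hom.atiyah_isHom F,
    fun P₁ P₂ F R₁ R₂ hR₁ hR₂ => ⟨PrincipalQBundle.Hom.isQGroupoidHom F hR₁ hR₂, fun h₁ h₂ hF =>
      ⟨PrincipalQBundle.lieMap_isHom F hR₁ hR₂ h₁ h₂ hF,
        PrincipalQBundle.ehr_naturality F hR₁ hR₂ h₁ h₂ hF⟩⟩,
    fun P => ⟨PrincipalQBundle.Hom.atiyahTotal_id P, PrincipalQBundle.Hom.gauge_id P,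
      fun R h hI x v => ?_⟩,
    fun P₁ P₂ P₃ F F' => ⟨PrincipalQBundle.Hom.atiyahTotal_comp F F',
      PrincipalQBundle.Hom.gauge_comp F F', fun R₁ R₂ R₃ h₁ h₂ h₃ hF hF' hC x v => ?_⟩⟩
  -- Both functor laws on the Lie algebroids are compared on total spaces, where they are the
  -- functor laws of the tangent map.
  · refine Subtype.ext (QStr.TB.eq_of_mk_eq ((hI.mk_lieMap h h x v).trans ?_))
    rw [PrincipalQBundle.Hom.gauge_id]
    exact tmap_id R _
  · refine Subtype.ext (QStr.TB.eq_of_mk_eq ((hC.mk_lieMap h₁ h₃ x v).trans ?_))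
    refine Eq.trans ?_ (hF'.mk_lieMap h₂ h₃ _ _).symm
    refine Eq.trans ?_ (congrArg (tmap R₂ R₃ (PrincipalQBundle.Hom.gauge F')) (hF.mk_lieMap h₁ h₂ x v)).symm
    rw [PrincipalQBundle.Hom.gauge_comp]
    exact tmap_comp hF'.smooth hF.smooth _
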